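/- For $\sigma\ge 0$, $s\ge 0$ let $G^{\sigma,s}$ be the space of $f\in L^2(\mathbb R)$ with $\|f\|_{G^{\sigma,s}}=\big\|e^{\sigma|\xi|}\langle\xi\rangle^s\widehat f(\xi)\big\|_{L^2_\xi}<\infty$, where $\widehat f(\xi)=\int_{\mathbb R} e^{-ix\xi}f(x)\,dx$ and $\langle\xi\rangle=(1+\xi^2)^{1/2}$; thus $G^{0,s}=H^s$. Let $\langle D_x\rangle^{-1}$ be the Fourier multiplier with symbol $\langle\xi\rangle^{-1}$. For masses $M,m\ge 0$ consider the Dirac–Klein–Gordon system on $\mathbb R^{1+1}$, $$(-i\gamma^0\partial_t-i\gamma^1\partial_x+M)\psi=\phi\psi,\qquad (\partial_t^2-\partial_x^2+m^2)\phi=\psi^*\gamma^0\psi,$$ with $\psi$ taking values in $\mathbb C^2$, $\phi$ real-valued, $\gamma^0=\begin{pmatrix}0&1\\1&0\end{pmatrix}$, $\gamma^1=\begin{pmatrix}0&-1\\1&0\end{pmatrix}$, and initial condition $\psi(0)=\psi_0=(f_+,f_-)^T$, $\phi(0)=\phi_0$, $\partial_t\phi(0)=\phi_1$. **Theorem.**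 For all $M,m\ge 0$ there is a constant $c_0>0$, depending only on $M$ and $m$, such that the following holds. Let $\sigma_0>0$ and $$(\psi_0,\phi_0,\phi_1)\in X_0:=G^{\sigma_0,0}(\mathbb R;\mathbb C^2)\times G^{\sigma_0,1}(\mathbb R;\mathbb R)\times G^{\sigma_0,0}(\mathbb R;\mathbb R),$$ and put $$\delta=\frac{c_0}{1+a_0^2+b_0},\qquad a_0=\|f_+\|_{G^{\sigma_0,0}}+\|f_-\|_{G^{\sigma_0,0}},\qquad b_0=\|g_+\|_{G^{\sigma_0,1}}+\|g_-\|_{G^{\sigma_0,1}},$$ where $g_\pm=\tfrac12\big(\phi_0\pm i\langle D_x\rangle^{-1}\phi_1\big)$. Then $\delta>0$, and the Cauchy problem has a solution on $[0,\delta]\times\mathbb R$ (in the sense of distributions) with $$(\psi,\phi,\partial_t\phi)\in C([0,\delta];X_0).$$ It is the only solution on $[0,\delta]\times\mathbb R$ with these data for which $(\psi,\phi,\partial_t\phi)\in C\big([0,\delta];L^2(\mathbb R;\mathbb C^2)\times H^1(\mathbb R;\mathbb R)\times L^2(\mathbb R;\mathbb R)\big)$. -/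

import Mathlib

open MeasureTheory Filter Topology
open scoped FourierTransform SchwartzMap ENNReal Matrix

namespace DKG

noncomputable section

/-- The space `L²(ℝ; ℂ)`. -/
abbrev L2 : Type := Lp ℂ 2 (volume : Measure ℝ)

/-- The weight `⟨ξ⟩ = (1 + ξ²)^{1/2}`. -/
def jap (ξ : ℝ) : ℝ := Real.sqrt (1 + ξ ^ 2)

/-- The Fourier transform with the normalization `∫ e^{-i x ξ} f(x) dx`. Mathlib's `𝓕` has
`e^{-2 π i x ξ}`, which accounts for the rescaling of the argument. -/
def hat (f : L2) (ξ : ℝ) : ℂ := (𝓕 f : L2) (ξ / (2 * Real.pi))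

/-- The norm of `G^{σ,s}`, with values in `[0, ∞]`: the `L²` norm of
`e^{σ|ξ|} ⟨ξ⟩^s (hat f)(ξ)`. -/
def gevreyENorm (σ s : ℝ) (f : L2) : ℝ≥0∞ :=
  eLpNorm (fun ξ : ℝ => ((Real.exp (σ * |ξ|) * jap ξ ^ s : ℝ) : ℂ) * hat f ξ) 2 volume

/-- `f ∈ G^{σ,s}`, for `f ∈ L²` (for `σ > 0`, or `σ = 0` and `s ≥ 0`, all elements of
`G^{σ,s}` are in `L²`). -/
def MemGevrey (σ s : ℝ) (f : L2) : Prop := gevreyENorm σ s f < ∞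

/-- The norm of `G^{σ,s}` as a real number (meaningful for elements of `G^{σ,s}`). -/
def gevreyNorm (σ s : ℝ) (f : L2) : ℝ := (gevreyENorm σ s f).toReal

/-- `f` is real-valued. -/
def IsRealValued (f : L2) : Prop := ∀ᵐ x : ℝ, (f x).im = 0

theorem memLp_japInv_mul (f : L2) :
    MemLp (fun η : ℝ => (((jap (2 * Real.pi * η))⁻¹ : ℝ) : ℂ) * f η) 2 volume := by
  have hc : Continuous fun η : ℝ => (((jap (2 * Real.pi * η))⁻¹ : ℝ) : ℂ) := by
    unfold jap
    refine Complex.continuous_ofReal.comp (Continuous.inv₀ (by fun_prop) fun η => ?_)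
    positivity
  refine MemLp.of_le (Lp.memLp f) (hc.aestronglyMeasurable.mul (Lp.aestronglyMeasurable f)) ?_
  refine Eventually.of_forall fun η => ?_
  have h1 : 1 ≤ jap (2 * Real.pi * η) := by
    unfold jap
    exact Real.one_le_sqrt.2 (by nlinarith [sq_nonneg (2 * Real.pi * η)])
  rw [norm_mul, Complex.norm_real, Real.norm_of_nonneg (inv_nonneg.2 (by linarith))]
  exact mul_le_of_le_one_left (norm_nonneg _) (inv_le_one_of_one_le₀ h1)

/-- The Fourier multiplier `⟨D_x⟩⁻¹`, whose symbol is `⟨ξ⟩⁻¹`; with Mathlib's frequency variable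
`η = ξ / (2π)` the symbol is `⟨2πη⟩⁻¹`. -/
def japInvD (f : L2) : L2 := 𝓕⁻ ((memLp_japInv_mul (𝓕 f)).toLp : L2)

/-- The Dirac matrix `γ⁰`. -/
def γ0 : Matrix (Fin 2) (Fin 2) ℂ := !![0, 1; 1, 0]

/-- The Dirac matrix `γ¹`. -/
def γ1 : Matrix (Fin 2) (Fin 2) ℂ := !![0, -1; 1, 0]

/-- A state of the system at a fixed time: the spinor `ψ = (ψ₊, ψ₋)`, the field `φ` and its
time derivative `φt`. -/
structure State where
  ψ : Fin 2 → L2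
  φ : L2
  φt : L2

/-- `u ∈ G^{σ,0}(ℝ; ℂ²) × G^{σ,1}(ℝ; ℝ) × G^{σ,0}(ℝ; ℝ)`. For `σ = 0` this space is
`L² × H¹ × L²`. -/
structure MemX (σ : ℝ) (u : State) : Prop where
  mem_ψ : ∀ i, MemGevrey σ 0 (u.ψ i)
  mem_φ : MemGevrey σ 1 u.φ
  mem_φt : MemGevrey σ 0 u.φt
  real_φ : IsRealValued u.φ
  real_φt : IsRealValued u.φt

/-- The distance of two states in the norm of `G^{σ,0} × G^{σ,1} × G^{σ,0}`. -/
def distX (σ : ℝ) (u v : State) : ℝ≥0∞ :=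
  (∑ i, gevreyENorm σ 0 (u.ψ i - v.ψ i)) + gevreyENorm σ 1 (u.φ - v.φ)
    + gevreyENorm σ 0 (u.φt - v.φt)

/-- `u ∈ C([0,T]; G^{σ,0} × G^{σ,1} × G^{σ,0})`. -/
def ContX (σ T : ℝ) (u : ℝ → State) : Prop :=
  (∀ t ∈ Set.Icc 0 T, MemX σ (u t)) ∧
    ∀ t ∈ Set.Icc 0 T, Tendsto (fun s => distX σ (u s) (u t)) (𝓝[Set.Icc 0 T] t) (𝓝 0)

/-- The (bilinear) pairing `∫ f η dx` with a test function. -/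
def pair (f : ℝ → ℂ) (η : ℝ → ℂ) : ℂ := ∫ x : ℝ, f x * η x

/-- `u = (ψ, φ, φt)` solves
`(-i γ⁰ ∂_t - i γ¹ ∂_x + M) ψ = φ ψ`, `(∂_t² - ∂_x² + m²) φ = ψ^* γ⁰ ψ`, `φt = ∂_t φ`
on `[0,T] × ℝ`, the equations being understood in the sense of distributions: for every test
function `η` of the variable `x` the pairings with `η` are differentiable in `t ∈ [0,T]`, and
the derivatives in `x` are moved to `η`. -/
structure IsSolution (M m T : ℝ) (u : ℝ → State) : Prop where
  dirac : ∀ η : 𝓢(ℝ, ℂ), ∀ t ∈ Set.Icc 0 T, ∀ i : Fin 2,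
    HasDerivWithinAt (fun s => -Complex.I * ∑ j, γ0 i j * pair ((u s).ψ j) η)
      (pair (fun x => (u t).φ x * (u t).ψ i x) η - M * pair ((u t).ψ i) η
        - Complex.I * ∑ j, γ1 i j * pair ((u t).ψ j) (deriv η)) (Set.Icc 0 T) t
  field : ∀ η : 𝓢(ℝ, ℂ), ∀ t ∈ Set.Icc 0 T,
    HasDerivWithinAt (fun s => pair (u s).φ η) (pair (u t).φt η) (Set.Icc 0 T) t
  wave : ∀ η : 𝓢(ℝ, ℂ), ∀ t ∈ Set.Icc 0 T,
    HasDerivWithinAt (fun s => pair (u s).φt η)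
      (pair (u t).φ (deriv (deriv η)) - m ^ 2 * pair (u t).φ η
        + pair (fun x => star (fun i => (u t).ψ i x) ⬝ᵥ (γ0 *ᵥ fun i => (u t).ψ i x)) η)
      (Set.Icc 0 T) t

/-- `a₀ = ‖f₊‖_{G^{σ,0}} + ‖f₋‖_{G^{σ,0}}` for the initial spinor `(f₊, f₋)`. -/
def spinorNorm (σ : ℝ) (u : State) : ℝ := gevreyNorm σ 0 (u.ψ 0) + gevreyNorm σ 0 (u.ψ 1)

/-- `g₊ = (φ₀ + i ⟨D_x⟩⁻¹ φ₁) / 2`. -/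
def gPlus (u : State) : L2 := (1 / 2 : ℂ) • (u.φ + Complex.I • japInvD u.φt)

/-- `g₋ = (φ₀ - i ⟨D_x⟩⁻¹ φ₁) / 2`. -/
def gMinus (u : State) : L2 := (1 / 2 : ℂ) • (u.φ - Complex.I • japInvD u.φt)

/-- `b₀ = ‖g₊‖_{G^{σ,1}} + ‖g₋‖_{G^{σ,1}}`. -/
def waveNorm (σ : ℝ) (u : State) : ℝ := gevreyNorm σ 1 (gPlus u) + gevreyNorm σ 1 (gMinus u)

/-- The lifespan `δ = c₀ / (1 + a₀² + b₀)`. -/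
def lifespan (c₀ σ : ℝ) (u : State) : ℝ := c₀ / (1 + spinorNorm σ u ^ 2 + waveNorm σ u)

end

end DKG

/-!
Local well-posedness of the Dirac–Klein–Gordon system in one space dimension, with data in Gevrey
spaces, on a time interval whose length depends only on `1 + a₀² + b₀`.

The argument is a normal form reduction. With `u = ψ₊`, `v = ψ₋`, `A = ∂ₜφ + (1 + ∂ₓ)φ` and
`B = ∂ₜφ - (1 + ∂ₓ)φ` the system becomes first order: `u` and `B` move to the right, `v` and `A`
to the left. The spinor has a source of the form `φ` times spinor, which is bounded on `L²`
because `φ = (1 + ∂ₓ)⁻¹ (A - B) / 2` is a bounded function. The source `2 Re(ū v)` of `A` and `B`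
is only integrable; but `u` and `v` travel in opposite directions, and this null structure makes
`ū v` a derivative along the characteristics: with `q = ((1 + ∂ₓ)⁻¹ ū) v` one has
`(∂ₜ - ∂ₓ) q = -2 ū v + products which are in L²` (`hasDerivWithinAt_dual_prod`). Hence
`A + Re q` and its analogue for `B` satisfy equations with sources in `L²`. In the interaction
picture the system is an ordinary differential equation in `(L²)⁴` with a vector field which is
Lipschitz on bounded sets (`vfield_lipschitz`), so Picard's theorem applies; the estimates are
homogeneous when the spinor has size `μ` and the wave variables have size `μ²`, which gives the
lifespan `c / μ²` (`exists_solution_vfield`).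

Everything takes place on the frequency side. The product with a function of the form
`(1 + ∂ₓ)⁻¹ a` is a superposition of frequency shifts, which makes sense as a Bochner integral since
the symbol of `(1 + ∂ₓ)⁻¹` is square integrable. Conjugating this product by the weight `e^{σ|ξ|}`
multiplies the shifts by the factor `e^{σ(|ξ| - |η| - |ξ - η|)} ≤ 1`, so all estimates
(`norm_prod_le`) hold uniformly in `σ`, and Gevrey data are treated as `L²` data.

Uniqueness is in the class `L² × H¹ × L²`. A distributional transport equation with continuous
source is a strong equation in the moving frame (`hasDerivWithinAt_of_transport`), so the normal form
variables of any solution solve the same ordinary differential equation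
(`hasDerivWithinAt_toPhase`).
-/

open scoped NNReal BoundedContinuousFunction

namespace DKG

noncomputable section

/-! ### Multiplication operators on the frequency side -/

theorem memLp_bcf_mul (m : ℝ →ᵇ ℂ) (F : L2) : MemLp (fun ξ => m ξ * F ξ) 2 volume :=
  (Lp.memLp F).of_le_mul (c := ‖m‖)
    (m.continuous.aestronglyMeasurable.mul (Lp.aestronglyMeasurable F))
    (Eventually.of_forall fun ξ => by
      rw [norm_mul]; gcongr; exact m.norm_coe_le_norm ξ)

/-- Multiplication by a bounded continuous symbol, as an operator on `L²`. On the frequency side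
this is the Fourier multiplier with that symbol. -/
def mulOp : (ℝ →ᵇ ℂ) →L[ℂ] L2 →L[ℂ] L2 :=
  LinearMap.mkContinuous₂ (LinearMap.mk₂ ℂ (fun m F => (memLp_bcf_mul m F).toLp)
    (fun m n F => by
      rw [← MemLp.toLp_add]
      exact MemLp.toLp_congr _ _ (Eventually.of_forall fun ξ => by simp [add_mul]))
    (fun c m F => by
      rw [← MemLp.toLp_const_smul]
      exact MemLp.toLp_congr _ _ (Eventually.of_forall fun ξ => by simp [mul_assoc]))
    (fun m F G => by
      rw [← MemLp.toLp_add]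
      refine MemLp.toLp_congr _ _ ?_
      filter_upwards [Lp.coeFn_add F G] with ξ h
      rw [Pi.add_apply, ← mul_add, h, Pi.add_apply])
    (fun c m F => by
      rw [← MemLp.toLp_const_smul]
      refine MemLp.toLp_congr _ _ ?_
      filter_upwards [Lp.coeFn_smul c F] with ξ h
      rw [Pi.smul_apply, h, Pi.smul_apply, smul_eq_mul, smul_eq_mul, mul_left_comm])) 1
      (fun m F => by
        rw [one_mul]
        refine Lp.norm_le_mul_norm_of_ae_le_mul ?_
        filter_upwards [(memLp_bcf_mul m F).coeFn_toLp] with ξ h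
        simp only [LinearMap.mk₂_apply, h, norm_mul]
        gcongr; exact m.norm_coe_le_norm ξ)

theorem coeFn_mulOp (m : ℝ →ᵇ ℂ) (F : L2) : mulOp m F =ᵐ[volume] fun ξ => m ξ * F ξ :=
  (memLp_bcf_mul m F).coeFn_toLp

theorem norm_mulOp_le {m : ℝ →ᵇ ℂ} {c : ℝ} (hm : ∀ ξ, ‖m ξ‖ ≤ c) (F : L2) :
    ‖mulOp m F‖ ≤ c * ‖F‖ := by
  refine Lp.norm_le_mul_norm_of_ae_le_mul ?_
  filter_upwards [coeFn_mulOp m F] with ξ h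
  rw [h, norm_mul]; gcongr; exact hm ξ

theorem norm_mulOp_eq {m : ℝ →ᵇ ℂ} (hm : ∀ ξ, ‖m ξ‖ = 1) (F : L2) : ‖mulOp m F‖ = ‖F‖ := by
  refine le_antisymm (by simpa using norm_mulOp_le (fun ξ => (hm ξ).le) F) ?_
  refine (Lp.norm_le_mul_norm_of_ae_le_mul (c := 1) ?_).trans_eq (one_mul _)
  filter_upwards [coeFn_mulOp m F] with ξ h
  rw [h, norm_mul, hm]; simp

theorem mulOp_mulOp (m n : ℝ →ᵇ ℂ) (F : L2) : mulOp m (mulOp n F) = mulOp (m * n) F := by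
  refine Lp.ext ?_
  filter_upwards [coeFn_mulOp m (mulOp n F), coeFn_mulOp n F, coeFn_mulOp (m * n) F]
    with ξ h1 h2 h3
  rw [h1, h2, h3, BoundedContinuousFunction.coe_mul, Pi.mul_apply, mul_assoc]

theorem mulOp_one (F : L2) : mulOp 1 F = F := by
  refine Lp.ext ?_
  filter_upwards [coeFn_mulOp 1 F] with ξ h
  rw [h]; simp

theorem mulOp_comm (m n : ℝ →ᵇ ℂ) (F : L2) : mulOp m (mulOp n F) = mulOp n (mulOp m F) := by
  rw [mulOp_mulOp, mulOp_mulOp, mul_comm]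

theorem mulOp_injective {m : ℝ →ᵇ ℂ} (hm : ∀ ξ, m ξ ≠ 0) : Function.Injective (mulOp m) := by
  intro F G h
  refine Lp.ext ?_
  have h' : mulOp m F =ᵐ[volume] mulOp m G := by rw [h]
  filter_upwards [coeFn_mulOp m F, coeFn_mulOp m G, h'] with ξ h1 h2 h3
  exact mul_left_cancel₀ (hm ξ) (h1 ▸ h2 ▸ h3)

/-- Dominated convergence for multiplication operators: uniformly bounded symbols which tend to
zero pointwise give operators which tend to zero strongly. -/
theorem tendsto_mulOp_zero {ι : Type*} {l : Filter ι} [l.IsCountablyGenerated]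
    {m : ι → (ℝ →ᵇ ℂ)} {c : ℝ} (hc : ∀ᶠ i in l, ∀ ξ, ‖m i ξ‖ ≤ c)
    (h0 : ∀ ξ, Tendsto (fun i => m i ξ) l (𝓝 0)) (F : L2) :
    Tendsto (fun i => mulOp (m i) F) l (𝓝 0) := by
  rw [Lp.tendsto_Lp_iff_tendsto_eLpNorm']
  have key : ∀ i, eLpNorm (⇑(mulOp (m i) F) - ⇑(0 : L2)) 2 volume
      = (∫⁻ ξ, ‖m i ξ * (Lp.aestronglyMeasurable F).mk F ξ‖ₑ ^ (2 : ℝ)) ^ (1 / 2 : ℝ) := by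
    intro i
    rw [eLpNorm_eq_lintegral_rpow_enorm_toReal (by norm_num) (by norm_num)]
    simp only [ENNReal.toReal_ofNat]
    congr 1
    refine lintegral_congr_ae ?_
    filter_upwards [coeFn_mulOp (m i) F, (Lp.aestronglyMeasurable F).ae_eq_mk] with ξ h1 h3
    simp [h1, ← h3]
  simp_rw [key]
  have hmeas : StronglyMeasurable ((Lp.aestronglyMeasurable F).mk F) :=
    (Lp.aestronglyMeasurable F).stronglyMeasurable_mk
  have hT := tendsto_lintegral_filter_of_dominated_convergence (μ := (volume : Measure ℝ)) (l := l)
    (F := fun i ξ => ‖m i ξ * (Lp.aestronglyMeasurable F).mk F ξ‖ₑ ^ (2 : ℝ)) (f := fun _ => 0)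
    (fun ξ => ENNReal.ofReal c ^ (2 : ℝ) * ‖F ξ‖ₑ ^ (2 : ℝ)) ?_ ?_ ?_ ?_
  · have := (ENNReal.continuous_rpow_const (y := (1 / 2 : ℝ))).tendsto 0 |>.comp
      (by simpa using hT)
    simpa [Function.comp_def] using this
  · refine Eventually.of_forall fun i => ?_
    exact (((m i).continuous.stronglyMeasurable.mul hmeas).enorm).pow_const _
  · filter_upwards [hc] with i hi
    filter_upwards [(Lp.aestronglyMeasurable F).ae_eq_mk] with ξ h3
    rw [← h3, enorm_mul, ENNReal.mul_rpow_of_nonneg _ _ (by norm_num)]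
    gcongr
    rw [← ofReal_norm]
    exact ENNReal.ofReal_le_ofReal (hi ξ)
  · rw [lintegral_const_mul' _ _ (by
      exact ENNReal.rpow_ne_top_of_nonneg (by norm_num) ENNReal.ofReal_ne_top)]
    refine ENNReal.mul_ne_top (ENNReal.rpow_ne_top_of_nonneg (by norm_num)
      ENNReal.ofReal_ne_top) ?_
    have := lintegral_rpow_enorm_lt_top_of_eLpNorm_lt_top (p := 2) (by norm_num) (by norm_num)
      (Lp.eLpNorm_lt_top F)
    simpa using this.ne
  · refine Eventually.of_forall fun ξ => ?_
    have h1 : Tendsto (fun i => m i ξ * (Lp.aestronglyMeasurable F).mk F ξ) l (𝓝 0) := by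
      simpa using (h0 ξ).mul_const ((Lp.aestronglyMeasurable F).mk F ξ)
    have h2 := (ENNReal.continuous_rpow_const (y := (2 : ℝ))).tendsto _ |>.comp
      (continuous_enorm.tendsto _ |>.comp h1)
    simpa [Function.comp_def] using h2

/-! ### The symbols of translations, of `(1 + ∂ₓ)⁻¹` and of the Gevrey weight -/

/-- The symbol `e^{-2πitη}` of the translation `f ↦ f(· - t)`. -/
def trSymb (t : ℝ) : ℝ →ᵇ ℂ :=
  BoundedContinuousFunction.ofNormedAddCommGroup
    (fun ξ => Complex.exp (((-(2 * Real.pi * ξ * t) : ℝ) : ℂ) * Complex.I))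
    (by fun_prop) 1 (fun ξ => (Complex.norm_exp_ofReal_mul_I _).le)

theorem trSymb_apply (t ξ : ℝ) :
    trSymb t ξ = Complex.exp (((-(2 * Real.pi * ξ * t) : ℝ) : ℂ) * Complex.I) := rfl

theorem norm_trSymb (t ξ : ℝ) : ‖trSymb t ξ‖ = 1 := Complex.norm_exp_ofReal_mul_I _

theorem trSymb_add (s t : ℝ) : trSymb (s + t) = trSymb s * trSymb t := by
  ext ξ
  simp only [BoundedContinuousFunction.coe_mul, Pi.mul_apply, trSymb_apply, ← Complex.exp_add]
  congr 1; push_cast; ring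

theorem trSymb_zero : trSymb 0 = 1 := by
  ext ξ; simp [trSymb_apply]

theorem one_add_ne_zero (ξ : ℝ) : (1 + ((2 * Real.pi * ξ : ℝ) : ℂ) * Complex.I) ≠ 0 := by
  intro h
  have := congrArg Complex.re h
  simp at this

theorem norm_one_add (ξ : ℝ) :
    ‖1 + ((2 * Real.pi * ξ : ℝ) : ℂ) * Complex.I‖ = jap (2 * Real.pi * ξ) := by
  rw [Complex.norm_def, jap, Complex.normSq_apply]
  congr 1
  simp
  ring

theorem one_le_jap (ξ : ℝ) : 1 ≤ jap ξ := by
  unfold jap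
  exact Real.one_le_sqrt.2 (by nlinarith [sq_nonneg ξ])

theorem abs_le_jap (ξ : ℝ) : |ξ| ≤ jap ξ := by
  unfold jap
  exact Real.abs_le_sqrt (by linarith)

/-- The symbol `1 / (1 + 2πiη)` of `(1 + ∂ₓ)⁻¹`; its modulus is `⟨2πη⟩⁻¹`. -/
def lamSymb : ℝ →ᵇ ℂ :=
  BoundedContinuousFunction.ofNormedAddCommGroup
    (fun ξ => (1 + ((2 * Real.pi * ξ : ℝ) : ℂ) * Complex.I)⁻¹)
    (Continuous.inv₀ (by fun_prop) one_add_ne_zero) 1 (fun ξ => by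
      rw [norm_inv, norm_one_add]
      exact inv_le_one_of_one_le₀ (one_le_jap _))

theorem lamSymb_apply (ξ : ℝ) :
    lamSymb ξ = (1 + ((2 * Real.pi * ξ : ℝ) : ℂ) * Complex.I)⁻¹ := rfl

theorem norm_lamSymb (ξ : ℝ) : ‖lamSymb ξ‖ = (jap (2 * Real.pi * ξ))⁻¹ := by
  rw [lamSymb_apply, norm_inv, norm_one_add]

theorem norm_lamSymb_le (ξ : ℝ) : ‖lamSymb ξ‖ ≤ 1 := by
  rw [norm_lamSymb]; exact inv_le_one_of_one_le₀ (one_le_jap _)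

theorem lamSymb_ne_zero (ξ : ℝ) : lamSymb ξ ≠ 0 := inv_ne_zero (one_add_ne_zero ξ)

theorem one_sub_lamSymb (ξ : ℝ) :
    1 - lamSymb ξ = ((2 * Real.pi * ξ : ℝ) : ℂ) * Complex.I * lamSymb ξ := by
  have h := mul_inv_cancel₀ (one_add_ne_zero ξ)
  rw [lamSymb_apply]
  linear_combination -h

theorem norm_freq_mul_lamSymb_le (ξ : ℝ) :
    ‖((2 * Real.pi * ξ : ℝ) : ℂ) * Complex.I * lamSymb ξ‖ ≤ 1 := by
  rw [norm_mul, norm_mul, norm_lamSymb, Complex.norm_I, mul_one, Complex.norm_real,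
    Real.norm_eq_abs, ← div_eq_mul_inv, div_le_one (by linarith [one_le_jap (2 * Real.pi * ξ)])]
  exact abs_le_jap _

theorem memLp_lamSymb : MemLp (fun ξ => lamSymb ξ) 2 volume := by
  rw [memLp_two_iff_integrable_sq_norm lamSymb.continuous.aestronglyMeasurable]
  have h : (fun ξ : ℝ => ‖lamSymb ξ‖ ^ 2) = fun ξ : ℝ => (1 + (2 * Real.pi * ξ) ^ 2)⁻¹ := by
    funext ξ
    rw [norm_lamSymb, jap, inv_pow, Real.sq_sqrt (by positivity)]
  rw [h]
  exact integrable_inv_one_add_sq.comp_mul_left' (by positivity : (2 * Real.pi : ℝ) ≠ 0)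

/-- The decaying weight `e^{-2πσ|η|}`, which maps `L²` onto the Fourier transforms of the
elements of `G^{σ,0}`. -/
def wtSymb (σ : ℝ≥0) : ℝ →ᵇ ℂ :=
  BoundedContinuousFunction.ofNormedAddCommGroup
    (fun ξ => ((Real.exp (-(σ * |2 * Real.pi * ξ|)) : ℝ) : ℂ))
    (by fun_prop) 1 (fun ξ => by
      rw [Complex.norm_real, Real.norm_eq_abs, Real.abs_exp, Real.exp_le_one_iff]
      simp only [Left.neg_nonpos_iff]; positivity)

theorem wtSymb_apply (σ : ℝ≥0) (ξ : ℝ) :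
    wtSymb σ ξ = ((Real.exp (-(σ * |2 * Real.pi * ξ|)) : ℝ) : ℂ) := rfl

theorem wtSymb_ne_zero (σ : ℝ≥0) (ξ : ℝ) : wtSymb σ ξ ≠ 0 := by
  rw [wtSymb_apply]; exact_mod_cast (Real.exp_pos _).ne'

theorem wtSymb_zero : wtSymb 0 = 1 := by
  ext ξ; simp [wtSymb_apply]

/-! ### The translation group -/

/-- Translation by `t`, acting on the Fourier transform. -/
abbrev tr (t : ℝ) : L2 →L[ℂ] L2 := mulOp (trSymb t)

/-- The smoothing operator `(1 + ∂ₓ)⁻¹`, acting on the Fourier transform. -/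
abbrev lam : L2 →L[ℂ] L2 := mulOp lamSymb

theorem norm_tr (t : ℝ) (F : L2) : ‖tr t F‖ = ‖F‖ := norm_mulOp_eq (norm_trSymb t) F

theorem tr_tr (s t : ℝ) (F : L2) : tr s (tr t F) = tr (s + t) F := by
  rw [mulOp_mulOp, ← trSymb_add]

theorem tr_zero (F : L2) : tr 0 F = F := by
  simp only [tr, trSymb_zero, mulOp_one]

theorem tr_neg_tr (t : ℝ) (F : L2) : tr (-t) (tr t F) = F := by
  rw [tr_tr, neg_add_cancel, tr_zero]

theorem tr_tr_neg (t : ℝ) (F : L2) : tr t (tr (-t) F) = F := by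
  rw [tr_tr, add_neg_cancel, tr_zero]

theorem norm_lam_le (F : L2) : ‖lam F‖ ≤ ‖F‖ := by
  simpa using norm_mulOp_le norm_lamSymb_le F

theorem continuous_trSymb_apply (ξ : ℝ) : Continuous fun t => trSymb t ξ := by
  simp only [trSymb_apply]; fun_prop

theorem continuous_tr (F : L2) : Continuous fun t => tr t F := by
  refine continuous_iff_continuousAt.2 fun t => ?_
  rw [ContinuousAt, tendsto_iff_norm_sub_tendsto_zero, ← tendsto_zero_iff_norm_tendsto_zero]
  have h := tendsto_mulOp_zero (l := 𝓝 t) (m := fun s => trSymb s - trSymb t) (c := 2)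
    (Eventually.of_forall fun s ξ => ?_) (fun ξ => ?_) F
  · simpa using h
  · rw [BoundedContinuousFunction.coe_sub, Pi.sub_apply]
    refine (norm_sub_le _ _).trans ?_
    rw [norm_trSymb, norm_trSymb]; norm_num
  · have := ((continuous_trSymb_apply ξ).tendsto t).sub_const (trSymb t ξ)
    simpa using this

/-- Joint continuity of the translation group. -/
theorem tendsto_tr {ι : Type*} {l : Filter ι} {c : ι → ℝ} {F : ι → L2} {c₀ : ℝ} {F₀ : L2}
    (hc : Tendsto c l (𝓝 c₀)) (hF : Tendsto F l (𝓝 F₀)) :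
    Tendsto (fun i => tr (c i) (F i)) l (𝓝 (tr c₀ F₀)) := by
  have h1 : Tendsto (fun i => tr (c i) F₀) l (𝓝 (tr c₀ F₀)) :=
    ((continuous_tr F₀).tendsto c₀).comp hc
  have h2 : Tendsto (fun i => tr (c i) (F i - F₀)) l (𝓝 0) := by
    rw [tendsto_zero_iff_norm_tendsto_zero]
    simp_rw [norm_tr]
    exact tendsto_iff_norm_sub_tendsto_zero.1 hF
  simpa using h2.add h1

/-- The difference quotient bound behind `d/dt (1+∂ₓ)⁻¹ τ_t = -∂ₓ (1+∂ₓ)⁻¹ τ_t`. -/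
theorem norm_trSymb_sub_one_mul_lamSymb_le (h ξ : ℝ) :
    ‖(trSymb h ξ - 1) * lamSymb ξ‖ ≤ |h| := by
  have h1 : ‖trSymb h ξ - 1‖ ≤ |2 * Real.pi * ξ * h| := by
    have := Real.norm_exp_I_mul_ofReal_sub_one_le (x := -(2 * Real.pi * ξ * h))
    rw [trSymb_apply, mul_comm]
    simpa using this
  rw [norm_mul]
  calc ‖trSymb h ξ - 1‖ * ‖lamSymb ξ‖ ≤ |2 * Real.pi * ξ * h| * ‖lamSymb ξ‖ := by gcongr
    _ = |h| * ‖((2 * Real.pi * ξ : ℝ) : ℂ) * Complex.I * lamSymb ξ‖ := by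
        rw [norm_mul, norm_mul, Complex.norm_I, Complex.norm_real, Real.norm_eq_abs, abs_mul]
        ring
    _ ≤ |h| * 1 := by gcongr; exact norm_freq_mul_lamSymb_le ξ
    _ = |h| := mul_one _

/-- On the range of `(1 + ∂ₓ)⁻¹`, which is `H¹`, the translation group is differentiable. Here
`-∂ₓ (1 + ∂ₓ)⁻¹ F = (1 + ∂ₓ)⁻¹ F - F`. -/
theorem hasDerivAt_tr_lam_zero (F : L2) :
    HasDerivAt (fun t : ℝ => tr t (lam F)) (lam F - F) 0 := by
  rw [hasDerivAt_iff_tendsto_slope_zero, tendsto_iff_norm_sub_tendsto_zero,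
    ← tendsto_zero_iff_norm_tendsto_zero]
  have h := tendsto_mulOp_zero (l := 𝓝[≠] (0 : ℝ))
    (m := fun h => ((h : ℂ)⁻¹) • ((trSymb h - 1) * lamSymb) - (lamSymb - 1)) (c := 2)
    ?_ (fun ξ => ?_) F
  · refine h.congr fun t => ?_
    simp only [map_sub, map_smul, _root_.sub_apply, _root_.smul_apply,
      sub_mul, one_mul, mulOp_one, ← mulOp_mulOp, zero_add, tr_zero]
    rw [← Complex.ofReal_inv, Complex.coe_smul]
    rfl
  · filter_upwards [self_mem_nhdsWithin] with t ht ξ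
    have ht : t ≠ 0 := ht
    simp only [BoundedContinuousFunction.coe_sub, BoundedContinuousFunction.coe_smul,
      BoundedContinuousFunction.coe_mul, Pi.sub_apply, Pi.mul_apply,
      BoundedContinuousFunction.coe_one, Pi.one_apply]
    refine (norm_sub_le _ _).trans ?_
    have e1 : ‖(t : ℂ)⁻¹ • ((trSymb t ξ - 1) * lamSymb ξ)‖ ≤ 1 := by
      rw [norm_smul, norm_inv, Complex.norm_real, Real.norm_eq_abs]
      calc |t|⁻¹ * _ ≤ |t|⁻¹ * |t| := by gcongr; exact norm_trSymb_sub_one_mul_lamSymb_le t ξ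
        _ = 1 := inv_mul_cancel₀ (abs_ne_zero.2 ht)
    have e2 : ‖lamSymb ξ - 1‖ ≤ 1 := by
      rw [norm_sub_rev, one_sub_lamSymb]; exact norm_freq_mul_lamSymb_le ξ
    linarith
  · have hd : HasDerivAt (fun t : ℝ => trSymb t ξ)
        (-(((2 * Real.pi * ξ : ℝ) : ℂ) * Complex.I)) 0 := by
      have h1 : HasDerivAt (fun t : ℝ => (((-(2 * Real.pi * ξ * t) : ℝ) : ℂ) * Complex.I))
          (((-(2 * Real.pi * ξ) : ℝ) : ℂ) * Complex.I) 0 := by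
        have := (((hasDerivAt_id (0 : ℝ)).const_mul (2 * Real.pi * ξ)).neg).ofReal_comp
          |>.mul_const Complex.I
        simpa using this
      have := h1.cexp
      simpa [trSymb_apply] using this
    rw [hasDerivAt_iff_tendsto_slope_zero] at hd
    have h2 := (hd.mul_const (lamSymb ξ)).sub_const (lamSymb ξ - 1)
    have e : -(((2 * Real.pi * ξ : ℝ) : ℂ) * Complex.I) * lamSymb ξ - (lamSymb ξ - 1) = 0 := by
      have := one_sub_lamSymb ξ
      linear_combination this
    rw [e] at h2
    refine h2.congr fun t => ?_
    simp only [BoundedContinuousFunction.coe_sub, BoundedContinuousFunction.coe_smul,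
      BoundedContinuousFunction.coe_mul, Pi.sub_apply, Pi.mul_apply,
      BoundedContinuousFunction.coe_one, Pi.one_apply, zero_add, trSymb_zero]
    rw [← Complex.ofReal_inv, Complex.coe_smul, smul_mul_assoc]

/-- Product rule for a curve moved along the translation group. At the time in question the
value of the curve has to be in `H¹`, that is, of the form `(1 + ∂ₓ)⁻¹ a`. -/
theorem hasDerivWithinAt_tr {F : ℝ → L2} {F' a : L2} {s : Set ℝ} {t c : ℝ}
    (hF : HasDerivWithinAt F F' s t) (ha : F t = lam a) :
    HasDerivWithinAt (fun r => tr (c * r) (F r)) (tr (c * t) (F' + c • (lam a - a))) s t := by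
  have h1 : HasDerivWithinAt (fun r => tr (c * r) (lam a)) (tr (c * t) (c • (lam a - a))) s t := by
    have e : (fun r : ℝ => tr (c * r) (lam a))
        = fun r => tr (c * t) (tr (c * (r - t)) (lam a)) := by
      funext r; rw [tr_tr]; congr 3; ring
    rw [e]
    have h2 : HasDerivAt (fun r : ℝ => c * (r - t)) c t := by
      simpa using ((hasDerivAt_id t).sub_const t).const_mul c
    have h3 := HasDerivAt.scomp (𝕜 := ℝ) t (g₁ := fun r => tr r (lam a)) (h := fun r => c * (r - t))
      (g₁' := lam a - a) (by simpa using hasDerivAt_tr_lam_zero a) h2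
    exact (((tr (c * t)).restrictScalars ℝ).hasFDerivAt.comp_hasDerivAt t h3).hasDerivWithinAt
  have h2 : HasDerivWithinAt (fun r => tr (c * r) (F r - F t)) (tr (c * t) F') s t := by
    rw [hasDerivWithinAt_iff_tendsto_slope] at hF ⊢
    have hc : Tendsto (fun r => c * r) (𝓝[s \ {t}] t) (𝓝 (c * t)) :=
      ((continuous_const.mul continuous_id).tendsto t).mono_left nhdsWithin_le_nhds
    refine (tendsto_tr hc hF).congr fun r => ?_
    simp only [slope_def_module, sub_self, map_zero, sub_zero]
    exact (((tr (c * r)).restrictScalars ℝ).map_smul _ _)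
  have h3 := h2.add h1
  rw [← map_add] at h3
  refine h3.congr_deriv ?_ |>.congr (fun r _ => ?_) ?_ <;> simp [ha]

/-! ### Conjugation and the bilinear pairing on the frequency side -/

/-- Pointwise complex conjugation on `L²`. -/
def conjL : L2 →L[ℝ] L2 := (Complex.conjCLE : ℂ →L[ℝ] ℂ).compLpL 2 volume

theorem coeFn_conjL (F : L2) : conjL F =ᵐ[volume] fun ξ => starRingEnd ℂ (F ξ) :=
  ContinuousLinearMap.coeFn_compLpL _ F

/-- The reflection `F(ξ) ↦ F(-ξ)` on `L²`. -/
def refl : L2 →L[ℂ] L2 :=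
  (Lp.compMeasurePreservingₗᵢ ℂ Neg.neg
    (Measure.measurePreserving_neg (volume : Measure ℝ))).toContinuousLinearMap

theorem coeFn_refl (F : L2) : refl F =ᵐ[volume] fun ξ => F (-ξ) :=
  Lp.coeFn_compMeasurePreserving F (Measure.measurePreserving_neg (volume : Measure ℝ))

/-- Conjugation of a function, seen on its Fourier transform: `F(ξ) ↦ conj F(-ξ)`. -/
def cc : L2 →L[ℝ] L2 := (refl.restrictScalars ℝ).comp conjL

theorem ae_neg {p : ℝ → Prop} (h : ∀ᵐ ξ : ℝ, p ξ) : ∀ᵐ ξ : ℝ, p (-ξ) :=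
  (Measure.measurePreserving_neg (volume : Measure ℝ)).quasiMeasurePreserving.ae h

theorem ae_toLp_neg (g : 𝓢(ℝ, ℂ)) : ∀ᵐ ξ : ℝ, (g.toLp 2 : L2) (-ξ) = g (-ξ) :=
  ae_neg (p := fun ξ => (g.toLp 2 volume : L2) ξ = g ξ) (g.coeFn_toLp 2 volume)

theorem coeFn_cc (F : L2) : cc F =ᵐ[volume] fun ξ => starRingEnd ℂ (F (-ξ)) := by
  filter_upwards [coeFn_refl (conjL F), ae_neg (coeFn_conjL F)] with ξ h1 h2
  simp only [cc, ContinuousLinearMap.comp_apply, ContinuousLinearMap.coe_restrictScalars']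
  rw [h1, h2]

theorem cc_cc (F : L2) : cc (cc F) = F := by
  refine Lp.ext ?_
  filter_upwards [coeFn_cc (cc F), ae_neg (coeFn_cc F)] with ξ h1 h2
  rw [h1, h2]; simp

theorem norm_cc_le (F : L2) : ‖cc F‖ ≤ ‖F‖ := by
  have h1 : ‖refl (conjL F)‖ = ‖conjL F‖ := LinearIsometry.norm_map _ _
  have h2 : ‖conjL F‖ ≤ 1 * ‖F‖ := by
    refine Lp.norm_le_mul_norm_of_ae_le_mul ?_
    filter_upwards [coeFn_conjL F] with ξ h
    rw [h]; simp
  simpa [cc] using h1.trans_le (by simpa using h2)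

theorem cc_mulOp {m : ℝ →ᵇ ℂ} (hm : ∀ ξ, starRingEnd ℂ (m (-ξ)) = m ξ) (F : L2) :
    cc (mulOp m F) = mulOp m (cc F) := by
  refine Lp.ext ?_
  filter_upwards [coeFn_cc (mulOp m F), coeFn_cc F, ae_neg (coeFn_mulOp m F),
    coeFn_mulOp m (cc F)] with ξ h1 h2 h3 h4
  rw [h1, h4, h3, h2, map_mul, hm]

theorem cc_tr (t : ℝ) (F : L2) : cc (tr t F) = tr t (cc F) := by
  refine cc_mulOp (fun ξ => ?_) F
  rw [trSymb_apply, trSymb_apply, ← Complex.exp_conj, map_mul, Complex.conj_ofReal,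
    Complex.conj_I]
  congr 1; push_cast; ring

theorem cc_lam (F : L2) : cc (lam F) = lam (cc F) := by
  refine cc_mulOp (fun ξ => ?_) F
  rw [lamSymb_apply, lamSymb_apply, map_inv₀, map_add, map_mul, Complex.conj_ofReal,
    Complex.conj_I, map_one]
  congr 1; push_cast; ring

theorem cc_wt (σ : ℝ≥0) (F : L2) : cc (mulOp (wtSymb σ) F) = mulOp (wtSymb σ) (cc F) := by
  refine cc_mulOp (fun ξ => ?_) F
  rw [wtSymb_apply, wtSymb_apply, Complex.conj_ofReal]
  simp

/-- The bilinear pairing `∫ F(ξ) G(-ξ) dξ` of two Fourier transforms; by Parseval it is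
`∫ f g dx`. -/
def dual : L2 →L[ℂ] L2 →L[ℂ] ℂ :=
  (((ContinuousLinearMap.mul ℂ ℂ).lpPairing volume 2 2).flip.comp refl).flip

theorem dual_apply (F G : L2) : dual F G = ∫ ξ, F ξ * G (-ξ) := by
  have h : dual F G = (ContinuousLinearMap.mul ℂ ℂ).lpPairing volume 2 2 F (refl G) := rfl
  rw [h, ContinuousLinearMap.lpPairing_eq_integral]
  refine integral_congr_ae ?_
  filter_upwards [coeFn_refl G] with ξ h
  rw [h]; rfl

theorem dual_comm (F G : L2) : dual F G = dual G F := by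
  rw [dual_apply, dual_apply, ← integral_neg_eq_self]
  simp [mul_comm]

theorem dual_mulOp {m n : ℝ →ᵇ ℂ} (h : ∀ ξ, m ξ = n (-ξ)) (F G : L2) :
    dual (mulOp m F) G = dual F (mulOp n G) := by
  rw [dual_apply, dual_apply]
  refine integral_congr_ae ?_
  filter_upwards [coeFn_mulOp m F, ae_neg (coeFn_mulOp n G)] with ξ h1 h2
  rw [h1, h2, h]; ring

theorem dual_tr (t : ℝ) (F G : L2) : dual (tr t F) G = dual F (tr (-t) G) := by
  refine dual_mulOp (fun ξ => ?_) F G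
  rw [trSymb_apply, trSymb_apply]; congr 3; ring

theorem dual_cc (F G : L2) : dual (cc F) G = starRingEnd ℂ (dual F (cc G)) := by
  rw [dual_apply, dual_apply, ← integral_conj, ← integral_neg_eq_self]
  refine integral_congr_ae ?_
  filter_upwards [ae_neg (coeFn_cc F), ae_neg (coeFn_cc G)] with ξ h1 h2
  rw [h1, h2]; simp

theorem inner_eq_dual (F G : L2) : inner ℂ F G = dual (cc F) G := by
  rw [dual_apply, L2.inner_def, ← integral_neg_eq_self]
  refine integral_congr_ae ?_
  filter_upwards [coeFn_cc F] with ξ h1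
  simp [h1, RCLike.inner_apply, mul_comm]

/-- A Schwartz function, as a frequency-side element of `L²`. -/
def test (η : 𝓢(ℝ, ℂ)) : L2 := 𝓕 (η.toLp 2)

theorem test_eq (η : 𝓢(ℝ, ℂ)) : test η = (𝓕 η).toLp 2 := SchwartzMap.toLp_fourier_eq η

theorem denseRange_test : DenseRange test := by
  have h := SchwartzMap.denseRange_toLpCLM (E := ℝ) (F := ℂ) (p := 2) (μ := volume)
    ENNReal.ofNat_ne_top
  exact ((Lp.fourierTransformₗᵢ ℝ ℂ).surjective.denseRange).comp h
    (Lp.fourierTransformₗᵢ ℝ ℂ).continuous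

theorem eq_zero_of_dual_test {F : L2} (h : ∀ η, dual F (test η) = 0) : F = 0 := by
  have h1 : ∀ G, dual F G = 0 := fun G =>
    denseRange_test.induction_on G (isClosed_eq (dual F).continuous continuous_const) h
  have h2 := inner_eq_dual (cc F) (cc F)
  rw [cc_cc, h1, inner_self_eq_zero] at h2
  rw [← cc_cc F, h2, map_zero]

/-- Parseval's identity for the bilinear pairing. -/
theorem integral_mul_eq_dual (f g : L2) : ∫ x, f x * g x = dual (𝓕 f) (𝓕 g) := by
  have e : ∀ f g : L2, ∫ x, f x * g x
      = (ContinuousLinearMap.mul ℂ ℂ).lpPairing volume 2 2 f g := fun f g => by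
    rw [ContinuousLinearMap.lpPairing_eq_integral]; rfl
  rw [e]
  have h := SchwartzMap.denseRange_toLpCLM (E := ℝ) (F := ℂ) (p := 2) (μ := volume)
    ENNReal.ofNat_ne_top
  refine h.induction_on₂ (p := fun f g : L2 => (ContinuousLinearMap.mul ℂ ℂ).lpPairing volume 2 2
    f g = dual (𝓕 f) (𝓕 g)) ?_ (fun a b => ?_) f g
  · have hF : Continuous fun f : L2 => (𝓕 f : L2) := (Lp.fourierTransformₗᵢ ℝ ℂ).continuous
    refine isClosed_eq (by fun_prop) (by fun_prop)
  · rw [← e, dual_apply, SchwartzMap.toLpCLM_apply, SchwartzMap.toLpCLM_apply,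
      SchwartzMap.toLp_fourier_eq, SchwartzMap.toLp_fourier_eq]
    have h1 : ∫ x, (a.toLp 2 : L2) x * (b.toLp 2 : L2) x = ∫ x, a x * b x := by
      refine integral_congr_ae ?_
      filter_upwards [a.coeFn_toLp 2, b.coeFn_toLp 2] with x h1 h2
      rw [h1, h2]
    have h2 : ∫ ξ, ((𝓕 a).toLp 2 : L2) ξ * ((𝓕 b).toLp 2 : L2) (-ξ)
        = ∫ ξ, 𝓕 a ξ * 𝓕⁻ b ξ := by
      refine integral_congr_ae ?_
      filter_upwards [(𝓕 a).coeFn_toLp 2, ae_toLp_neg (𝓕 b)] with x h1 h2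
      rw [h1, h2, SchwartzMap.fourierInv_coe, Real.fourierInv_eq_fourier_neg,
        SchwartzMap.fourier_coe b]
    rw [h1, h2, SchwartzMap.integral_fourier_mul_eq]
    simp

theorem fourier_conjL (f : L2) : 𝓕 (conjL f) = cc (𝓕 f) := by
  rw [← sub_eq_zero]
  refine eq_zero_of_dual_test fun η => ?_
  rw [map_sub, _root_.sub_apply, test, ← integral_mul_eq_dual, ← inner_eq_dual,
    Lp.inner_fourier_eq, L2.inner_def, sub_eq_zero]
  refine integral_congr_ae ?_
  filter_upwards [coeFn_conjL f] with x h
  rw [h]; simp [RCLike.inner_apply, mul_comm]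

theorem isRealValued_iff (f : L2) : IsRealValued f ↔ cc (𝓕 f) = 𝓕 f := by
  have hi : (𝓕 (conjL f) : L2) = 𝓕 f ↔ conjL f = f :=
    (Lp.fourierTransformₗᵢ ℝ ℂ).injective.eq_iff
  rw [← fourier_conjL, hi, IsRealValued]
  constructor
  · intro h
    refine Lp.ext ?_
    filter_upwards [h, coeFn_conjL f] with x h1 h2
    rw [h2]; exact Complex.conj_eq_iff_im.2 h1
  · intro h
    have h' : conjL f =ᵐ[volume] f := by rw [h]
    filter_upwards [h', coeFn_conjL f] with x h1 h2
    rw [h2] at h1; exact Complex.conj_eq_iff_im.1 h1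

theorem pair_eq_dual (f : L2) (η : 𝓢(ℝ, ℂ)) : pair f η = dual (𝓕 f) (test η) := by
  rw [test, ← integral_mul_eq_dual, pair]
  refine integral_congr_ae ?_
  filter_upwards [η.coeFn_toLp 2] with x h
  rw [h]

theorem test_eq_lam (η : 𝓢(ℝ, ℂ)) :
    test η = lam (test η + test (SchwartzMap.derivCLM ℂ ℂ η)) := by
  refine Lp.ext ?_
  rw [test_eq, test_eq]
  filter_upwards [(𝓕 η).coeFn_toLp 2, (𝓕 (SchwartzMap.derivCLM ℂ ℂ η)).coeFn_toLp 2,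
    coeFn_mulOp lamSymb ((𝓕 η).toLp 2 + (𝓕 (SchwartzMap.derivCLM ℂ ℂ η)).toLp 2),
    Lp.coeFn_add ((𝓕 η).toLp 2 : L2) ((𝓕 (SchwartzMap.derivCLM ℂ ℂ η)).toLp 2)]
    with ξ h1 h2 h3 h4
  rw [h1, h3, h4, Pi.add_apply, h1, h2]
  have h5 : 𝓕 (SchwartzMap.derivCLM ℂ ℂ η) ξ
      = ((2 * Real.pi * ξ : ℝ) : ℂ) * Complex.I * 𝓕 η ξ := by
    have := Real.fourier_deriv (f := η) η.integrable η.differentiable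
      (by exact (SchwartzMap.derivCLM ℂ ℂ η).integrable)
    rw [SchwartzMap.fourier_coe, SchwartzMap.fourier_coe]
    have h6 : ⇑(SchwartzMap.derivCLM ℂ ℂ η) = deriv η := by
      ext x; simp
    rw [h6, this]
    push_cast
    rw [smul_eq_mul]
    ring
  rw [h5, lamSymb_apply]
  have := inv_mul_cancel₀ (one_add_ne_zero ξ)
  linear_combination (-𝓕 η ξ) * this

theorem tr_test (t : ℝ) (η : 𝓢(ℝ, ℂ)) :
    tr t (test η) = test (SchwartzMap.compSubConstCLM ℂ t η) := by
  refine Lp.ext ?_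
  rw [test_eq, test_eq]
  filter_upwards [(𝓕 η).coeFn_toLp 2,
    (𝓕 (SchwartzMap.compSubConstCLM ℂ t η)).coeFn_toLp 2,
    coeFn_mulOp (trSymb t) ((𝓕 η).toLp 2)] with ξ h1 h2 h3
  rw [h2, h3, h1, SchwartzMap.fourier_coe, SchwartzMap.fourier_coe, trSymb_apply]
  have h6 : ⇑(SchwartzMap.compSubConstCLM ℂ t η) = (⇑η ∘ fun x => x + (-t)) := by
    ext x; simp [sub_eq_add_neg]
  rw [h6]
  have h7 := congrFun (VectorFourier.fourierIntegral_comp_add_right Real.fourierChar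
    (volume : Measure ℝ) (innerₗ ℝ) η (-t)) ξ
  have h8 : ∀ f : ℝ → ℂ, 𝓕 f ξ = VectorFourier.fourierIntegral Real.fourierChar
    (volume : Measure ℝ) (innerₗ ℝ) f ξ := fun f => rfl
  rw [h8, h8, h7, Circle.smul_def, Real.fourierChar_apply]
  simp
  left
  congr 1
  ring

/-! ### Products in Gevrey spaces -/

/-- The shift `F ↦ F(· - η)` of a function of the frequency. -/
def freqShift (η : ℝ) : L2 →L[ℂ] L2 :=
  (Lp.compMeasurePreservingₗᵢ ℂ (fun ξ => ξ - η)
    (measurePreserving_sub_right (volume : Measure ℝ) η)).toContinuousLinearMap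

theorem coeFn_freqShift (η : ℝ) (F : L2) : freqShift η F =ᵐ[volume] fun ξ => F (ξ - η) :=
  Lp.coeFn_compMeasurePreserving F (measurePreserving_sub_right (volume : Measure ℝ) η)

theorem norm_freqShift (η : ℝ) (F : L2) : ‖freqShift η F‖ = ‖F‖ := LinearIsometry.norm_map _ _

theorem continuous_freqShift (F : L2) : Continuous fun η => freqShift η F := by
  have hg : Continuous fun η : ℝ => (⟨fun ξ => ξ - η, by fun_prop⟩ : C(ℝ, ℝ)) :=
    ContinuousMap.continuous_of_continuous_uncurry _ (by
      simp only [Function.uncurry_def, ContinuousMap.coe_mk]; fun_prop)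
  exact (continuous_const (y := F)).compMeasurePreservingLp hg
    (fun η => measurePreserving_sub_right (volume : Measure ℝ) η) (by norm_num)

/-- The exponent `2πσ(|ξ| - |η| - |ξ - η|)` of `kerSymb`. -/
def kerExp (σ : ℝ≥0) (η ξ : ℝ) : ℝ :=
  σ * (|2 * Real.pi * ξ| - |2 * Real.pi * η| - |2 * Real.pi * (ξ - η)|)

theorem kerExp_nonpos (σ : ℝ≥0) (η ξ : ℝ) : kerExp σ η ξ ≤ 0 := by
  refine mul_nonpos_of_nonneg_of_nonpos σ.2 ?_
  have := abs_add_le (2 * Real.pi * η) (2 * Real.pi * (ξ - η))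
  have e : 2 * Real.pi * η + 2 * Real.pi * (ξ - η) = 2 * Real.pi * ξ := by ring
  rw [e] at this
  linarith

/-- The quotient `e^{2πσ|ξ|} / (e^{2πσ|η|} e^{2πσ|ξ - η|})` of Gevrey weights, which is at most
`1` by the triangle inequality. -/
def kerSymb (σ : ℝ≥0) (η : ℝ) : ℝ →ᵇ ℂ :=
  BoundedContinuousFunction.ofNormedAddCommGroup
    (fun ξ => ((Real.exp (kerExp σ η ξ) : ℝ) : ℂ))
    (by unfold kerExp; fun_prop) 1 (fun ξ => by
      rw [Complex.norm_real, Real.norm_eq_abs, Real.abs_exp, Real.exp_le_one_iff]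
      exact kerExp_nonpos σ η ξ)

theorem kerSymb_apply (σ : ℝ≥0) (η ξ : ℝ) :
    kerSymb σ η ξ = ((Real.exp (kerExp σ η ξ) : ℝ) : ℂ) := rfl

theorem norm_kerSymb_le (σ : ℝ≥0) (η ξ : ℝ) : ‖kerSymb σ η ξ‖ ≤ 1 := by
  rw [kerSymb_apply, Complex.norm_real, Real.norm_eq_abs, Real.abs_exp, Real.exp_le_one_iff]
  exact kerExp_nonpos σ η ξ

/-- The shift by `η`, conjugated with the Gevrey weight and normalized to be a contraction. -/
def modShift (σ : ℝ≥0) (η : ℝ) : L2 →L[ℂ] L2 := (mulOp (kerSymb σ η)).comp (freqShift η)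

theorem coeFn_modShift (σ : ℝ≥0) (η : ℝ) (F : L2) :
    modShift σ η F =ᵐ[volume] fun ξ => kerSymb σ η ξ * F (ξ - η) := by
  filter_upwards [coeFn_mulOp (kerSymb σ η) (freqShift η F), coeFn_freqShift η F] with ξ h1 h2
  rw [modShift, ContinuousLinearMap.comp_apply, h1, h2]

theorem norm_modShift_le (σ : ℝ≥0) (η : ℝ) (F : L2) : ‖modShift σ η F‖ ≤ ‖F‖ := by
  have := norm_mulOp_le (norm_kerSymb_le σ η) (freqShift η F)
  rwa [one_mul, norm_freqShift] at this

theorem continuous_modShift (σ : ℝ≥0) (F : L2) : Continuous fun η => modShift σ η F := by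
  refine continuous_iff_continuousAt.2 fun η => ?_
  have h1 : Tendsto (fun r => mulOp (kerSymb σ r) (freqShift r F - freqShift η F)) (𝓝 η)
      (𝓝 0) := by
    refine squeeze_zero_norm (fun r => ?_)
      (tendsto_iff_norm_sub_tendsto_zero.1 ((continuous_freqShift F).tendsto η))
    simpa using norm_mulOp_le (norm_kerSymb_le σ r) (freqShift r F - freqShift η F)
  have h2 := tendsto_mulOp_zero (l := 𝓝 η) (m := fun r => kerSymb σ r - kerSymb σ η) (c := 2)
    (Eventually.of_forall fun r ξ => ?_) (fun ξ => ?_) (freqShift η F)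
  · rw [ContinuousAt, tendsto_iff_norm_sub_tendsto_zero, ← tendsto_zero_iff_norm_tendsto_zero]
    have h3 := h1.add h2
    rw [add_zero] at h3
    refine h3.congr fun r => ?_
    simp [modShift]
  · rw [BoundedContinuousFunction.coe_sub, Pi.sub_apply]
    refine (norm_sub_le _ _).trans ?_
    linarith [norm_kerSymb_le σ r ξ, norm_kerSymb_le σ η ξ]
  · have hc : Continuous fun r => kerSymb σ r ξ := by
      simp only [kerSymb_apply, kerExp]; fun_prop
    simpa using (hc.tendsto η).sub_const (kerSymb σ η ξ)

theorem integrable_lamSymb_mul (a : L2) : Integrable (fun η => lamSymb η * a η) :=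
  memLp_lamSymb.integrable_mul (Lp.memLp a)

theorem integrable_smul_modShift (σ : ℝ≥0) (a b : L2) :
    Integrable (fun η => (lamSymb η * a η) • modShift σ η b) :=
  (integrable_lamSymb_mul a).smul_bdd ‖b‖ (continuous_modShift σ b).aestronglyMeasurable
    (Eventually.of_forall fun η => norm_modShift_le σ η b)

/-- The norm of `1 / (1 + 2πiη)` in `L²`, the constant of the embedding of `H¹` into the functions
with integrable Fourier transform. -/
def lamNorm : ℝ := ‖(memLp_lamSymb.toLp : L2)‖

theorem lamNorm_nonneg : 0 ≤ lamNorm := norm_nonneg _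

theorem integral_norm_lamSymb_mul_le (a : L2) : ∫ η, ‖lamSymb η * a η‖ ≤ lamNorm * ‖a‖ := by
  have h1 := (ContinuousLinearMap.mul ℂ ℂ).norm_holder_apply_apply_le (r := 1)
    (μ := volume) (p := 2) (q := 2) memLp_lamSymb.toLp a
  rw [L1.norm_eq_integral_norm] at h1
  calc ∫ η, ‖lamSymb η * a η‖
      = ∫ η, ‖(ContinuousLinearMap.mul ℂ ℂ).holder 1 (memLp_lamSymb.toLp : L2) a η‖ := by
        refine integral_congr_ae ?_
        filter_upwards [(ContinuousLinearMap.mul ℂ ℂ).coeFn_holder (r := 1)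
          (memLp_lamSymb.toLp : L2) a, memLp_lamSymb.coeFn_toLp] with η h2 h3
        rw [h2, h3]; rfl
    _ ≤ _ := h1
    _ ≤ 1 * lamNorm * ‖a‖ := by
        gcongr
        · exact ContinuousLinearMap.opNorm_mul_le ℂ ℂ
        · exact le_rfl
    _ = _ := by rw [one_mul]

/-- The product `((1 + ∂ₓ)⁻¹ f) g`, acting on Fourier transforms which are divided by the
decaying Gevrey weight `wtSymb σ`. It is the superposition of the shifts of `b`. -/
def prod (σ : ℝ≥0) : L2 →L[ℂ] L2 →L[ℂ] L2 :=
  LinearMap.mkContinuous₂ (LinearMap.mk₂ ℂ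
    (fun a b => ∫ η, (lamSymb η * a η) • modShift σ η b)
    (fun a a' b => by
      rw [← integral_add (integrable_smul_modShift σ a b) (integrable_smul_modShift σ a' b)]
      refine integral_congr_ae ?_
      filter_upwards [Lp.coeFn_add a a'] with η h
      rw [h, Pi.add_apply, mul_add, add_smul])
    (fun c a b => by
      rw [← integral_smul]
      refine integral_congr_ae ?_
      filter_upwards [Lp.coeFn_smul c a] with η h
      rw [h, Pi.smul_apply, smul_eq_mul, mul_left_comm, mul_smul])
    (fun a b b' => by
      rw [← integral_add (integrable_smul_modShift σ a b) (integrable_smul_modShift σ a b')]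
      simp only [map_add, smul_add])
    (fun c a b => by
      rw [← integral_smul]
      simp only [map_smul]
      congr 1; funext η; rw [smul_comm])) lamNorm (fun a b => by
        calc ‖∫ η, (lamSymb η * a η) • modShift σ η b‖
            ≤ ∫ η, ‖lamSymb η * a η‖ * ‖b‖ := by
              refine norm_integral_le_of_norm_le
                ((integrable_lamSymb_mul a).norm.mul_const _) (Eventually.of_forall fun η => ?_)
              rw [norm_smul]
              gcongr
              exact norm_modShift_le σ η b
          _ = (∫ η, ‖lamSymb η * a η‖) * ‖b‖ := integral_mul_const _ _
          _ ≤ lamNorm * ‖a‖ * ‖b‖ := by gcongr; exact integral_norm_lamSymb_mul_le a)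

theorem prod_apply (σ : ℝ≥0) (a b : L2) :
    prod σ a b = ∫ η, (lamSymb η * a η) • modShift σ η b := rfl

theorem norm_prod_le (σ : ℝ≥0) (a b : L2) : ‖prod σ a b‖ ≤ lamNorm * ‖a‖ * ‖b‖ :=
  ((prod σ).le_opNorm₂ a b).trans (by
    gcongr; exact LinearMap.mkContinuous₂_norm_le _ lamNorm_nonneg _)

/-- A symbol `m` with `m(ξ) k_σ(η, ξ) = m(η) k_τ(η, ξ) m(ξ - η)` acts on products factor by
factor. -/
theorem mulOp_prod {m : ℝ →ᵇ ℂ} {σ τ : ℝ≥0}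
    (h : ∀ ξ η, m ξ * kerSymb σ η ξ = m η * (kerSymb τ η ξ * m (ξ - η))) (a b : L2) :
    mulOp m (prod σ a b) = prod τ (mulOp m a) (mulOp m b) := by
  rw [prod_apply, ← ContinuousLinearMap.integral_comp_comm _ (integrable_smul_modShift σ a b),
    prod_apply]
  refine integral_congr_ae ?_
  filter_upwards [coeFn_mulOp m a] with η h1
  rw [h1, map_smul]
  have key : mulOp m (modShift σ η b) = m η • modShift τ η (mulOp m b) := by
    refine Lp.ext ?_
    have h5 : ∀ᵐ ξ : ℝ, mulOp m b (ξ - η) = m (ξ - η) * b (ξ - η) :=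
      (measurePreserving_sub_right (volume : Measure ℝ) η).quasiMeasurePreserving.ae
        (coeFn_mulOp m b)
    filter_upwards [coeFn_mulOp m (modShift σ η b), coeFn_modShift σ η b,
      coeFn_modShift τ η (mulOp m b), Lp.coeFn_smul (m η) (modShift τ η (mulOp m b)), h5]
      with ξ h1 h2 h3 h4 h5
    rw [h1, h2, h4, Pi.smul_apply, h3, h5, smul_eq_mul]
    linear_combination b (ξ - η) * h ξ η
  rw [key, smul_smul]
  congr 1; ring

theorem tr_prod (σ : ℝ≥0) (t : ℝ) (a b : L2) :
    tr t (prod σ a b) = prod σ (tr t a) (tr t b) := by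
  refine mulOp_prod (fun ξ η => ?_) a b
  rw [mul_left_comm, mul_comm (trSymb t ξ)]
  congr 1
  rw [trSymb_apply, trSymb_apply, trSymb_apply, ← Complex.exp_add]
  congr 1; push_cast; ring

theorem wt_prod (σ : ℝ≥0) (a b : L2) :
    mulOp (wtSymb σ) (prod σ a b) = prod 0 (mulOp (wtSymb σ) a) (mulOp (wtSymb σ) b) := by
  refine mulOp_prod (fun ξ η => ?_) a b
  simp only [wtSymb_apply, kerSymb_apply, kerExp, ← Complex.ofReal_mul, ← Real.exp_add]
  congr 2
  simp only [NNReal.coe_zero, zero_mul]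
  ring

/-! ### Products on the physical side -/

theorem kerSymb_zero (η ξ : ℝ) : kerSymb 0 η ξ = 1 := by simp [kerSymb_apply, kerExp]

/-- Modulation of a Schwartz function is a shift of its inverse Fourier transform. -/
theorem fourierInv_modulation (θ : 𝓢(ℝ, ℂ)) (η : ℝ) : ∃ g : 𝓢(ℝ, ℂ),
    (∀ x, g x = Complex.exp (((2 * Real.pi * x * η : ℝ) : ℂ) * Complex.I) * θ x) ∧
    ∀ ξ, 𝓕⁻ g ξ = 𝓕⁻ θ (ξ + η) := by
  refine ⟨𝓕 (SchwartzMap.compSubConstCLM ℂ (-η) (𝓕⁻ θ)), fun x => ?_, fun ξ => ?_⟩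
  · have h6 : ⇑(SchwartzMap.compSubConstCLM ℂ (-η) (𝓕⁻ θ))
        = (⇑(𝓕⁻ θ : 𝓢(ℝ, ℂ)) ∘ fun x => x + η) := by
      ext x; simp
    have h7 := congrFun (VectorFourier.fourierIntegral_comp_add_right Real.fourierChar
      (volume : Measure ℝ) (innerₗ ℝ) (𝓕⁻ θ : 𝓢(ℝ, ℂ)) η) x
    have h8 : ∀ f : ℝ → ℂ, 𝓕 f x = VectorFourier.fourierIntegral Real.fourierChar
      (volume : Measure ℝ) (innerₗ ℝ) f x := fun f => rfl
    rw [SchwartzMap.fourier_coe, h6, h8, h7, ← h8, ← SchwartzMap.fourier_coe,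
      FourierTransform.fourier_fourierInv_eq, Circle.smul_def, Real.fourierChar_apply]
    simp
    left
    congr 1
    ring
  · rw [FourierTransform.fourierInv_fourier_eq]
    simp

theorem dual_modShift_zero_eq (η : ℝ) (h θ : 𝓢(ℝ, ℂ)) :
    dual (modShift 0 η (h.toLp 2)) (test θ) = ∫ ξ, h (ξ - η) * (𝓕⁻ θ : 𝓢(ℝ, ℂ)) ξ := by
  have h5 : ∀ᵐ ξ : ℝ, (h.toLp 2 volume : L2) (ξ - η) = h (ξ - η) :=
    (measurePreserving_sub_right (volume : Measure ℝ) η).quasiMeasurePreserving.ae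
      (p := fun ξ => (h.toLp 2 volume : L2) ξ = h ξ) (h.coeFn_toLp 2 volume)
  rw [dual_apply, test_eq]
  refine integral_congr_ae ?_
  filter_upwards [coeFn_modShift 0 η (h.toLp 2 volume), h5, ae_toLp_neg (𝓕 θ)] with ξ h1 h2 h3
  rw [h1, h2, h3, kerSymb_zero, one_mul, SchwartzMap.fourierInv_coe,
    Real.fourierInv_eq_fourier_neg, SchwartzMap.fourier_coe θ]

theorem dual_modShift_zero (η : ℝ) (h θ : 𝓢(ℝ, ℂ)) :
    dual (modShift 0 η (h.toLp 2)) (test θ)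
      = ∫ x, Complex.exp (((2 * Real.pi * x * η : ℝ) : ℂ) * Complex.I)
          * ((𝓕⁻ h : 𝓢(ℝ, ℂ)) x * θ x) := by
  obtain ⟨g, hg1, hg2⟩ := fourierInv_modulation θ η
  have e1 := integral_add_right_eq_self (μ := (volume : Measure ℝ))
    (fun ξ => h (ξ - η) * (𝓕⁻ θ : 𝓢(ℝ, ℂ)) ξ) η
  have e2 := SchwartzMap.integral_fourierInv_mul_eq h g
  rw [dual_modShift_zero_eq, ← e1]
  simp only [add_sub_cancel_right, ← hg2]
  rw [← e2]
  congr 1; funext x; rw [hg1]; ring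

theorem memLp_mul_schwartz (f : L2) (θ : 𝓢(ℝ, ℂ)) : MemLp (fun x => f x * θ x) 2 volume := by
  refine (memLp_bcf_mul θ.toBoundedContinuousFunction f).ae_eq ?_
  exact Eventually.of_forall fun x => by simp [mul_comm]

theorem dual_prod_zero_test (a b : L2) (θ : 𝓢(ℝ, ℂ)) :
    dual (prod 0 a b) (test θ)
      = ∫ x, (𝓕⁻ (lam a) : L2) x * ((𝓕⁻ b : L2) x * θ x) := by
  have hR : ∀ b : L2, ∫ x, (𝓕⁻ (lam a) : L2) x * ((𝓕⁻ b : L2) x * θ x)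
      = dual (lam a) (𝓕 (mulOp θ.toBoundedContinuousFunction (𝓕⁻ b))) := fun b => by
    have h1 := integral_mul_eq_dual (𝓕⁻ (lam a)) (mulOp θ.toBoundedContinuousFunction (𝓕⁻ b))
    rw [FourierTransform.fourier_fourierInv_eq] at h1
    rw [← h1]
    refine integral_congr_ae ?_
    filter_upwards [coeFn_mulOp θ.toBoundedContinuousFunction (𝓕⁻ b)] with x hx
    rw [hx]; simp; left; ring
  have hd := SchwartzMap.denseRange_toLpCLM (E := ℝ) (F := ℂ) (p := 2) (μ := volume)
    ENNReal.ofNat_ne_top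
  refine hd.induction_on (p := fun b : L2 => dual (prod 0 a b) (test θ)
      = ∫ x, (𝓕⁻ (lam a) : L2) x * ((𝓕⁻ b : L2) x * θ x)) b ?_ (fun h => ?_)
  · simp_rw [hR]
    have hF : Continuous fun f : L2 => (𝓕 f : L2) := (Lp.fourierTransformₗᵢ ℝ ℂ).continuous
    have hF' : Continuous fun f : L2 => (𝓕⁻ f : L2) :=
      (Lp.fourierTransformₗᵢ ℝ ℂ).symm.continuous
    exact isClosed_eq (by fun_prop) (by fun_prop)
  · rw [SchwartzMap.toLpCLM_apply]
    set κ : 𝓢(ℝ, ℂ) := SchwartzMap.pairing (ContinuousLinearMap.mul ℂ ℂ) (𝓕⁻ h) θ with hκ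
    have hκ' : ∀ x, κ x = 𝓕⁻ h x * θ x := fun x => by
      rw [hκ, SchwartzMap.pairing_apply_apply]; rfl
    have e1 : ∫ x, (𝓕⁻ (lam a) : L2) x * ((𝓕⁻ (h.toLp 2) : L2) x * θ x)
        = dual (lam a) (test κ) := by
      have := pair_eq_dual (𝓕⁻ (lam a)) κ
      rw [FourierTransform.fourier_fourierInv_eq] at this
      rw [← this, pair, SchwartzMap.toLp_fourierInv_eq]
      refine integral_congr_ae ?_
      filter_upwards [(𝓕⁻ h).coeFn_toLp 2] with x hx
      rw [hx, hκ']
    rw [e1, dual_comm, dual_comm (lam a), prod_apply, dual_comm,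
      ← ContinuousLinearMap.flip_apply dual,
      ← ContinuousLinearMap.integral_comp_comm _ (integrable_smul_modShift 0 a _), dual_comm,
      dual_apply, test_eq κ]
    refine integral_congr_ae ?_
    filter_upwards [coeFn_mulOp lamSymb a,
      ae_toLp_neg (𝓕 κ)] with η h1 h2
    rw [ContinuousLinearMap.flip_apply, map_smul, _root_.smul_apply, dual_modShift_zero, h1, h2,
      smul_eq_mul, SchwartzMap.fourier_coe, Real.fourier_eq']
    congr 2
    funext x
    rw [hκ']
    simp only [RCLike.inner_apply, conj_trivial, smul_eq_mul]
    congr 2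
    push_cast
    ring

/-- On the physical side, `prod` is the pointwise product of `(1 + ∂ₓ)⁻¹ f` and `g`. -/
theorem fourierInv_prod_zero (a b : L2) : (𝓕⁻ (prod 0 a b) : L2) =ᵐ[volume]
    fun x => (𝓕⁻ (lam a) : L2) x * (𝓕⁻ b : L2) x := by
  refine ae_eq_of_integral_contDiff_smul_eq
    ((Lp.memLp _).locallyIntegrable (by norm_num))
    ((Lp.memLp (𝓕⁻ (lam a) : L2)).integrable_mul
      (Lp.memLp (𝓕⁻ b : L2))).locallyIntegrable (fun g hg hgs => ?_)
  have hs : HasCompactSupport fun x => (g x : ℂ) := hgs.comp_left Complex.ofReal_zero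
  have hc : ContDiff ℝ ((⊤ : ℕ∞) : WithTop ℕ∞) fun x => (g x : ℂ) :=
    Complex.ofRealCLM.contDiff.comp hg
  have h := dual_prod_zero_test a b (hs.toSchwartzMap hc)
  have h2 := pair_eq_dual (𝓕⁻ (prod 0 a b)) (hs.toSchwartzMap hc)
  rw [FourierTransform.fourier_fourierInv_eq, h, pair] at h2
  have e : ∀ x, (hs.toSchwartzMap hc) x = (g x : ℂ) := fun x => rfl
  simp only [e] at h2
  calc ∫ x, g x • (𝓕⁻ (prod 0 a b) : L2) x = ∫ x, (𝓕⁻ (prod 0 a b) : L2) x * (g x : ℂ) := by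
        congr 1; funext x; rw [Complex.real_smul, mul_comm]
    _ = _ := h2
    _ = _ := by
        congr 1; funext x; rw [Complex.real_smul]; ring

theorem dual_eq_integral (F G : L2) :
    dual F G = ∫ x, (𝓕⁻ F : L2) x * (𝓕⁻ G : L2) x := by
  rw [integral_mul_eq_dual, FourierTransform.fourier_fourierInv_eq,
    FourierTransform.fourier_fourierInv_eq]

/-- The trilinear form `∫ ((1 + ∂ₓ)⁻¹ a) b c dx` may be grouped in two ways if `c` is of the form
`(1 + ∂ₓ)⁻¹ d`. -/
theorem dual_prod_lam (a b d : L2) :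
    dual (prod 0 a b) (lam d) = dual (lam a) (prod 0 d b) := by
  rw [dual_eq_integral, dual_eq_integral]
  refine integral_congr_ae ?_
  filter_upwards [fourierInv_prod_zero a b, fourierInv_prod_zero d b] with x h1 h2
  rw [h1, h2]; ring

theorem dual_prod_swap (a b d : L2) : dual b (prod 0 d a) = dual a (prod 0 d b) := by
  rw [dual_eq_integral, dual_eq_integral]
  refine integral_congr_ae ?_
  filter_upwards [fourierInv_prod_zero d a, fourierInv_prod_zero d b] with x h1 h2
  rw [h1, h2]; ring

/-! ### The Gevrey norms on the frequency side -/

/-- The factor `√(2π)` between the norm of `G^{σ,s}` and Mathlib's `L²` norm on the frequency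
side. -/
def fourierConst : ℝ≥0∞ := ENNReal.ofReal (2 * Real.pi) ^ (1 / 2 : ℝ)

theorem fourierConst_ne_zero : fourierConst ≠ 0 := by
  have : 0 < ENNReal.ofReal (2 * Real.pi) := ENNReal.ofReal_pos.2 (by positivity)
  exact (ENNReal.rpow_pos this ENNReal.ofReal_ne_top).ne'

theorem fourierConst_ne_top : fourierConst ≠ ∞ :=
  ENNReal.rpow_ne_top_of_nonneg (by norm_num) ENNReal.ofReal_ne_top

theorem one_le_toReal_fourierConst : 1 ≤ fourierConst.toReal := by
  have h : (1 : ℝ≥0∞) ≤ fourierConst := by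
    refine ENNReal.one_le_rpow ?_ (by norm_num)
    rw [ENNReal.one_le_ofReal]
    linarith [Real.pi_gt_three]
  simpa using (ENNReal.toReal_le_toReal (by simp) fourierConst_ne_top).2 h

/-- The Gevrey weight in Mathlib's frequency variable. -/
def gevreyWt (σ s η : ℝ) : ℝ :=
  Real.exp (σ * |2 * Real.pi * η|) * jap (2 * Real.pi * η) ^ s

theorem measurable_gevreyWt (σ s : ℝ) : Measurable (gevreyWt σ s) := by
  unfold gevreyWt jap; fun_prop

theorem gevreyWt_nonneg (σ s η : ℝ) : 0 ≤ gevreyWt σ s η :=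
  mul_nonneg (Real.exp_nonneg _) (Real.rpow_nonneg (by linarith [one_le_jap (2 * Real.pi * η)]) _)

theorem gevreyENorm_eq (σ s : ℝ) (f : L2) : gevreyENorm σ s f
    = fourierConst * eLpNorm (fun η => (gevreyWt σ s η : ℂ) * (𝓕 f : L2) η) 2 volume := by
  have hpi : (2 * Real.pi)⁻¹ ≠ 0 := by positivity
  have hmap := Real.map_volume_mul_left hpi
  have hm : AEStronglyMeasurable (fun η => (gevreyWt σ s η : ℂ) * (𝓕 f : L2) η) volume :=
    (Complex.measurable_ofReal.comp (measurable_gevreyWt σ s)).aestronglyMeasurable.mul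
      (Lp.aestronglyMeasurable _)
  have e : (fun ξ : ℝ => ((Real.exp (σ * |ξ|) * jap ξ ^ s : ℝ) : ℂ) * hat f ξ)
      = (fun η => (gevreyWt σ s η : ℂ) * (𝓕 f : L2) η) ∘ fun ξ => (2 * Real.pi)⁻¹ * ξ := by
    funext ξ
    have h1 : 2 * Real.pi * ((2 * Real.pi)⁻¹ * ξ) = ξ := by field_simp
    simp only [Function.comp_apply, gevreyWt, hat, h1]
    rw [div_eq_inv_mul]
  rw [gevreyENorm, e, ← eLpNorm_map_measure (by rw [hmap]; exact hm.smul_measure _)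
    (by fun_prop), hmap, eLpNorm_smul_measure_of_ne_top (by norm_num)]
  rw [inv_inv, abs_of_pos (by positivity), fourierConst, smul_eq_mul]
  norm_num

theorem norm_gevreyWt_zero_mul_wtSymb (σ : ℝ≥0) (η : ℝ) (z : ℂ) :
    ‖(gevreyWt σ 0 η : ℂ) * (wtSymb σ η * z)‖ = ‖z‖ := by
  rw [← mul_assoc, wtSymb_apply, gevreyWt, Real.rpow_zero, mul_one, ← Complex.ofReal_mul,
    ← Real.exp_add]
  simp

theorem norm_gevreyWt_one_mul_wtSymb (σ : ℝ≥0) (η : ℝ) (z : ℂ) :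
    ‖(gevreyWt σ 1 η : ℂ) * (wtSymb σ η * (lamSymb η * z))‖ = ‖z‖ := by
  have h1 := one_le_jap (2 * Real.pi * η)
  have h : ‖(gevreyWt σ 1 η : ℂ) * wtSymb σ η‖ = jap (2 * Real.pi * η) := by
    rw [wtSymb_apply, gevreyWt, Real.rpow_one, ← Complex.ofReal_mul, mul_right_comm,
      ← Real.exp_add, Complex.norm_real]
    simp [abs_of_nonneg (zero_le_one.trans h1)]
  rw [← mul_assoc, norm_mul, h, norm_mul, norm_lamSymb, mul_inv_cancel_left₀ (by linarith)]

theorem gevreyENorm_zero_eq {σ : ℝ≥0} {f a : L2} (h : 𝓕 f = mulOp (wtSymb σ) a) :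
    gevreyENorm σ 0 f = fourierConst * ‖a‖ₑ := by
  rw [gevreyENorm_eq, Lp.enorm_def, h]
  congr 1
  refine eLpNorm_congr_norm_ae ?_
  filter_upwards [coeFn_mulOp (wtSymb σ) a] with η h1
  rw [h1, norm_gevreyWt_zero_mul_wtSymb]

theorem gevreyENorm_one_eq {σ : ℝ≥0} {f a : L2} (h : 𝓕 f = mulOp (wtSymb σ) (lam a)) :
    gevreyENorm σ 1 f = fourierConst * ‖a‖ₑ := by
  rw [gevreyENorm_eq, Lp.enorm_def, h]
  congr 1
  refine eLpNorm_congr_norm_ae ?_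
  filter_upwards [coeFn_mulOp (wtSymb σ) (lam a), coeFn_mulOp lamSymb a] with η h1 h2
  rw [h1, h2, norm_gevreyWt_one_mul_wtSymb]

theorem eLpNorm_lt_top_of_memGevrey {σ s : ℝ} {f : L2} (h : MemGevrey σ s f) :
    eLpNorm (fun η => (gevreyWt σ s η : ℂ) * (𝓕 f : L2) η) 2 volume < ∞ := by
  rw [MemGevrey, gevreyENorm_eq] at h
  exact ENNReal.lt_top_of_mul_ne_top_right h.ne fourierConst_ne_zero

theorem exists_of_memGevrey_zero {σ : ℝ≥0} {f : L2} (h : MemGevrey σ 0 f) :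
    ∃ a : L2, 𝓕 f = mulOp (wtSymb σ) a := by
  have hL : MemLp (fun η => (gevreyWt σ 0 η : ℂ) * (𝓕 f : L2) η) 2 volume :=
    ⟨(Complex.measurable_ofReal.comp (measurable_gevreyWt σ 0)).aestronglyMeasurable.mul
      (Lp.aestronglyMeasurable _), eLpNorm_lt_top_of_memGevrey h⟩
  refine ⟨hL.toLp, Lp.ext ?_⟩
  filter_upwards [coeFn_mulOp (wtSymb σ) hL.toLp, hL.coeFn_toLp] with η h1 h2
  rw [h1, h2, ← mul_assoc, wtSymb_apply, gevreyWt, Real.rpow_zero, mul_one,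
    ← Complex.ofReal_mul, ← Real.exp_add]
  simp

theorem exists_of_memGevrey_one {σ : ℝ≥0} {f : L2} (h : MemGevrey σ 1 f) :
    ∃ a : L2, 𝓕 f = mulOp (wtSymb σ) (lam a) := by
  have hL : MemLp (fun η => (lamSymb η)⁻¹ * ((wtSymb σ η)⁻¹ * (𝓕 f : L2) η)) 2 volume := by
    refine MemLp.congr_norm (f := fun η => (gevreyWt σ 1 η : ℂ) * (𝓕 f : L2) η)
      ⟨(Complex.measurable_ofReal.comp (measurable_gevreyWt σ 1)).aestronglyMeasurable.mul
        (Lp.aestronglyMeasurable _), eLpNorm_lt_top_of_memGevrey h⟩ ?_ ?_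
    · exact (lamSymb.continuous.measurable.inv.aestronglyMeasurable).mul
        ((wtSymb σ).continuous.measurable.inv.aestronglyMeasurable.mul
          (Lp.aestronglyMeasurable _))
    · refine Eventually.of_forall fun η => ?_
      rw [← norm_gevreyWt_one_mul_wtSymb σ η ((lamSymb η)⁻¹ * _),
        mul_inv_cancel_left₀ (lamSymb_ne_zero η), mul_inv_cancel_left₀ (wtSymb_ne_zero σ η)]
  refine ⟨hL.toLp, Lp.ext ?_⟩
  filter_upwards [coeFn_mulOp (wtSymb σ) (lam hL.toLp), coeFn_mulOp lamSymb hL.toLp,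
    hL.coeFn_toLp] with η h1 h2 h3
  rw [h1, h2, h3, mul_inv_cancel_left₀ (lamSymb_ne_zero η),
    mul_inv_cancel_left₀ (wtSymb_ne_zero σ η)]

theorem gevreyENorm_mono {σ : ℝ≥0} (s : ℝ) (f : L2) :
    gevreyENorm 0 s f ≤ gevreyENorm σ s f := by
  rw [gevreyENorm_eq, gevreyENorm_eq]
  gcongr
  refine eLpNorm_mono fun η => ?_
  rw [norm_mul, norm_mul, Complex.norm_real, Complex.norm_real,
    Real.norm_of_nonneg (gevreyWt_nonneg _ _ _), Real.norm_of_nonneg (gevreyWt_nonneg _ _ _)]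
  gcongr
  unfold gevreyWt
  have h1 := one_le_jap (2 * Real.pi * η)
  gcongr
  exact σ.2

theorem contX_zero_of_contX {σ : ℝ≥0} {T : ℝ} {u : ℝ → State} (h : ContX σ T u) :
    ContX 0 T u := by
  refine ⟨fun t ht => ?_, fun t ht => ?_⟩
  · have := h.1 t ht
    exact ⟨fun i => (gevreyENorm_mono _ _).trans_lt (this.mem_ψ i),
      (gevreyENorm_mono _ _).trans_lt this.mem_φ, (gevreyENorm_mono _ _).trans_lt this.mem_φt,
      this.real_φ, this.real_φt⟩
  · refine tendsto_of_tendsto_of_tendsto_of_le_of_le tendsto_const_nhds (h.2 t ht)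
      (fun _ => zero_le) fun s => ?_
    unfold distX
    gcongr <;> exact gevreyENorm_mono _ _

/-! ### The norms of the initial data -/

theorem gevreyNorm_zero_eq {σ : ℝ≥0} {f a : L2} (h : 𝓕 f = mulOp (wtSymb σ) a) :
    gevreyNorm σ 0 f = fourierConst.toReal * ‖a‖ := by
  rw [gevreyNorm, gevreyENorm_zero_eq h, ENNReal.toReal_mul, toReal_enorm]

theorem gevreyNorm_one_eq {σ : ℝ≥0} {f a : L2} (h : 𝓕 f = mulOp (wtSymb σ) (lam a)) :
    gevreyNorm σ 1 f = fourierConst.toReal * ‖a‖ := by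
  rw [gevreyNorm, gevreyENorm_one_eq h, ENNReal.toReal_mul, toReal_enorm]

theorem norm_le_gevreyNorm_zero {σ : ℝ≥0} {f a : L2} (h : 𝓕 f = mulOp (wtSymb σ) a) :
    ‖a‖ ≤ gevreyNorm σ 0 f := by
  rw [gevreyNorm_zero_eq h]
  exact le_mul_of_one_le_left (norm_nonneg _) one_le_toReal_fourierConst

/-- The unimodular symbol `(1 + 2πiη) / ⟨2πη⟩`, by which `⟨D⟩⁻¹` and `(1 + ∂ₓ)⁻¹` differ. -/
def phaseSymb : ℝ →ᵇ ℂ :=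
  BoundedContinuousFunction.ofNormedAddCommGroup
    (fun ξ => (((jap (2 * Real.pi * ξ))⁻¹ : ℝ) : ℂ)
      * (1 + ((2 * Real.pi * ξ : ℝ) : ℂ) * Complex.I))
    (by
      refine Continuous.mul (Complex.continuous_ofReal.comp (Continuous.inv₀ ?_ fun ξ => ?_))
        (by fun_prop)
      · unfold jap; fun_prop
      · linarith [one_le_jap (2 * Real.pi * ξ)]) 1 (fun ξ => by
      have := one_le_jap (2 * Real.pi * ξ)
      rw [norm_mul, norm_one_add, Complex.norm_real, Real.norm_of_nonneg (by positivity),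
        inv_mul_cancel₀ (by linarith)])

theorem norm_phaseSymb (ξ : ℝ) : ‖phaseSymb ξ‖ = 1 := by
  have := one_le_jap (2 * Real.pi * ξ)
  change ‖(((jap (2 * Real.pi * ξ))⁻¹ : ℝ) : ℂ)
      * (1 + ((2 * Real.pi * ξ : ℝ) : ℂ) * Complex.I)‖ = 1
  rw [norm_mul, norm_one_add, Complex.norm_real, Real.norm_of_nonneg (by positivity),
        inv_mul_cancel₀ (by linarith)]

theorem fourier_japInvD {σ : ℝ≥0} {f b : L2} (h : 𝓕 f = mulOp (wtSymb σ) b) :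
    𝓕 (japInvD f) = mulOp (wtSymb σ) (lam (mulOp phaseSymb b)) := by
  rw [japInvD, FourierTransform.fourier_fourierInv_eq]
  refine Lp.ext ?_
  have h' : (𝓕 f : L2) =ᵐ[volume] mulOp (wtSymb σ) b := by rw [h]
  filter_upwards [(memLp_japInv_mul (𝓕 f)).coeFn_toLp, h', coeFn_mulOp (wtSymb σ) b,
    coeFn_mulOp (wtSymb σ) (lam (mulOp phaseSymb b)), coeFn_mulOp lamSymb (mulOp phaseSymb b),
    coeFn_mulOp phaseSymb b] with η h1 h2 h3 h4 h5 h6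
  rw [h1, h2, h3, h4, h5, h6]
  have h7 : phaseSymb η = (((jap (2 * Real.pi * η))⁻¹ : ℝ) : ℂ)
      * (1 + ((2 * Real.pi * η : ℝ) : ℂ) * Complex.I) := rfl
  have h8 := inv_mul_cancel₀ (one_add_ne_zero η)
  rw [← lamSymb_apply] at h8
  rw [h7]
  linear_combination (-(((jap (2 * Real.pi * η))⁻¹ : ℝ) : ℂ) * (wtSymb σ η * b η)) * h8

/-- The norm `b₀` of the data controls `φ₀` in `G^{σ,1}` and `φ₁` in `G^{σ,0}`. -/
theorem norm_le_waveNorm {σ : ℝ≥0} {u : State} {a b : L2}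
    (ha : 𝓕 u.φ = mulOp (wtSymb σ) (lam a)) (hb : 𝓕 u.φt = mulOp (wtSymb σ) b) :
    ‖a‖ ≤ waveNorm σ u ∧ ‖b‖ ≤ waveNorm σ u := by
  have hp : 𝓕 (gPlus u) = mulOp (wtSymb σ)
      (lam ((1 / 2 : ℂ) • (a + Complex.I • mulOp phaseSymb b))) := by
    rw [gPlus, FourierTransform.fourier_smul, FourierTransform.fourier_add,
      FourierTransform.fourier_smul, fourier_japInvD hb, ha]
    simp only [map_smul, map_add]
  have hm : 𝓕 (gMinus u) = mulOp (wtSymb σ)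
      (lam ((1 / 2 : ℂ) • (a - Complex.I • mulOp phaseSymb b))) := by
    rw [gMinus, FourierTransform.fourier_smul, sub_eq_add_neg, ← neg_smul,
      FourierTransform.fourier_add, FourierTransform.fourier_smul, fourier_japInvD hb, ha]
    simp only [map_smul, sub_eq_add_neg, map_add, map_neg, neg_smul]
  have hw : ‖(1 / 2 : ℂ) • (a + Complex.I • mulOp phaseSymb b)‖
      + ‖(1 / 2 : ℂ) • (a - Complex.I • mulOp phaseSymb b)‖ ≤ waveNorm σ u := by
    rw [waveNorm, gevreyNorm_one_eq hp, gevreyNorm_one_eq hm, ← mul_add]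
    exact le_mul_of_one_le_left (by positivity) one_le_toReal_fourierConst
  constructor
  · refine le_trans ?_ ((norm_add_le _ _).trans hw)
    rw [← smul_add]
    apply le_of_eq
    congr 1
    module
  · refine le_trans ?_ ((norm_sub_le _ _).trans hw)
    rw [← smul_sub]
    have : (1 / 2 : ℂ) • (a + Complex.I • mulOp phaseSymb b - (a - Complex.I • mulOp phaseSymb b))
        = Complex.I • mulOp phaseSymb b := by module
    rw [this, norm_smul, Complex.norm_I, one_mul, norm_mulOp_eq norm_phaseSymb]

/-! ### The system in normal form -/

/-- The phase space of the system in normal form: the two components of the spinor and the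
normal form variables which stand for `∂ₜφ + (1 + ∂ₓ)φ` and `∂ₜφ - (1 + ∂ₓ)φ`, all seen on the
frequency side. -/
abbrev Phase : Type := L2 × L2 × L2 × L2

/-- The real part of a function, seen on its Fourier transform. -/
def re : L2 →L[ℝ] L2 := (1 / 2 : ℝ) • (ContinuousLinearMap.id ℝ L2 + cc)

theorem re_apply (F : L2) : re F = (1 / 2 : ℝ) • (F + cc F) := rfl

theorem norm_re_le (F : L2) : ‖re F‖ ≤ ‖F‖ := by
  rw [re_apply, norm_smul]
  have := norm_add_le F (cc F)
  have := norm_cc_le F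
  norm_num
  linarith

theorem cc_re (F : L2) : cc (re F) = re F := by
  rw [re_apply, map_smul, map_add, cc_cc, add_comm]

theorem re_of_cc {F : L2} (h : cc F = F) : re F = F := by
  rw [re_apply, h, ← two_smul ℝ F, smul_smul]; norm_num

theorem re_mulOp {m : ℝ →ᵇ ℂ} (h : ∀ F, cc (mulOp m F) = mulOp m (cc F)) (F : L2) :
    re (mulOp m F) = mulOp m (re F) := by
  rw [re_apply, re_apply, h, ← map_add]
  exact (((mulOp m).restrictScalars ℝ).map_smul _ _).symm

/-- `∂ₜφ + (1 + ∂ₓ)φ` in terms of the normal form variables. -/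
def fieldA (σ : ℝ≥0) (y : Phase) : L2 := y.2.2.1 - re (prod σ (cc y.1) y.2.1)

/-- `∂ₜφ - (1 + ∂ₓ)φ` in terms of the normal form variables. -/
def fieldB (σ : ℝ≥0) (y : Phase) : L2 := y.2.2.2 + re (prod σ y.2.1 (cc y.1))

/-- `2 (1 + ∂ₓ) φ`. -/
def fieldDiff (σ : ℝ≥0) (y : Phase) : L2 := fieldA σ y - fieldB σ y

/-- The source `i (φ - M) v` of the transport equation of `u`. -/
def srcU (M : ℝ) (σ : ℝ≥0) (y : Phase) : L2 :=
  (Complex.I / 2) • prod σ (fieldDiff σ y) y.2.1 - (Complex.I * M) • y.2.1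

/-- The source `i (φ - M) u` of the transport equation of `v`. -/
def srcV (M : ℝ) (σ : ℝ≥0) (y : Phase) : L2 :=
  (Complex.I / 2) • prod σ (fieldDiff σ y) y.1 - (Complex.I * M) • y.1

/-- The source of the equation of the first wave variable in normal form. -/
def srcA (M m : ℝ) (σ : ℝ≥0) (y : Phase) : L2 :=
  re (fieldB σ y + ((1 - m ^ 2) / 2 : ℝ) • lam (fieldDiff σ y)
    + (2 : ℝ) • prod σ (cc y.1) y.2.1 + prod σ (cc (srcU M σ y)) y.2.1
    + prod σ (cc y.1) (srcV M σ y))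

/-- The source of the equation of the second wave variable in normal form. -/
def srcB (M m : ℝ) (σ : ℝ≥0) (y : Phase) : L2 :=
  re (-fieldA σ y + ((1 - m ^ 2) / 2 : ℝ) • lam (fieldDiff σ y)
    + (2 : ℝ) • prod σ y.2.1 (cc y.1) - prod σ y.2.1 (cc (srcU M σ y))
    - prod σ (srcV M σ y) (cc y.1))

/-- The nonlinearity of the system in normal form. -/
def source (M m : ℝ) (σ : ℝ≥0) (y : Phase) : Phase :=
  (srcU M σ y, srcV M σ y, srcA M m σ y, srcB M m σ y)

/-- The free evolution: `u` and the second wave variable move to the right, the others to the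
left. -/
def free (t : ℝ) : Phase →L[ℂ] Phase :=
  (tr t).prodMap ((tr (-t)).prodMap ((tr (-t)).prodMap (tr t)))

theorem free_apply (t : ℝ) (y : Phase) :
    free t y = (tr t y.1, tr (-t) y.2.1, tr (-t) y.2.2.1, tr t y.2.2.2) := rfl

theorem norm_free (t : ℝ) (y : Phase) : ‖free t y‖ = ‖y‖ := by
  simp only [free_apply, Prod.norm_def, norm_tr]

theorem free_neg_free (t : ℝ) (y : Phase) : free (-t) (free t y) = y := by
  simp only [free_apply, tr_neg_tr, neg_neg, tr_tr_neg]

theorem free_free_neg (t : ℝ) (y : Phase) : free t (free (-t) y) = y := by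
  simpa using free_neg_free (-t) y

theorem tendsto_free {ι : Type*} {l : Filter ι} {c : ι → ℝ} {F : ι → Phase} {c₀ : ℝ} {F₀ : Phase}
    (hc : Tendsto c l (𝓝 c₀)) (hF : Tendsto F l (𝓝 F₀)) :
    Tendsto (fun i => free (c i) (F i)) l (𝓝 (free c₀ F₀)) := by
  simp only [free_apply]
  have h1 := (continuous_fst.tendsto F₀).comp hF
  have h2 := (continuous_snd.tendsto F₀).comp hF
  have h3 := (continuous_fst.tendsto _).comp h2
  have h4 := (continuous_snd.tendsto _).comp h2
  have h5 := (continuous_fst.tendsto _).comp h4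
  have h6 := (continuous_snd.tendsto _).comp h4
  exact (tendsto_tr hc h1).prodMk_nhds ((tendsto_tr hc.neg h3).prodMk_nhds
    ((tendsto_tr hc.neg h5).prodMk_nhds (tendsto_tr hc h6)))

/-- The vector field of the system in normal form in the interaction picture, that is, for the
unknown `free (-t) y(t)`. -/
def vfield (M m : ℝ) (σ : ℝ≥0) (t : ℝ) (z : Phase) : Phase :=
  free (-t) (source M m σ (free t z))

/-! ### Lipschitz bounds -/

/-- Lipschitz continuity on bounded sets. -/
def LipBdd {E G : Type*} [SeminormedAddCommGroup E] [SeminormedAddCommGroup G]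
    (f : E → G) : Prop :=
  ∀ R : ℝ, ∃ K : ℝ≥0, LipschitzOnWith K f (Metric.closedBall 0 R)

namespace LipBdd

variable {E G H : Type*} [SeminormedAddCommGroup E] [SeminormedAddCommGroup G]
  [SeminormedAddCommGroup H] {f g : E → G}

theorem of_lipschitz {K : ℝ≥0} (h : LipschitzWith K f) : LipBdd f :=
  fun _ => ⟨K, h.lipschitzOnWith⟩

theorem comp_lipschitz {K : ℝ≥0} {L : G → H} (h : LipschitzWith K L) (hf : LipBdd f) :
    LipBdd fun x => L (f x) := fun R => by
  obtain ⟨K', h'⟩ := hf R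
  exact ⟨_, h.comp_lipschitzOnWith h'⟩

theorem add (hf : LipBdd f) (hg : LipBdd g) : LipBdd fun x => f x + g x := fun R => by
  obtain ⟨K, h⟩ := hf R
  obtain ⟨K', h'⟩ := hg R
  exact ⟨_, h.add h'⟩

theorem sub (hf : LipBdd f) (hg : LipBdd g) : LipBdd fun x => f x - g x := fun R => by
  obtain ⟨K, h⟩ := hf R
  obtain ⟨K', h'⟩ := hg R
  exact ⟨_, h.sub h'⟩

theorem neg (hf : LipBdd f) : LipBdd fun x => -f x := fun R => by
  obtain ⟨K, h⟩ := hf R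
  exact ⟨_, h.neg⟩

theorem prodMk {g : E → H} (hf : LipBdd f) (hg : LipBdd g) : LipBdd fun x => (f x, g x) :=
  fun R => by
  obtain ⟨K, h⟩ := hf R
  obtain ⟨K', h'⟩ := hg R
  exact ⟨_, h.prodMk h'⟩

theorem exists_bound (hf : LipBdd f) (R : ℝ) :
    ∃ C, 0 ≤ C ∧ ∀ x ∈ Metric.closedBall (0 : E) R, ‖f x‖ ≤ C := by
  obtain ⟨K, h⟩ := hf R
  refine ⟨K * |R| + ‖f 0‖, by positivity, fun x hx => ?_⟩
  have hx' : ‖x‖ ≤ R := by simpa using hx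
  have h0 : (0 : E) ∈ Metric.closedBall (0 : E) R := by
    simpa using (norm_nonneg x).trans hx'
  have := h.norm_sub_le hx h0
  rw [sub_zero] at this
  have h2 : (K : ℝ) * ‖x‖ ≤ K * |R| := by gcongr; exact hx'.trans (le_abs_self R)
  calc ‖f x‖ = ‖(f x - f 0) + f 0‖ := by simp
    _ ≤ ‖f x - f 0‖ + ‖f 0‖ := norm_add_le _ _
    _ ≤ _ := by linarith

theorem continuous (hf : LipBdd f) : Continuous f := by
  refine continuous_iff_continuousAt.2 fun x => ?_
  obtain ⟨K, h⟩ := hf (‖x‖ + 1)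
  refine h.continuousOn.continuousAt ?_
  refine mem_of_superset (Metric.ball_mem_nhds x one_pos) fun y hy => ?_
  rw [mem_closedBall_zero_iff]
  have h1 : ‖y - x‖ < 1 := by simpa [dist_eq_norm] using hy
  calc ‖y‖ = ‖x + (y - x)‖ := by simp
    _ ≤ ‖x‖ + ‖y - x‖ := norm_add_le _ _
    _ ≤ _ := by linarith

end LipBdd

theorem LipBdd.prod {E : Type*} [SeminormedAddCommGroup E] {f g : E → L2} (σ : ℝ≥0)
    (hf : LipBdd f) (hg : LipBdd g) : LipBdd fun x => DKG.prod σ (f x) (g x) := fun R => by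
  obtain ⟨C, hC, hfC⟩ := hf.exists_bound R
  obtain ⟨C', hC', hgC⟩ := hg.exists_bound R
  obtain ⟨K, h⟩ := hf R
  obtain ⟨K', h'⟩ := hg R
  refine ⟨Real.toNNReal (lamNorm * (K * C' + C * K')), ?_⟩
  refine LipschitzOnWith.of_dist_le_mul fun x hx y hy => ?_
  have hl := lamNorm_nonneg
  rw [dist_eq_norm, dist_eq_norm, Real.coe_toNNReal _ (by positivity)]
  have h1 := h.norm_sub_le hx hy
  have h2 := h'.norm_sub_le hx hy
  have e : DKG.prod σ (f x) (g x) - DKG.prod σ (f y) (g y)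
      = DKG.prod σ (f x - f y) (g x) + DKG.prod σ (f y) (g x - g y) := by
    simp only [map_sub, _root_.sub_apply]; abel
  rw [e]
  calc _ ≤ lamNorm * ‖f x - f y‖ * ‖g x‖ + lamNorm * ‖f y‖ * ‖g x - g y‖ :=
        (norm_add_le _ _).trans (add_le_add (norm_prod_le _ _ _) (norm_prod_le _ _ _))
    _ ≤ lamNorm * (K * ‖x - y‖) * C' + lamNorm * C * (K' * ‖x - y‖) := by
        gcongr
        · exact hgC x hx
        · exact hfC y hy
    _ = _ := by ring

theorem lipBdd_fieldA (σ : ℝ≥0) : LipBdd (fieldA σ) := by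
  have h1 : LipBdd fun y : Phase => y.1 := .of_lipschitz LipschitzWith.prod_fst
  have h2' : LipBdd fun y : Phase => y.2 := .of_lipschitz LipschitzWith.prod_snd
  have h2 : LipBdd fun y : Phase => y.2.1 := h2'.comp_lipschitz LipschitzWith.prod_fst
  have h3' : LipBdd fun y : Phase => y.2.2 := h2'.comp_lipschitz LipschitzWith.prod_snd
  have h3 : LipBdd fun y : Phase => y.2.2.1 := h3'.comp_lipschitz LipschitzWith.prod_fst
  exact h3.sub (((h1.comp_lipschitz cc.lipschitz).prod σ h2).comp_lipschitz re.lipschitz)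

theorem lipBdd_fieldB (σ : ℝ≥0) : LipBdd (fieldB σ) := by
  have h1 : LipBdd fun y : Phase => y.1 := .of_lipschitz LipschitzWith.prod_fst
  have h2' : LipBdd fun y : Phase => y.2 := .of_lipschitz LipschitzWith.prod_snd
  have h2 : LipBdd fun y : Phase => y.2.1 := h2'.comp_lipschitz LipschitzWith.prod_fst
  have h3' : LipBdd fun y : Phase => y.2.2 := h2'.comp_lipschitz LipschitzWith.prod_snd
  have h4 : LipBdd fun y : Phase => y.2.2.2 := h3'.comp_lipschitz LipschitzWith.prod_snd
  exact h4.add ((h2.prod σ (h1.comp_lipschitz cc.lipschitz)).comp_lipschitz re.lipschitz)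

theorem lipBdd_source (M m : ℝ) (σ : ℝ≥0) : LipBdd (source M m σ) := by
  have h1 : LipBdd fun y : Phase => y.1 := .of_lipschitz LipschitzWith.prod_fst
  have h2' : LipBdd fun y : Phase => y.2 := .of_lipschitz LipschitzWith.prod_snd
  have h2 : LipBdd fun y : Phase => y.2.1 := h2'.comp_lipschitz LipschitzWith.prod_fst
  have hcc : ∀ {f : Phase → L2}, LipBdd f → LipBdd fun y => cc (f y) :=
    fun hf => hf.comp_lipschitz cc.lipschitz
  have hre : ∀ {f : Phase → L2}, LipBdd f → LipBdd fun y => re (f y) :=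
    fun hf => hf.comp_lipschitz re.lipschitz
  have hlam : ∀ {f : Phase → L2}, LipBdd f → LipBdd fun y => lam (f y) :=
    fun hf => hf.comp_lipschitz lam.lipschitz
  have hs : ∀ (c : ℂ) {f : Phase → L2}, LipBdd f → LipBdd fun y => c • f y :=
    fun c _ hf => hf.comp_lipschitz (lipschitzWith_smul c)
  have hsr : ∀ (c : ℝ) {f : Phase → L2}, LipBdd f → LipBdd fun y => c • f y :=
    fun c _ hf => hf.comp_lipschitz (lipschitzWith_smul c)
  have hA := lipBdd_fieldA σ
  have hB := lipBdd_fieldB σ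
  have hD : LipBdd (fieldDiff σ) := hA.sub hB
  have hu : LipBdd (srcU M σ) := (hs _ (hD.prod σ h2)).sub (hs _ h2)
  have hv : LipBdd (srcV M σ) := (hs _ (hD.prod σ h1)).sub (hs _ h1)
  have ha : LipBdd (srcA M m σ) := hre ((((hB.add (hsr _ (hlam hD))).add
    (hsr _ ((hcc h1).prod σ h2))).add ((hcc hu).prod σ h2)).add ((hcc h1).prod σ hv))
  have hb : LipBdd (srcB M m σ) := hre ((((hA.neg.add (hsr _ (hlam hD))).add
    (hsr _ (h2.prod σ (hcc h1)))).sub (h2.prod σ (hcc hu))).sub (hv.prod σ (hcc h1)))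
  exact hu.prodMk (hv.prodMk (ha.prodMk hb))

theorem vfield_lipschitz (M m : ℝ) (σ : ℝ≥0) (R : ℝ) :
    ∃ K : ℝ≥0, ∀ t, LipschitzOnWith K (vfield M m σ t) (Metric.closedBall 0 R) := by
  obtain ⟨K, h⟩ := lipBdd_source M m σ R
  refine ⟨K, fun t => LipschitzOnWith.of_dist_le_mul fun x hx y hy => ?_⟩
  have hm : ∀ z ∈ Metric.closedBall (0 : Phase) R, free t z ∈ Metric.closedBall (0 : Phase) R := by
    intro z hz
    rw [mem_closedBall_zero_iff] at hz ⊢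
    rwa [norm_free]
  have := h.dist_le_mul _ (hm x hx) _ (hm y hy)
  rw [dist_eq_norm, dist_eq_norm] at this ⊢
  rwa [vfield, vfield, ← map_sub, norm_free, ← norm_free t (x - y), map_sub]

theorem continuousOn_vfield (M m : ℝ) (σ : ℝ≥0) {z : ℝ → Phase} {s : Set ℝ}
    (hz : ContinuousOn z s) : ContinuousOn (fun t => vfield M m σ t (z t)) s := by
  intro t ht
  have h1 : Tendsto (fun r : ℝ => r) (𝓝[s] t) (𝓝 t) := tendsto_id.mono_left nhdsWithin_le_nhds
  exact tendsto_free h1.neg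
    (((lipBdd_source M m σ).continuous.tendsto _).comp (tendsto_free h1 (hz t ht)))

/-- Size of the nonlinearity. The spinor is of size `μ` and the field of size `μ²`; each of the
terms gains at most a factor `μ²`. -/
theorem exists_source_bound (M m R : ℝ) (hR : 0 ≤ R) : ∃ C, 0 < C ∧ ∀ (σ : ℝ≥0) (μ : ℝ), 1 ≤ μ →
    ∀ y : Phase, ‖y.1‖ ≤ R * μ → ‖y.2.1‖ ≤ R * μ → ‖y.2.2.1‖ ≤ R * μ ^ 2 →
      ‖y.2.2.2‖ ≤ R * μ ^ 2 →
      ‖srcU M σ y‖ ≤ C * μ ^ 3 ∧ ‖srcV M σ y‖ ≤ C * μ ^ 3 ∧ ‖srcA M m σ y‖ ≤ C * μ ^ 4 ∧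
        ‖srcB M m σ y‖ ≤ C * μ ^ 4 := by
  have hl := lamNorm_nonneg
  set N := lamNorm with hN
  set R₁ := R + N * R ^ 2 with hR₁
  set R₂ := N * R₁ * R + |M| * R with hR₂
  set R₃ := R₁ + |1 - m ^ 2| * R₁ + 2 * (N * R ^ 2) + 2 * (N * R₂ * R) with hR₃
  have p1 : 0 ≤ R₁ := by positivity
  have p2 : 0 ≤ R₂ := by positivity
  have p3 : 0 ≤ R₃ := by positivity
  refine ⟨R₂ + R₃ + 1, by positivity, fun σ μ hμ y h1 h2 h3 h4 => ?_⟩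
  have hμ0 : 0 ≤ μ := by linarith
  have hc1 : ‖cc y.1‖ ≤ R * μ := (norm_cc_le _).trans h1
  have hP : ∀ {a b : L2} {α β : ℝ}, ‖a‖ ≤ α → ‖b‖ ≤ β → ‖prod σ a b‖ ≤ N * α * β := by
    intro a b α β ha hb
    have : 0 ≤ α := (norm_nonneg _).trans ha
    exact (norm_prod_le σ a b).trans (by gcongr)
  have hA : ‖fieldA σ y‖ ≤ R₁ * μ ^ 2 := by
    refine (norm_sub_le _ _).trans ?_
    have := (norm_re_le _).trans (hP hc1 h2)
    calc _ ≤ R * μ ^ 2 + N * (R * μ) * (R * μ) := add_le_add h3 this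
      _ = _ := by rw [hR₁]; ring
  have hB : ‖fieldB σ y‖ ≤ R₁ * μ ^ 2 := by
    refine (norm_add_le _ _).trans ?_
    have := (norm_re_le _).trans (hP h2 hc1)
    calc _ ≤ R * μ ^ 2 + N * (R * μ) * (R * μ) := add_le_add h4 this
      _ = _ := by rw [hR₁]; ring
  have hD : ‖fieldDiff σ y‖ ≤ 2 * R₁ * μ ^ 2 := by
    refine (norm_sub_le _ _).trans ?_
    linarith
  have hsrc : ∀ w : L2, ‖w‖ ≤ R * μ →
      ‖(Complex.I / 2) • prod σ (fieldDiff σ y) w - (Complex.I * M) • w‖ ≤ R₂ * μ ^ 3 := by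
    intro w hw
    refine (norm_sub_le _ _).trans ?_
    rw [norm_smul, norm_smul, norm_div, norm_mul, Complex.norm_I, Complex.norm_real,
      Real.norm_eq_abs]
    have h5 : μ ≤ μ ^ 3 := le_self_pow₀ hμ (by norm_num)
    have h6 : |M| * (R * μ) ≤ |M| * (R * μ ^ 3) := by gcongr
    have h7 : |M| * ‖w‖ ≤ |M| * (R * μ) := by gcongr
    have h8 := hP hD hw
    norm_num
    calc _ ≤ 1 / 2 * (N * (2 * R₁ * μ ^ 2) * (R * μ)) + |M| * (R * μ ^ 3) :=
          add_le_add (by gcongr) (h7.trans h6)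
      _ = _ := by rw [hR₂]; ring
  have hU : ‖srcU M σ y‖ ≤ R₂ * μ ^ 3 := hsrc _ h2
  have hV : ‖srcV M σ y‖ ≤ R₂ * μ ^ 3 := hsrc _ h1
  have hcU : ‖cc (srcU M σ y)‖ ≤ R₂ * μ ^ 3 := (norm_cc_le _).trans hU
  have hL : ‖((1 - m ^ 2) / 2 : ℝ) • lam (fieldDiff σ y)‖ ≤ |1 - m ^ 2| * R₁ * μ ^ 2 := by
    rw [norm_smul, Real.norm_eq_abs, abs_div, abs_two]
    have := (norm_lam_le _).trans hD
    calc _ ≤ |1 - m ^ 2| / 2 * (2 * R₁ * μ ^ 2) := by gcongr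
      _ = _ := by ring
  have h24 : μ ^ 2 ≤ μ ^ 4 := pow_le_pow_right₀ hμ (by norm_num)
  have hfin : R₁ * μ ^ 2 + |1 - m ^ 2| * R₁ * μ ^ 2 + 2 * (N * (R * μ) * (R * μ))
      + N * (R₂ * μ ^ 3) * (R * μ) + N * (R₂ * μ ^ 3) * (R * μ) ≤ R₃ * μ ^ 4 := by
    calc _ = (R₁ + |1 - m ^ 2| * R₁ + 2 * (N * R ^ 2)) * μ ^ 2 + 2 * (N * R₂ * R) * μ ^ 4 := by
          ring
      _ ≤ (R₁ + |1 - m ^ 2| * R₁ + 2 * (N * R ^ 2)) * μ ^ 4 + 2 * (N * R₂ * R) * μ ^ 4 := by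
          gcongr
      _ = _ := by rw [hR₃]; ring
  have n2 : ∀ x : L2, ‖(2 : ℝ) • x‖ = 2 * ‖x‖ := fun x => by rw [norm_smul]; norm_num
  have m3 : 0 ≤ μ ^ 3 := by positivity
  have m4 : 0 ≤ μ ^ 4 := by positivity
  refine ⟨hU.trans (by gcongr; linarith), hV.trans (by gcongr; linarith), ?_, ?_⟩
  · have e1 := hP hc1 h2
    have e2 := hP hcU h2
    have e3 := hP hc1 hV
    have : ‖srcA M m σ y‖ ≤ R₃ * μ ^ 4 := by
      refine (norm_re_le _).trans ((norm_add_le _ _).trans ?_)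
      refine (add_le_add ((norm_add_le _ _).trans (add_le_add ((norm_add_le _ _).trans
        (add_le_add ((norm_add_le _ _).trans (add_le_add hB hL)) le_rfl)) e2)) e3).trans ?_
      rw [n2]
      linarith
    exact this.trans (by gcongr; linarith)
  · have e1 := hP h2 hc1
    have e2 := hP h2 hcU
    have e3 := hP hV hc1
    have : ‖srcB M m σ y‖ ≤ R₃ * μ ^ 4 := by
      refine (norm_re_le _).trans ((norm_sub_le _ _).trans ?_)
      refine (add_le_add ((norm_sub_le _ _).trans (add_le_add ((norm_add_le _ _).trans
        (add_le_add ((norm_add_le _ _).trans (add_le_add ((norm_neg _).le.trans hA) hL)) le_rfl))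
          e2)) e3).trans ?_
      rw [n2]
      linarith
    exact this.trans (by gcongr; linarith)

/-! ### Local existence for the system in normal form -/

/-- The anisotropic scaling of phase space under which the data have size one. -/
def scale (μ : ℝ) : Phase →L[ℝ] Phase :=
  (μ • ContinuousLinearMap.id ℝ L2).prodMap ((μ • ContinuousLinearMap.id ℝ L2).prodMap
    ((μ ^ 2 • ContinuousLinearMap.id ℝ L2).prodMap (μ ^ 2 • ContinuousLinearMap.id ℝ L2)))

theorem scale_apply (μ : ℝ) (y : Phase) :
    scale μ y = (μ • y.1, μ • y.2.1, μ ^ 2 • y.2.2.1, μ ^ 2 • y.2.2.2) := rfl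

theorem scale_scale_inv {μ : ℝ} (hμ : μ ≠ 0) (y : Phase) : scale μ (scale μ⁻¹ y) = y := by
  simp only [scale_apply, smul_smul]
  have : μ ^ 2 * μ⁻¹ ^ 2 = 1 := by field_simp
  rw [mul_inv_cancel₀ hμ, this]; simp

/-- Local existence, uniformly in `σ`, by Picard's theorem. In the variables rescaled by `scale μ`
the data and the radius of the ball are of size one, and the vector field is of size `μ²`, so that the
solution exists up to a time comparable to `μ⁻²`. -/
theorem exists_solution_vfield (M m R : ℝ) (hR : 0 ≤ R) : ∃ c, 0 < c ∧
    ∀ (σ : ℝ≥0) (μ : ℝ), 1 ≤ μ → ∀ y : Phase, ‖y.1‖ ≤ R * μ → ‖y.2.1‖ ≤ R * μ →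
      ‖y.2.2.1‖ ≤ R * μ ^ 2 → ‖y.2.2.2‖ ≤ R * μ ^ 2 → ∀ δ, 0 ≤ δ → δ * μ ^ 2 ≤ c →
      ∃ z : ℝ → Phase, z 0 = y ∧ ∀ t ∈ Set.Icc 0 δ,
        HasDerivWithinAt z (vfield M m σ t (z t)) (Set.Icc 0 δ) t := by
  obtain ⟨C, hC, hsrc⟩ := exists_source_bound M m (R + 1) (by linarith)
  refine ⟨C⁻¹, by positivity, fun σ μ hμ y h1 h2 h3 h4 δ hδ hδc => ?_⟩
  have hμ0 : 0 < μ := by linarith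
  have hle : ∀ (x : L2) (k : ℕ), ‖x‖ ≤ R * μ ^ k → ‖μ⁻¹ ^ k • x‖ ≤ R := by
    intro x k hx
    rw [norm_smul, Real.norm_of_nonneg (by positivity), inv_pow, inv_mul_le_iff₀ (by positivity)]
    linarith
  have hy0 : ‖scale μ⁻¹ y‖ ≤ R := by
    rw [scale_apply]
    simp only [Prod.norm_def, sup_le_iff]
    exact ⟨by simpa using hle _ 1 (by simpa using h1), by simpa using hle _ 1 (by simpa using h2),
      hle _ 2 h3, hle _ 2 h4⟩
  have hball : ∀ x ∈ Metric.closedBall (scale μ⁻¹ y) (1 : ℝ≥0), ‖x‖ ≤ R + 1 := by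
    intro x hx
    rw [mem_closedBall_iff_norm] at hx
    calc ‖x‖ = ‖(x - scale μ⁻¹ y) + scale μ⁻¹ y‖ := by simp
      _ ≤ _ := norm_add_le _ _
      _ ≤ 1 + R := add_le_add (by simpa using hx) hy0
      _ = _ := by ring
  obtain ⟨K, hK⟩ := vfield_lipschitz M m σ (‖scale μ‖ * (R + 1))
  have hmaps : Set.MapsTo (scale μ) (Metric.closedBall (scale μ⁻¹ y) (1 : ℝ≥0))
      (Metric.closedBall 0 (‖scale μ‖ * (R + 1))) := by
    intro x hx
    rw [mem_closedBall_zero_iff]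
    exact ((scale μ).le_opNorm x).trans (by gcongr; exact hball x hx)
  have hPL : IsPicardLindelof (fun t x => scale μ⁻¹ (vfield M m σ t (scale μ x)))
      (tmin := 0) (tmax := δ) ⟨0, Set.left_mem_Icc.2 hδ⟩ (scale μ⁻¹ y) 1 0
      (Real.toNNReal (C * μ ^ 2)) (‖scale μ⁻¹‖₊ * (K * ‖scale μ‖₊)) := by
    refine ⟨fun t _ => ?_, fun x _ => ?_, fun t _ x hx => ?_, ?_⟩
    · exact (scale μ⁻¹).lipschitz.comp_lipschitzOnWith
        ((hK t).comp (scale μ).lipschitz.lipschitzOnWith hmaps)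
    · exact (scale μ⁻¹).continuous.comp_continuousOn
        (continuousOn_vfield M m σ (z := fun _ => scale μ x) continuousOn_const)
    · rw [Real.coe_toNNReal _ (by positivity)]
      have hx' := hball x hx
      simp only [Prod.norm_def, sup_le_iff] at hx'
      obtain ⟨x1, x2, x3, x4⟩ := hx'
      have hs : ∀ (w : L2) (k : ℕ), ‖w‖ ≤ R + 1 → ‖μ ^ k • w‖ ≤ (R + 1) * μ ^ k := by
        intro w k hw
        rw [norm_smul, Real.norm_of_nonneg (by positivity), mul_comm]
        gcongr
      obtain ⟨s1, s2, s3, s4⟩ := hsrc σ μ hμ (free t (scale μ x))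
        ((norm_tr t (μ • x.1)).trans_le (by simpa using hs _ 1 x1))
        ((norm_tr (-t) (μ • x.2.1)).trans_le (by simpa using hs _ 1 x2))
        ((norm_tr (-t) (μ ^ 2 • x.2.2.1)).trans_le (by simpa using hs _ 2 x3))
        ((norm_tr t (μ ^ 2 • x.2.2.2)).trans_le (by simpa using hs _ 2 x4))
      have hs' : ∀ (w : L2) (k : ℕ), ‖w‖ ≤ C * μ ^ (k + 2) → ‖μ⁻¹ ^ k • w‖ ≤ C * μ ^ 2 := by
        intro w k hw
        rw [norm_smul, Real.norm_of_nonneg (by positivity), inv_pow,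
          inv_mul_le_iff₀ (by positivity)]
        calc ‖w‖ ≤ _ := hw
          _ = _ := by ring
      rw [vfield, scale_apply, free_apply]
      simp only [Prod.norm_def, sup_le_iff]
      refine ⟨?_, ?_, ?_, ?_⟩
      · have q := hs' (tr (-t) (srcU M σ _)) 1 (by rw [norm_tr]; exact s1)
        rwa [pow_one] at q
      · have q := hs' (tr (- -t) (srcV M σ _)) 1 (by rw [norm_tr]; exact s2)
        rwa [pow_one] at q
      · exact hs' (tr (- -t) (srcA M m σ _)) 2 (by rw [norm_tr]; exact s3)
      · exact hs' (tr (-t) (srcB M m σ _)) 2 (by rw [norm_tr]; exact s4)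
    · rw [Real.coe_toNNReal _ (by positivity)]
      simp only [sub_zero, NNReal.coe_one, NNReal.coe_zero]
      rw [max_eq_left hδ]
      have := mul_le_mul_of_nonneg_left hδc hC.le
      rw [mul_inv_cancel₀ hC.ne'] at this
      linarith
  obtain ⟨α, hα0, hα⟩ := hPL.exists_eq_forall_mem_Icc_hasDerivWithinAt₀
  refine ⟨fun t => scale μ (α t), ?_, fun t ht => ?_⟩
  · change scale μ (α 0) = y
    have hα0' : α 0 = scale μ⁻¹ y := hα0
    rw [hα0', scale_scale_inv hμ0.ne']
  · have := (scale μ).hasFDerivAt.comp_hasDerivWithinAt t (hα t ht)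
    rwa [scale_scale_inv hμ0.ne'] at this

/-! ### Change of the Gevrey weight -/

/-- Passage from the phase space weighted by `e^{2πσ|η|}` to the unweighted one. -/
def unweight (σ : ℝ≥0) : Phase →L[ℂ] Phase :=
  (mulOp (wtSymb σ)).prodMap ((mulOp (wtSymb σ)).prodMap
    ((mulOp (wtSymb σ)).prodMap (mulOp (wtSymb σ))))

theorem unweight_apply (σ : ℝ≥0) (y : Phase) : unweight σ y = (mulOp (wtSymb σ) y.1,
    mulOp (wtSymb σ) y.2.1, mulOp (wtSymb σ) y.2.2.1, mulOp (wtSymb σ) y.2.2.2) := rfl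

theorem re_wt (σ : ℝ≥0) (F : L2) : re (mulOp (wtSymb σ) F) = mulOp (wtSymb σ) (re F) :=
  re_mulOp (cc_wt σ) F

theorem fieldA_unweight (σ : ℝ≥0) (y : Phase) :
    fieldA 0 (unweight σ y) = mulOp (wtSymb σ) (fieldA σ y) := by
  simp only [fieldA, unweight_apply, map_sub, ← wt_prod, cc_wt, re_wt]

theorem fieldB_unweight (σ : ℝ≥0) (y : Phase) :
    fieldB 0 (unweight σ y) = mulOp (wtSymb σ) (fieldB σ y) := by
  simp only [fieldB, unweight_apply, map_add, ← wt_prod, cc_wt, re_wt]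

theorem fieldDiff_unweight (σ : ℝ≥0) (y : Phase) :
    fieldDiff 0 (unweight σ y) = mulOp (wtSymb σ) (fieldDiff σ y) := by
  rw [fieldDiff, fieldA_unweight, fieldB_unweight, fieldDiff, map_sub]

theorem srcU_unweight (M : ℝ) (σ : ℝ≥0) (y : Phase) :
    srcU M 0 (unweight σ y) = mulOp (wtSymb σ) (srcU M σ y) := by
  rw [srcU, srcU, fieldDiff_unweight]
  simp only [unweight_apply, ← wt_prod, map_sub, map_smul]

theorem srcV_unweight (M : ℝ) (σ : ℝ≥0) (y : Phase) :
    srcV M 0 (unweight σ y) = mulOp (wtSymb σ) (srcV M σ y) := by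
  rw [srcV, srcV, fieldDiff_unweight]
  simp only [unweight_apply, ← wt_prod, map_sub, map_smul]

theorem mulOp_real_smul (m : ℝ →ᵇ ℂ) (c : ℝ) (F : L2) : mulOp m (c • F) = c • mulOp m F :=
  ((mulOp m).restrictScalars ℝ).map_smul c F

theorem source_unweight (M m : ℝ) (σ : ℝ≥0) (y : Phase) :
    source M m 0 (unweight σ y) = unweight σ (source M m σ y) := by
  have hA : srcA M m 0 (unweight σ y) = mulOp (wtSymb σ) (srcA M m σ y) := by
    rw [srcA, srcA, fieldDiff_unweight, fieldB_unweight, srcU_unweight, srcV_unweight, ← re_wt]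
    simp only [unweight_apply, ← wt_prod, map_add, mulOp_real_smul, cc_wt,
      mulOp_comm (wtSymb σ) lamSymb]
  have hB : srcB M m 0 (unweight σ y) = mulOp (wtSymb σ) (srcB M m σ y) := by
    rw [srcB, srcB, fieldDiff_unweight, fieldA_unweight, srcU_unweight, srcV_unweight, ← re_wt]
    simp only [unweight_apply, ← wt_prod, map_add, map_sub, map_neg, mulOp_real_smul, cc_wt,
      mulOp_comm (wtSymb σ) lamSymb]
  rw [source, srcU_unweight, srcV_unweight, hA, hB]; rfl

theorem free_unweight (σ : ℝ≥0) (t : ℝ) (y : Phase) :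
    free t (unweight σ y) = unweight σ (free t y) := by
  simp only [free_apply, unweight_apply, mulOp_comm (wtSymb σ) (trSymb _)]

theorem vfield_unweight (M m : ℝ) (σ : ℝ≥0) (t : ℝ) (z : Phase) :
    vfield M m 0 t (unweight σ z) = unweight σ (vfield M m σ t z) := by
  rw [vfield, free_unweight, source_unweight, free_unweight, vfield]

/-! ### Weak time derivatives -/

theorem tendsto_apply₂ {E F G : Type*} [TopologicalSpace E] [TopologicalSpace F]
    [TopologicalSpace G] {f : E → F → G} (hf : Continuous fun p : E × F => f p.1 p.2)
    {α : Type*} {l : Filter α} {W : α → E} {Z : α → F} {w : E} {z : F}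
    (hW : Tendsto W l (𝓝 w)) (hZ : Tendsto Z l (𝓝 z)) :
    Tendsto (fun r => f (W r) (Z r)) l (𝓝 (f w z)) :=
  (hf.tendsto (w, z)).comp (hW.prodMk_nhds hZ)

theorem tendsto_dual {α : Type*} {l : Filter α} {W Z : α → L2} {w z : L2}
    (hW : Tendsto W l (𝓝 w)) (hZ : Tendsto Z l (𝓝 z)) :
    Tendsto (fun r => dual (W r) (Z r)) l (𝓝 (dual w z)) :=
  tendsto_apply₂ (f := fun F G => dual F G)
    ((dual.continuous.comp continuous_fst).clm_apply continuous_snd) hW hZ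

theorem tendsto_prod {α : Type*} {l : Filter α} {W Z : α → L2} {w z : L2}
    (hW : Tendsto W l (𝓝 w)) (hZ : Tendsto Z l (𝓝 z)) :
    Tendsto (fun r => prod 0 (W r) (Z r)) l (𝓝 (prod 0 w z)) :=
  tendsto_apply₂ (f := fun F G => prod 0 F G)
    (((prod 0).continuous.comp continuous_fst).clm_apply continuous_snd) hW hZ

/-- Product rule for the pairing of a curve which is only weakly differentiable with a
differentiable curve of test functions. -/
theorem hasDerivWithinAt_dual {W ζ : ℝ → L2} {ζ' : L2} {d : ℂ} {s : Set ℝ} {t : ℝ}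
    (hW : ContinuousWithinAt W s t) (hd : HasDerivWithinAt (fun r => dual (W r) (ζ t)) d s t)
    (hζ : HasDerivWithinAt ζ ζ' s t) :
    HasDerivWithinAt (fun r => dual (W r) (ζ r)) (d + dual (W t) ζ') s t := by
  rw [hasDerivWithinAt_iff_tendsto_slope] at hd hζ ⊢
  have h1 : Tendsto (fun r => dual (W r) (slope ζ t r)) (𝓝[s \ {t}] t) (𝓝 (dual (W t) ζ')) :=
    tendsto_dual (hW.mono_left (nhdsWithin_mono _ Set.sdiff_subset)) hζ
  refine (hd.add h1).congr fun r => ?_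
  have e : dual (W r) (slope ζ t r) = (r - t)⁻¹ • (dual (W r) (ζ r) - dual (W r) (ζ t)) := by
    rw [slope_def_module, ← map_sub]
    exact ((dual (W r)).restrictScalars ℝ).map_smul _ _
  rw [e, slope_def_module, slope_def_module, ← smul_add]
  congr 1; ring

theorem hasDerivWithinAt_dual_const {W : ℝ → L2} {W' : L2} {s : Set ℝ} {t : ℝ}
    (h : HasDerivWithinAt W W' s t) (G : L2) :
    HasDerivWithinAt (fun r => dual (W r) G) (dual W' G) s t :=
  ((dual.flip G).restrictScalars ℝ).hasFDerivAt.comp_hasDerivWithinAt t h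

theorem lam_tr (t : ℝ) (F : L2) : lam (tr t F) = tr t (lam F) := mulOp_comm _ _ F

theorem lam_injective : Function.Injective lam := mulOp_injective lamSymb_ne_zero

/-- Weak form of the transport of a curve: if the derivative of `W` is known weakly, then that of
`τ_{ct} W` is obtained by moving the derivative `c ∂ₓ` to the test function `(1 + ∂ₓ)⁻¹ a`. -/
theorem hasDerivWithinAt_dual_tr {W : ℝ → L2} {d : ℂ} {s : Set ℝ} {t c : ℝ} {a : L2}
    (hW : ContinuousWithinAt W s t)
    (hd : HasDerivWithinAt (fun r => dual (W r) (lam (tr (-(c * t)) a))) d s t) :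
    HasDerivWithinAt (fun r => dual (tr (c * r) (W r)) (lam a))
      (d + c * dual (tr (c * t) (W t)) (a - lam a)) s t := by
  have h1 := hasDerivWithinAt_tr (F := fun _ => lam a) (s := s) (t := t) (c := -c)
    (hasDerivWithinAt_const t s (lam a)) rfl
  have h2 := hasDerivWithinAt_dual hW (ζ := fun r => tr (-c * r) (lam a)) (d := d)
    (by simpa [lam_tr] using hd) h1
  simp only [neg_mul] at h2
  refine (h2.congr_deriv ?_).congr (fun r _ => by rw [dual_tr]) (by rw [dual_tr])
  rw [dual_tr, zero_add, neg_smul, ← smul_neg, neg_sub, mulOp_real_smul]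
  congr 1
  exact ((dual (W t)).restrictScalars ℝ).map_smul _ _

theorem dual_real_smul (r : ℝ) (F G : L2) : dual (r • F) G = r * dual F G :=
  ((dual.flip G).restrictScalars ℝ).map_smul r F

theorem hasDerivWithinAt_clm (S : L2 →L[ℂ] L2) {W : ℝ → L2} {W' : L2} {s : Set ℝ} {t : ℝ}
    (h : HasDerivWithinAt W W' s t) : HasDerivWithinAt (fun r => S (W r)) (S W') s t :=
  (S.restrictScalars ℝ).hasFDerivAt.comp_hasDerivWithinAt t h

/-- In a frame which moves with one of the factors the product is differentiable when tested with
`(1 + ∂ₓ)⁻¹ b`, because the derivative of the other factor falls on an element of `H¹`. -/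
theorem hasDerivWithinAt_dual_prod_moving {X Y : ℝ → L2} {X' Y' : L2} {s : Set ℝ} {t c : ℝ}
    (hX : HasDerivWithinAt X X' s t) (hY : HasDerivWithinAt Y Y' s t) (b : L2) :
    HasDerivWithinAt (fun r => dual (prod 0 (tr (c * r) (X r)) (Y r)) (lam b))
      (dual (tr (c * t) (lam X' + c • (lam (X t) - X t))) (prod 0 b (Y t))
        + dual (tr (c * t) (lam (X t))) (prod 0 b Y')) s t := by
  have hX1 : HasDerivWithinAt (fun r => lam (X r)) (lam X') s t :=
    hasDerivWithinAt_clm lam hX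
  have hX2 : HasDerivWithinAt (fun r => tr (c * r) (lam (X r)))
      (tr (c * t) (lam X' + c • (lam (X t) - X t))) s t := hasDerivWithinAt_tr hX1 rfl
  have hY1 : HasDerivWithinAt (fun r => prod 0 b (Y r)) (prod 0 b Y') s t :=
    hasDerivWithinAt_clm (prod 0 b) hY
  have h1 : HasDerivWithinAt (fun r => dual (tr (c * r) (lam (X r))) (prod 0 b (Y r)))
      (dual (tr (c * t) (lam X' + c • (lam (X t) - X t))) (prod 0 b (Y t))
        + dual (tr (c * t) (lam (X t))) (prod 0 b Y')) s t :=
    hasDerivWithinAt_dual hX2.continuousWithinAt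
      (hasDerivWithinAt_dual_const hX2 (prod 0 b (Y t))) hY1
  have e : ∀ r, dual (prod 0 (tr (c * r) (X r)) (Y r)) (lam b)
      = dual (tr (c * r) (lam (X r))) (prod 0 b (Y r)) := fun r => by
    rw [dual_prod_lam, lam_tr]
  simpa only [e] using h1

theorem continuousWithinAt_prod_moving {X Y : ℝ → L2} {s : Set ℝ} {t c : ℝ}
    (hX : ContinuousWithinAt X s t) (hY : ContinuousWithinAt Y s t) :
    ContinuousWithinAt (fun r => prod 0 (tr (c * r) (X r)) (Y r)) s t := by
  have hx : Tendsto (fun r => tr (c * r) (X r)) (𝓝[s] t) (𝓝 (tr (c * t) (X t))) :=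
    tendsto_tr (((continuous_const.mul continuous_id).tendsto t).mono_left nhdsWithin_le_nhds) hX
  exact tendsto_prod hx hY

theorem dual_prod_tr_tr (r : ℝ) (p q a : L2) :
    dual (tr r p) (prod 0 (tr r a) q) = dual p (prod 0 a (tr (-r) q)) := by
  rw [dual_tr, tr_prod, tr_neg_tr]

theorem tr_two_mul (c t : ℝ) (F : L2) : tr (2 * c * t) F = tr (c * t) (tr (c * t) F) := by
  rw [tr_tr]; congr 2; ring

/-- Null form identity. The curves `x = τ_{ct} X` and `y = τ_{-ct} Y` move in opposite
directions with sources `x₁`, `y₁`. Applying `∂ₜ - c ∂ₓ` to `q = ((1 + ∂ₓ)⁻¹ x) y` one finds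
`-2c x y`, which is only integrable, up to terms which are products of the type of `q`. -/
theorem hasDerivWithinAt_dual_prod {X Y : ℝ → L2} {x₁ y₁ : L2} {s : Set ℝ} {t c : ℝ}
    (hX : HasDerivWithinAt X (tr (-(c * t)) x₁) s t)
    (hY : HasDerivWithinAt Y (tr (c * t) y₁) s t) (a : L2) :
    HasDerivWithinAt (fun r => dual (prod 0 (tr (c * r) (X r)) (tr (-(c * r)) (Y r))) (lam a))
      (dual (prod 0 x₁ (tr (-(c * t)) (Y t)) + prod 0 (tr (c * t) (X t)) y₁
          + (2 * c) • prod 0 (tr (c * t) (X t)) (tr (-(c * t)) (Y t))) (lam a)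
        - 2 * c * dual (tr (c * t) (X t)) (prod 0 a (tr (-(c * t)) (Y t)))
        - c * dual (prod 0 (tr (c * t) (X t)) (tr (-(c * t)) (Y t))) (a - lam a)) s t := by
  -- in the frame moving with speed `-c` the product is `((1 + ∂ₓ)⁻¹ τ_{2ct} X) Y`
  have h2 := hasDerivWithinAt_dual_prod_moving (c := 2 * c) hX hY (tr (c * t) a)
  have hcX := continuousWithinAt_prod_moving (c := 2 * c)
    hX.continuousWithinAt hY.continuousWithinAt
  have h3 := hasDerivWithinAt_dual_tr (c := -c) (a := a) hcX (by
    rw [show -(-c * t) = c * t by ring]; exact h2)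
  have e3 : ∀ r, tr (-c * r) (prod 0 (tr (2 * c * r) (X r)) (Y r))
      = prod 0 (tr (c * r) (X r)) (tr (-(c * r)) (Y r)) := fun r => by
    rw [tr_prod, tr_two_mul, neg_mul, tr_neg_tr]
  simp only [e3] at h3
  refine h3.congr_deriv ?_
  -- transport the products at time `t` back to the rest frame
  have f2 : ∀ p q : L2, dual (tr (c * t) (lam p)) (prod 0 (tr (c * t) a) q)
      = dual (prod 0 p (tr (-(c * t)) q)) (lam a) := fun p q => by
    rw [dual_prod_tr_tr, dual_prod_lam]
  have g1 : tr (2 * c * t) (lam (tr (-(c * t)) x₁)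
      + (2 * c) • (lam (X t) - X t))
      = tr (c * t) (lam x₁)
        + (2 * c) • (tr (c * t) (lam (tr (c * t) (X t))) - tr (c * t) (tr (c * t) (X t))) := by
    rw [tr_two_mul, lam_tr, map_add, tr_tr_neg, map_add, mulOp_real_smul, mulOp_real_smul,
      map_sub, map_sub, lam_tr]
  have g2 : tr (2 * c * t) (lam (X t)) = tr (c * t) (lam (tr (c * t) (X t))) := by
    rw [tr_two_mul, lam_tr]
  rw [g1, g2]
  simp only [map_add, map_sub, _root_.add_apply, _root_.sub_apply, dual_real_smul, f2,
    dual_prod_tr_tr, tr_neg_tr]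
  push_cast
  ring

/-! ### The quadratic source of the wave equation -/

/-- The functional `a ↦ ∫ 2 Re(ū v) (1 + ∂ₓ)⁻¹ a dx`. -/
def nullForm (u v a : L2) : ℂ :=
  dual (cc u) (prod 0 a v) + starRingEnd ℂ (dual (cc u) (prod 0 (cc a) v))

theorem dual_re (F G : L2) :
    dual (re F) G = (1 / 2 : ℂ) * (dual F G + starRingEnd ℂ (dual F (cc G))) := by
  rw [re_apply, dual_real_smul, map_add, _root_.add_apply, dual_cc]
  push_cast; ring

/-- The real part of a curve of frequency-side functions inherits a weak derivative. -/
theorem hasDerivWithinAt_dual_re {W : ℝ → L2} {d : L2 → ℂ} {s : Set ℝ} {t : ℝ} {a : L2}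
    (h : ∀ a, HasDerivWithinAt (fun r => dual (W r) (lam a)) (d a) s t) :
    HasDerivWithinAt (fun r => dual (re (W r)) (lam a))
      ((1 / 2 : ℂ) * (d a + starRingEnd ℂ (d (cc a)))) s t := by
  simp only [dual_re, cc_lam]
  have h2 : HasDerivWithinAt (fun r => starRingEnd ℂ (dual (W r) (lam (cc a))))
      (starRingEnd ℂ (d (cc a))) s t :=
    (Complex.conjCLE : ℂ →L[ℝ] ℂ).hasFDerivAt.comp_hasDerivWithinAt t (h (cc a))
  exact ((h a).add h2).const_mul _

/-- The normal form correction of the first wave variable produces the quadratic source. -/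
theorem hasDerivWithinAt_corrA {U V : ℝ → L2} {h k : L2} {s : Set ℝ} {t : ℝ}
    (hU : HasDerivWithinAt U (tr (-t) h) s t) (hV : HasDerivWithinAt V (tr t k) s t) (a : L2) :
    HasDerivWithinAt (fun r => dual (re (prod 0 (cc (tr r (U r))) (tr (-r) (V r)))) (lam a))
      (dual (re ((2 : ℝ) • prod 0 (cc (tr t (U t))) (tr (-t) (V t))
          + prod 0 (cc h) (tr (-t) (V t)) + prod 0 (cc (tr t (U t))) k)) (lam a)
        - nullForm (tr t (U t)) (tr (-t) (V t)) a
        - dual (re (prod 0 (cc (tr t (U t))) (tr (-t) (V t)))) (a - lam a)) s t := by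
  have hU' : HasDerivWithinAt (fun r => cc (U r)) (tr (-(1 * t)) (cc h)) s t := by
    rw [one_mul, ← cc_tr]
    exact cc.hasFDerivAt.comp_hasDerivWithinAt t hU
  have hN := fun a => hasDerivWithinAt_dual_prod (c := 1) hU' (by simpa using hV) a
  have := hasDerivWithinAt_dual_re (a := a) hN
  simp only [one_mul, ← cc_tr] at this
  refine this.congr_deriv ?_
  rw [nullForm, dual_re, dual_re]
  simp only [map_add, map_sub, map_mul, _root_.add_apply, cc_lam, dual_real_smul,
    Complex.conj_ofReal]
  push_cast
  simp only [map_ofNat]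
  ring

/-- The normal form correction of the second wave variable produces the quadratic source. -/
theorem hasDerivWithinAt_corrB {U V : ℝ → L2} {h k : L2} {s : Set ℝ} {t : ℝ}
    (hU : HasDerivWithinAt U (tr (-t) h) s t) (hV : HasDerivWithinAt V (tr t k) s t) (a : L2) :
    HasDerivWithinAt (fun r => dual (re (prod 0 (tr (-r) (V r)) (cc (tr r (U r))))) (lam a))
      (dual (re (-((2 : ℝ) • prod 0 (tr (-t) (V t)) (cc (tr t (U t))))
          + prod 0 (tr (-t) (V t)) (cc h) + prod 0 k (cc (tr t (U t))))) (lam a)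
        + nullForm (tr t (U t)) (tr (-t) (V t)) a
        + dual (re (prod 0 (tr (-t) (V t)) (cc (tr t (U t))))) (a - lam a)) s t := by
  have hU' : HasDerivWithinAt (fun r => cc (U r)) (tr (-1 * t) (cc h)) s t := by
    rw [neg_one_mul, ← cc_tr]
    exact cc.hasFDerivAt.comp_hasDerivWithinAt t hU
  have hN := fun a => hasDerivWithinAt_dual_prod (c := -1) (by simpa using hV) hU' a
  have := hasDerivWithinAt_dual_re (a := a) hN
  simp only [neg_one_mul, neg_neg, ← cc_tr] at this
  refine this.congr_deriv ?_
  rw [nullForm, dual_re, dual_re]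
  simp only [map_add, map_sub, map_neg, map_mul, _root_.add_apply, _root_.neg_apply, cc_lam,
    dual_real_smul, Complex.conj_ofReal, dual_prod_swap (cc (tr t (U t))) (tr (-t) (V t))]
  push_cast
  simp only [map_ofNat]
  ring

/-! ### Weak equations tested with Schwartz functions -/

/-- The derivative of a Schwartz function. -/
abbrev dS (η : 𝓢(ℝ, ℂ)) : 𝓢(ℝ, ℂ) := SchwartzMap.derivCLM ℂ ℂ η

/-- The preimage `η + η'` of `η` under `(1 + ∂ₓ)⁻¹`. -/
def pre (η : 𝓢(ℝ, ℂ)) : L2 := test η + test (dS η)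

theorem lam_pre (η : 𝓢(ℝ, ℂ)) : lam (pre η) = test η := (test_eq_lam η).symm

theorem pre_sub_lam (η : 𝓢(ℝ, ℂ)) : pre η - lam (pre η) = test (dS η) := by
  rw [lam_pre, pre, add_sub_cancel_left]

theorem tr_pre (t : ℝ) (η : 𝓢(ℝ, ℂ)) :
    tr t (pre η) = pre (SchwartzMap.compSubConstCLM ℂ t η) := by
  refine lam_injective ?_
  rw [lam_tr, lam_pre, lam_pre, tr_test]

/-- The Fourier multiplier `(1 - ∂ₓ)⁻¹`, the transpose of `(1 + ∂ₓ)⁻¹`. -/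
abbrev lamT : L2 →L[ℂ] L2 := mulOp (star lamSymb)

theorem star_lamSymb_apply (ξ : ℝ) : star lamSymb ξ = lamSymb (-ξ) := by
  rw [BoundedContinuousFunction.star_apply, lamSymb_apply, lamSymb_apply]
  simp

theorem dual_lam (F G : L2) : dual (lam F) G = dual F (lamT G) :=
  dual_mulOp (fun ξ => by rw [star_lamSymb_apply, neg_neg]) F G

/-- The partial fraction decomposition `2 (1 - ∂ₓ²)⁻¹ = (1 + ∂ₓ)⁻¹ + (1 - ∂ₓ)⁻¹`. -/
theorem two_smul_lam_lamT (F : L2) : (2 : ℂ) • lam (lamT F) = lam F + lamT F := by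
  have h : (2 : ℂ) • (lamSymb * star lamSymb) = lamSymb + star lamSymb := by
    ext ξ
    simp only [BoundedContinuousFunction.coe_smul, BoundedContinuousFunction.coe_mul,
      BoundedContinuousFunction.coe_add, Pi.mul_apply, Pi.add_apply, star_lamSymb_apply,
      smul_eq_mul]
    have e1 := one_add_ne_zero ξ
    have e2 := one_add_ne_zero (-ξ)
    rw [lamSymb_apply, lamSymb_apply]
    rw [show ((2 * Real.pi * -ξ : ℝ) : ℂ) = -((2 * Real.pi * ξ : ℝ) : ℂ) by push_cast; ring]
      at e2 ⊢
    generalize ((2 * Real.pi * ξ : ℝ) : ℂ) = x at e1 e2 ⊢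
    rw [← mul_inv, ← div_eq_mul_inv, inv_add_inv e1 e2]
    congr 1
    ring
  rw [mulOp_mulOp, ← _root_.smul_apply, ← map_smul, h, map_add, _root_.add_apply]

/-- Integration by parts for `D = (1 + ∂ₓ) F`. -/
theorem dual_eq_dual_lam (D : L2) (η : 𝓢(ℝ, ℂ)) :
    dual D (test η) = dual (lam D) (test η) - dual (lam D) (test (dS η)) := by
  have h : lamT (test η - test (dS η)) = test η := by
    rw [← pre_sub_lam, ← lam_pre, sub_sub_eq_add_sub, ← two_smul ℂ, map_sub, map_smul,
      mulOp_comm, two_smul_lam_lamT, add_sub_cancel_right]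
  rw [← map_sub, dual_lam, h]

/-- A curve with a continuous weak derivative is differentiable. -/
theorem hasDerivWithinAt_of_dual {W G : ℝ → L2} {T : ℝ}
    (hG : ContinuousOn G (Set.Icc 0 T))
    (h : ∀ η, ∀ t ∈ Set.Icc 0 T, HasDerivWithinAt (fun r => dual (W r) (test η))
      (dual (G t) (test η)) (Set.Icc 0 T) t) :
    ∀ t ∈ Set.Icc 0 T, HasDerivWithinAt W (G t) (Set.Icc 0 T) t := by
  intro t ht
  have hT : 0 ≤ T := ht.1.trans ht.2
  set Q : ℝ → L2 := fun t => W 0 + ∫ r in (0 : ℝ)..t, G r with hQdef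
  have hQ : ∀ t ∈ Set.Icc 0 T, HasDerivWithinAt Q (G t) (Set.Icc 0 T) t := by
    intro t ht
    have := ODE.hasDerivWithinAt_picard_Icc (f := fun r _ => G r) (α := fun _ => (0 : L2))
      (u := Set.univ) (t₀ := 0) (tmin := 0) (tmax := T) (Set.left_mem_Icc.2 hT)
      (hG.comp continuousOn_fst fun p hp => hp.1) continuousOn_const (fun _ _ => trivial) (W 0) ht
    exact this
  have hEq : ∀ t ∈ Set.Icc 0 T, W t = Q t := by
    intro t ht
    rw [← sub_eq_zero]
    refine eq_zero_of_dual_test fun η => ?_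
    have hd : ∀ r ∈ Set.Icc 0 T, HasDerivWithinAt (fun r => dual (W r - Q r) (test η)) 0
        (Set.Icc 0 T) r := by
      intro r hr
      have := (h η r hr).fun_sub (hasDerivWithinAt_dual_const (hQ r hr) (test η))
      simpa only [map_sub, _root_.sub_apply, sub_self] using this
    have hc := constant_of_has_deriv_right_zero
      (fun r hr => (hd r hr).continuousWithinAt)
      (fun r hr => ((hd r ⟨hr.1, hr.2.le⟩).mono_of_mem_nhdsWithin
        (Icc_mem_nhdsGE_of_mem hr))) t ht
    rw [hc]; simp [hQdef]
  exact (hQ t ht).congr hEq (hEq t ht)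

/-- The transport equation `(∂ₜ + c ∂ₓ) w = g`, tested with Schwartz functions, holds in the
strong sense in the moving frame. -/
theorem hasDerivWithinAt_of_transport {w g : ℝ → L2} {T c : ℝ}
    (hw : ContinuousOn w (Set.Icc 0 T)) (hg : ContinuousOn g (Set.Icc 0 T))
    (h : ∀ η, ∀ t ∈ Set.Icc 0 T, HasDerivWithinAt (fun r => dual (w r) (test η))
      (dual (g t) (test η) + c * dual (w t) (test (dS η))) (Set.Icc 0 T) t) :
    ∀ t ∈ Set.Icc 0 T,
      HasDerivWithinAt (fun r => tr (-c * r) (w r)) (tr (-c * t) (g t)) (Set.Icc 0 T) t := by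
  have hcont : ∀ {f : ℝ → L2}, ContinuousOn f (Set.Icc 0 T) →
      ContinuousOn (fun r => tr (-c * r) (f r)) (Set.Icc 0 T) := fun hf t ht =>
    tendsto_tr (((continuous_const.mul continuous_id).tendsto t).mono_left nhdsWithin_le_nhds)
      (hf t ht)
  refine hasDerivWithinAt_of_dual (hcont hg) fun η t ht => ?_
  set η' := SchwartzMap.compSubConstCLM ℂ (c * t) η with hη'
  have e : tr (-(-c * t)) (pre η) = pre η' := by
    rw [hη', ← tr_pre]; congr 2; ring
  have h1 := hasDerivWithinAt_dual_tr (c := -c) (a := pre η) (hw t ht)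
    (d := dual (g t) (test η') + c * dual (w t) (test (dS η')))
    (by rw [e, lam_pre]; exact h η' t ht)
  rw [lam_pre] at h1
  refine h1.congr_deriv ?_
  rw [← lam_pre η, pre_sub_lam, lam_pre]
  have e1 : dual (tr (-c * t) (g t)) (test η) = dual (g t) (test η') := by
    rw [dual_tr, ← lam_pre, ← lam_tr, e, lam_pre]
  have e2 : dual (tr (-c * t) (w t)) (test (dS η)) = dual (w t) (test (dS η')) := by
    rw [dual_tr, ← pre_sub_lam, map_sub, ← lam_tr, e, pre_sub_lam]
  rw [e1, e2]
  push_cast; ring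

/-! ### The distributional equations on the frequency side -/

theorem fourierInv_test (η : 𝓢(ℝ, ℂ)) : (𝓕⁻ (test η) : L2) = η.toLp 2 volume := by
  rw [test, FourierTransform.fourierInv_fourier_eq]

theorem fourierInv_cc (F : L2) : (𝓕⁻ (cc F) : L2) = conjL (𝓕⁻ F) := by
  have := fourier_conjL (𝓕⁻ F)
  rw [FourierTransform.fourier_fourierInv_eq] at this
  rw [← this, FourierTransform.fourierInv_fourier_eq]

/-- The pairing of a product with a Schwartz function. -/
theorem pair_mul {f g d : L2} (hf : 𝓕 f = lam d) (η : 𝓢(ℝ, ℂ)) :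
    pair (fun x => f x * g x) η = dual (prod 0 d (𝓕 g)) (test η) := by
  rw [show prod 0 d (𝓕 g) = 𝓕 (𝓕⁻ (prod 0 d (𝓕 g)) : L2) from
    (FourierTransform.fourier_fourierInv_eq _).symm, ← pair_eq_dual]
  refine integral_congr_ae ?_
  filter_upwards [fourierInv_prod_zero d (𝓕 g)] with x hx
  rw [hx, ← hf, FourierTransform.fourierInv_fourier_eq, FourierTransform.fourierInv_fourier_eq]

theorem dual_cc_prod_eq_integral (f g a : L2) :
    dual (cc (𝓕 f)) (prod 0 a (𝓕 g))
      = ∫ x, starRingEnd ℂ (f x) * ((𝓕⁻ (lam a) : L2) x * g x) := by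
  rw [dual_eq_integral]
  refine integral_congr_ae ?_
  rw [fourierInv_cc, FourierTransform.fourierInv_fourier_eq]
  filter_upwards [coeFn_conjL f, fourierInv_prod_zero a (𝓕 g)] with x h1 h2
  rw [h1, h2, FourierTransform.fourierInv_fourier_eq]

theorem integrable_conj_mul_mul (f g : L2) (η : 𝓢(ℝ, ℂ)) :
    Integrable fun x => starRingEnd ℂ (f x) * (η x * g x) := by
  have h : MemLp (fun x => starRingEnd ℂ (f x)) 2 volume :=
    (memLp_congr_ae (coeFn_conjL f)).1 (Lp.memLp (conjL f))
  have h2 : MemLp (fun x => η x * g x) 2 volume := by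
    simpa [mul_comm] using memLp_mul_schwartz g η
  exact h.integrable_mul h2

/-- The quadratic source of the wave equation, tested with a Schwartz function. -/
theorem pair_density (ψ : Fin 2 → L2) (η : 𝓢(ℝ, ℂ)) :
    pair (fun x => star (fun i => ψ i x) ⬝ᵥ (γ0 *ᵥ fun i => ψ i x)) η
      = nullForm (𝓕 (ψ 0)) (𝓕 (ψ 1)) (pre η) := by
  have h1 : dual (cc (𝓕 (ψ 0))) (prod 0 (pre η) (𝓕 (ψ 1)))
      = ∫ x, starRingEnd ℂ (ψ 0 x) * (η x * ψ 1 x) := by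
    rw [dual_cc_prod_eq_integral, lam_pre, fourierInv_test]
    refine integral_congr_ae ?_
    filter_upwards [η.coeFn_toLp 2 volume] with x hx
    rw [hx]
  have h2 : starRingEnd ℂ (dual (cc (𝓕 (ψ 0))) (prod 0 (cc (pre η)) (𝓕 (ψ 1))))
      = ∫ x, starRingEnd ℂ (ψ 1 x) * (η x * ψ 0 x) := by
    rw [dual_cc_prod_eq_integral, ← cc_lam, lam_pre, fourierInv_cc, fourierInv_test,
      ← integral_conj]
    refine integral_congr_ae ?_
    filter_upwards [η.coeFn_toLp 2 volume, coeFn_conjL (η.toLp 2 volume)] with x hx hx2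
    rw [hx2, hx]
    simp only [map_mul, Complex.conj_conj]
    ring
  rw [nullForm, h1, h2, ← integral_add (integrable_conj_mul_mul _ _ η)
    (integrable_conj_mul_mul _ _ η)]
  refine integral_congr_ae (Eventually.of_forall fun x => ?_)
  simp [γ0, dotProduct, Matrix.mulVec, Fin.sum_univ_two]
  ring

theorem pair_deriv (f : L2) (η : 𝓢(ℝ, ℂ)) : pair f (deriv η) = dual (𝓕 f) (test (dS η)) :=
  pair_eq_dual f (dS η)

theorem pair_deriv_deriv (f : L2) (η : 𝓢(ℝ, ℂ)) :
    pair f (deriv (deriv η)) = dual (𝓕 f) (test (dS (dS η))) :=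
  pair_eq_dual f (dS (dS η))

/-- The system, tested with Schwartz functions on the frequency side. Here `d` stands for
`(1 + ∂ₓ) φ`. -/
structure IsWeakSolution (M m T : ℝ) (u v d p : ℝ → L2) : Prop where
  left : ∀ η : 𝓢(ℝ, ℂ), ∀ t ∈ Set.Icc 0 T, HasDerivWithinAt (fun r => dual (u r) (test η))
    (Complex.I * (dual (prod 0 (d t) (v t)) (test η) - M * dual (v t) (test η))
      + dual (u t) (test (dS η))) (Set.Icc 0 T) t
  right : ∀ η : 𝓢(ℝ, ℂ), ∀ t ∈ Set.Icc 0 T, HasDerivWithinAt (fun r => dual (v r) (test η))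
    (Complex.I * (dual (prod 0 (d t) (u t)) (test η) - M * dual (u t) (test η))
      - dual (v t) (test (dS η))) (Set.Icc 0 T) t
  field : ∀ η : 𝓢(ℝ, ℂ), ∀ t ∈ Set.Icc 0 T, HasDerivWithinAt (fun r => dual (lam (d r)) (test η))
    (dual (p t) (test η)) (Set.Icc 0 T) t
  wave : ∀ η : 𝓢(ℝ, ℂ), ∀ t ∈ Set.Icc 0 T, HasDerivWithinAt (fun r => dual (p r) (test η))
    (dual (lam (d t)) (test (dS (dS η))) - m ^ 2 * dual (lam (d t)) (test η)
      + nullForm (u t) (v t) (pre η)) (Set.Icc 0 T) t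

theorem isSolution_iff {M m T : ℝ} {w : ℝ → State} {d : ℝ → L2}
    (hd : ∀ t ∈ Set.Icc 0 T, 𝓕 (w t).φ = lam (d t)) :
    IsSolution M m T w ↔ IsWeakSolution M m T (fun t => 𝓕 ((w t).ψ 0)) (fun t => 𝓕 ((w t).ψ 1)) d
      (fun t => 𝓕 (w t).φt) := by
  have hadd : ∀ z z' : ℂ, Complex.I * (z + Complex.I * z') = Complex.I * z - z' := fun z z' => by
    rw [mul_add, ← mul_assoc, Complex.I_mul_I]; ring
  have hsub : ∀ z z' : ℂ, Complex.I * (z - Complex.I * z') = Complex.I * z + z' := fun z z' => by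
    rw [mul_sub, ← mul_assoc, Complex.I_mul_I]; ring
  have hI : ∀ z : ℂ, Complex.I * (-Complex.I * z) = z := fun z => by
    rw [← mul_assoc]; simp
  have key : ∀ (f : ℝ → ℂ) (f' : ℂ) (t : ℝ),
      HasDerivWithinAt (fun s => -Complex.I * f s) f' (Set.Icc 0 T) t ↔
        HasDerivWithinAt f (Complex.I * f') (Set.Icc 0 T) t := fun f f' t => by
    constructor
    · intro h
      simpa only [hI] using h.const_mul Complex.I
    · intro h
      refine (h.const_mul (-Complex.I)).congr_deriv ?_
      rw [← mul_assoc]; simp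
  have hdirac : ∀ (η : 𝓢(ℝ, ℂ)) (t : ℝ), t ∈ Set.Icc 0 T →
      ((∀ i : Fin 2, HasDerivWithinAt (fun s => -Complex.I * ∑ j, γ0 i j * pair ((w s).ψ j) η)
        (pair (fun x => (w t).φ x * (w t).ψ i x) η - M * pair ((w t).ψ i) η
          - Complex.I * ∑ j, γ1 i j * pair ((w t).ψ j) (deriv η)) (Set.Icc 0 T) t) ↔
      (HasDerivWithinAt (fun r => dual (𝓕 ((w r).ψ 0)) (test η))
        (Complex.I * (dual (prod 0 (d t) (𝓕 ((w t).ψ 1))) (test η)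
          - M * dual (𝓕 ((w t).ψ 1)) (test η))
          + dual (𝓕 ((w t).ψ 0)) (test (dS η))) (Set.Icc 0 T) t ∧
       HasDerivWithinAt (fun r => dual (𝓕 ((w r).ψ 1)) (test η))
        (Complex.I * (dual (prod 0 (d t) (𝓕 ((w t).ψ 0))) (test η)
          - M * dual (𝓕 ((w t).ψ 0)) (test η))
          - dual (𝓕 ((w t).ψ 1)) (test (dS η))) (Set.Icc 0 T) t)) := by
    intro η t ht
    rw [Fin.forall_fin_two, and_comm]
    simp only [key, pair_mul (hd t ht), pair_eq_dual, pair_deriv]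
    simp only [γ0, γ1, Fin.sum_univ_two, Matrix.of_apply, Matrix.cons_val_zero,
      Matrix.cons_val_one, Matrix.cons_val', Matrix.cons_val_fin_one, zero_mul, one_mul,
      zero_add, add_zero, neg_mul, mul_neg, sub_neg_eq_add]
    simp only [hsub, hadd]
  have hfield : ∀ (η : 𝓢(ℝ, ℂ)) (t : ℝ), t ∈ Set.Icc 0 T →
      (HasDerivWithinAt (fun s => pair (w s).φ η) (pair (w t).φt η) (Set.Icc 0 T) t ↔
        HasDerivWithinAt (fun r => dual (lam (d r)) (test η)) (dual (𝓕 (w t).φt) (test η))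
          (Set.Icc 0 T) t) := by
    intro η t ht
    simp only [pair_eq_dual]
    have e : ∀ r ∈ Set.Icc 0 T, dual (𝓕 (w r).φ) (test η) = dual (lam (d r)) (test η) :=
      fun r hr => by rw [hd r hr]
    exact ⟨fun h => h.congr (fun r hr => (e r hr).symm) (e t ht).symm,
      fun h => h.congr e (e t ht)⟩
  have hwave : ∀ (η : 𝓢(ℝ, ℂ)) (t : ℝ), t ∈ Set.Icc 0 T →
      (HasDerivWithinAt (fun s => pair (w s).φt η)
        (pair (w t).φ (deriv (deriv η)) - m ^ 2 * pair (w t).φ η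
          + pair (fun x => star (fun i => (w t).ψ i x) ⬝ᵥ (γ0 *ᵥ fun i => (w t).ψ i x)) η)
        (Set.Icc 0 T) t ↔
      HasDerivWithinAt (fun r => dual (𝓕 (w r).φt) (test η))
        (dual (lam (d t)) (test (dS (dS η))) - m ^ 2 * dual (lam (d t)) (test η)
          + nullForm (𝓕 ((w t).ψ 0)) (𝓕 ((w t).ψ 1)) (pre η)) (Set.Icc 0 T) t) := by
    intro η t ht
    simp only [pair_eq_dual, pair_deriv_deriv, pair_density, hd t ht]
  constructor
  · intro h
    exact ⟨fun η t ht => ((hdirac η t ht).1 (h.dirac η t ht)).1,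
      fun η t ht => ((hdirac η t ht).1 (h.dirac η t ht)).2,
      fun η t ht => (hfield η t ht).1 (h.field η t ht),
      fun η t ht => (hwave η t ht).1 (h.wave η t ht)⟩
  · intro h
    exact ⟨fun η t ht => (hdirac η t ht).2 ⟨h.left η t ht, h.right η t ht⟩,
      fun η t ht => (hfield η t ht).2 (h.field η t ht),
      fun η t ht => (hwave η t ht).2 (h.wave η t ht)⟩

/-! ### From the normal form to the system -/

/-- A curve which is differentiable in the moving frame is weakly differentiable at rest. -/
theorem hasDerivWithinAt_dual_frame {W : ℝ → L2} {g : L2} {s : Set ℝ} {t c : ℝ}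
    (hW : HasDerivWithinAt W (tr (-(c * t)) g) s t) (a : L2) :
    HasDerivWithinAt (fun r => dual (tr (c * r) (W r)) (lam a))
      (dual g (lam a) + c * dual (tr (c * t) (W t)) (a - lam a)) s t := by
  refine hasDerivWithinAt_dual_tr hW.continuousWithinAt ?_
  have h := hasDerivWithinAt_dual_const hW (lam (tr (-(c * t)) a))
  rwa [dual_tr, ← lam_tr, tr_neg_tr] at h

section Frame

variable {M m : ℝ} {z : ℝ → Phase} {s : Set ℝ} {t : ℝ}

theorem hasDerivWithinAt_fst {E G : Type*} [NormedAddCommGroup E] [NormedSpace ℝ E]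
    [NormedAddCommGroup G] [NormedSpace ℝ G] {f : ℝ → E × G} {f' : E × G}
    (h : HasDerivWithinAt f f' s t) : HasDerivWithinAt (fun r => (f r).1) f'.1 s t :=
  (ContinuousLinearMap.fst ℝ E G).hasFDerivAt.comp_hasDerivWithinAt t h

theorem hasDerivWithinAt_snd {E G : Type*} [NormedAddCommGroup E] [NormedSpace ℝ E]
    [NormedAddCommGroup G] [NormedSpace ℝ G] {f : ℝ → E × G} {f' : E × G}
    (h : HasDerivWithinAt f f' s t) : HasDerivWithinAt (fun r => (f r).2) f'.2 s t :=
  (ContinuousLinearMap.snd ℝ E G).hasFDerivAt.comp_hasDerivWithinAt t h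

theorem vfield_apply (y : Phase) : vfield M m 0 t y = (tr (-t) (srcU M 0 (free t y)),
    tr t (srcV M 0 (free t y)), tr t (srcA M m 0 (free t y)), tr (-t) (srcB M m 0 (free t y))) := by
  rw [vfield, free_apply (-t), neg_neg, source]

theorem hasDerivWithinAt_vfield_fst (h : HasDerivWithinAt z (vfield M m 0 t (z t)) s t) :
    HasDerivWithinAt (fun r => (z r).1) (tr (-t) (srcU M 0 (free t (z t)))) s t := by
  rw [vfield_apply] at h
  exact hasDerivWithinAt_fst h

theorem hasDerivWithinAt_vfield_snd (h : HasDerivWithinAt z (vfield M m 0 t (z t)) s t) :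
    HasDerivWithinAt (fun r => (z r).2.1) (tr t (srcV M 0 (free t (z t)))) s t := by
  rw [vfield_apply] at h
  exact hasDerivWithinAt_fst (hasDerivWithinAt_snd h)

theorem hasDerivWithinAt_vfield_trd (h : HasDerivWithinAt z (vfield M m 0 t (z t)) s t) :
    HasDerivWithinAt (fun r => (z r).2.2.1) (tr t (srcA M m 0 (free t (z t)))) s t := by
  rw [vfield_apply] at h
  exact hasDerivWithinAt_fst (hasDerivWithinAt_snd (hasDerivWithinAt_snd h))

theorem hasDerivWithinAt_vfield_fth (h : HasDerivWithinAt z (vfield M m 0 t (z t)) s t) :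
    HasDerivWithinAt (fun r => (z r).2.2.2) (tr (-t) (srcB M m 0 (free t (z t)))) s t := by
  rw [vfield_apply] at h
  exact hasDerivWithinAt_snd (hasDerivWithinAt_snd (hasDerivWithinAt_snd h))

end Frame

/-- The wave variables of `y` are Fourier transforms of real-valued functions. -/
def Phase.IsReal (y : Phase) : Prop := cc y.2.2.1 = y.2.2.1 ∧ cc y.2.2.2 = y.2.2.2

theorem Phase.IsReal.free {y : Phase} (h : Phase.IsReal y) (t : ℝ) :
    Phase.IsReal (DKG.free t y) := by
  simp only [Phase.IsReal, free_apply, cc_tr, h.1, h.2, and_self]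

theorem Phase.IsReal.fieldA {y : Phase} (h : Phase.IsReal y) (σ : ℝ≥0) :
    cc (DKG.fieldA σ y) = DKG.fieldA σ y := by
  rw [DKG.fieldA, map_sub, cc_re, h.1]

theorem Phase.IsReal.fieldB {y : Phase} (h : Phase.IsReal y) (σ : ℝ≥0) :
    cc (DKG.fieldB σ y) = DKG.fieldB σ y := by
  rw [DKG.fieldB, map_add, cc_re, h.2]

theorem Phase.IsReal.fieldDiff {y : Phase} (h : Phase.IsReal y) (σ : ℝ≥0) :
    cc (DKG.fieldDiff σ y) = DKG.fieldDiff σ y := by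
  rw [DKG.fieldDiff, map_sub, h.fieldA, h.fieldB]

theorem eq_of_hasDerivWithinAt_zero {f : ℝ → L2} {T : ℝ}
    (h : ∀ t ∈ Set.Icc 0 T, HasDerivWithinAt f 0 (Set.Icc 0 T) t) :
    ∀ t ∈ Set.Icc 0 T, f t = f 0 :=
  constant_of_has_deriv_right_zero (fun r hr => (h r hr).continuousWithinAt)
    (fun r hr => (h r ⟨hr.1, hr.2.le⟩).mono_of_mem_nhdsWithin (Icc_mem_nhdsGE_of_mem hr))

/-- The evolution preserves the reality of the wave field. -/
theorem isReal_of_isReal_zero {M m T : ℝ} {z : ℝ → Phase}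
    (hz : ∀ t ∈ Set.Icc 0 T, HasDerivWithinAt z (vfield M m 0 t (z t)) (Set.Icc 0 T) t)
    (h0 : Phase.IsReal (z 0)) : ∀ t ∈ Set.Icc 0 T, Phase.IsReal (z t) := by
  have key : ∀ (W W' : ℝ → L2), (∀ t ∈ Set.Icc 0 T, HasDerivWithinAt W (W' t) (Set.Icc 0 T) t) →
      (∀ t, cc (W' t) = W' t) → cc (W 0) = W 0 → ∀ t ∈ Set.Icc 0 T, cc (W t) = W t := by
    intro W W' hW hW' h0 t ht
    have := eq_of_hasDerivWithinAt_zero (f := fun r => cc (W r) - W r) (T := T) (fun r hr => by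
      have h1 : HasDerivWithinAt (fun r => cc (W r)) (cc (W' r)) (Set.Icc 0 T) r :=
        cc.hasFDerivAt.comp_hasDerivWithinAt r (hW r hr)
      exact (h1.fun_sub (hW r hr)).congr_deriv (by rw [hW', sub_self])) t ht
    simpa only [h0, sub_self, sub_eq_zero] using this
  intro t ht
  refine ⟨key (fun r => (z r).2.2.1) _ (fun r hr => hasDerivWithinAt_vfield_trd (hz r hr))
    (fun r => ?_) h0.1 t ht, key (fun r => (z r).2.2.2) _
    (fun r hr => hasDerivWithinAt_vfield_fth (hz r hr)) (fun r => ?_) h0.2 t ht⟩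
  · rw [cc_tr, srcA, cc_re]
  · rw [cc_tr, srcB, cc_re]

/-- The weak equations of the two wave variables `A = ∂ₜφ + (1 + ∂ₓ)φ`, `B = ∂ₜφ - (1 + ∂ₓ)φ`. -/
theorem weak_fieldA {M m : ℝ} {z : ℝ → Phase} {s : Set ℝ} {t : ℝ}
    (h : HasDerivWithinAt z (vfield M m 0 t (z t)) s t) (hr : Phase.IsReal (z t)) (a : L2) :
    HasDerivWithinAt (fun r => dual (fieldA 0 (free r (z r))) (lam a))
      (dual (fieldB 0 (free t (z t))
          + ((1 - m ^ 2) / 2 : ℝ) • lam (fieldDiff 0 (free t (z t)))) (lam a)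
        + nullForm (free t (z t)).1 (free t (z t)).2.1 a
        - dual (fieldA 0 (free t (z t))) (a - lam a)) s t := by
  have h1 := hasDerivWithinAt_corrA (hasDerivWithinAt_vfield_fst h)
    (hasDerivWithinAt_vfield_snd h) a
  have h2 := hasDerivWithinAt_dual_frame (c := -1) (W := fun r => (z r).2.2.1)
    (by simpa using hasDerivWithinAt_vfield_trd h) a
  simp only [neg_one_mul] at h2
  have h3 := h2.fun_sub h1
  have e : ∀ r, dual (fieldA 0 (free r (z r))) (lam a) = dual (tr (-r) (z r).2.2.1) (lam a)
      - dual (re (prod 0 (cc (tr r (z r).1)) (tr (-r) (z r).2.1))) (lam a) := fun r => by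
    rw [fieldA, map_sub, _root_.sub_apply, free_apply]
  simp only [e]
  refine h3.congr_deriv ?_
  have hre : re (fieldB 0 (free t (z t))
      + ((1 - m ^ 2) / 2 : ℝ) • lam (fieldDiff 0 (free t (z t))))
      = fieldB 0 (free t (z t)) + ((1 - m ^ 2) / 2 : ℝ) • lam (fieldDiff 0 (free t (z t))) := by
    refine re_of_cc ?_
    rw [map_add, map_smul, cc_lam, (hr.free t).fieldB, (hr.free t).fieldDiff]
  rw [← hre, srcA, fieldA]
  simp only [map_add, map_sub, _root_.add_apply, _root_.sub_apply, free_apply]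
  push_cast
  ring

theorem weak_fieldB {M m : ℝ} {z : ℝ → Phase} {s : Set ℝ} {t : ℝ}
    (h : HasDerivWithinAt z (vfield M m 0 t (z t)) s t) (hr : Phase.IsReal (z t)) (a : L2) :
    HasDerivWithinAt (fun r => dual (fieldB 0 (free r (z r))) (lam a))
      (dual (-fieldA 0 (free t (z t))
          + ((1 - m ^ 2) / 2 : ℝ) • lam (fieldDiff 0 (free t (z t)))) (lam a)
        + nullForm (free t (z t)).1 (free t (z t)).2.1 a
        + dual (fieldB 0 (free t (z t))) (a - lam a)) s t := by
  have h1 := hasDerivWithinAt_corrB (hasDerivWithinAt_vfield_fst h)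
    (hasDerivWithinAt_vfield_snd h) a
  have h2 := hasDerivWithinAt_dual_frame (c := 1) (W := fun r => (z r).2.2.2)
    (by simpa using hasDerivWithinAt_vfield_fth h) a
  simp only [one_mul] at h2
  have h3 := h2.fun_add h1
  have e : ∀ r, dual (fieldB 0 (free r (z r))) (lam a) = dual (tr r (z r).2.2.2) (lam a)
      + dual (re (prod 0 (tr (-r) (z r).2.1) (cc (tr r (z r).1)))) (lam a) := fun r => by
    rw [fieldB, map_add, _root_.add_apply, free_apply]
  simp only [e]
  refine h3.congr_deriv ?_
  have hre : re (-fieldA 0 (free t (z t))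
      + ((1 - m ^ 2) / 2 : ℝ) • lam (fieldDiff 0 (free t (z t))))
      = -fieldA 0 (free t (z t)) + ((1 - m ^ 2) / 2 : ℝ) • lam (fieldDiff 0 (free t (z t))) := by
    refine re_of_cc ?_
    rw [map_add, map_neg, map_smul, cc_lam, (hr.free t).fieldA, (hr.free t).fieldDiff]
  rw [← hre, srcB, fieldB]
  simp only [map_add, map_sub, map_neg, _root_.add_apply, _root_.sub_apply, _root_.neg_apply,
    free_apply]
  push_cast
  ring

/-- The function `(1 + ∂ₓ)φ`, seen on the frequency side. -/
def fieldD (σ : ℝ≥0) (y : Phase) : L2 := (1 / 2 : ℝ) • fieldDiff σ y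

/-- The function `∂ₜφ`, seen on the frequency side. -/
def fieldP (σ : ℝ≥0) (y : Phase) : L2 := (1 / 2 : ℝ) • (fieldA σ y + fieldB σ y)

/-- The pairing of the sources `srcU` and `srcV`, with `x` the spinor component they contain. -/
theorem dual_src (M : ℝ) (y : Phase) (x F : L2) :
    dual ((Complex.I / 2) • prod 0 (fieldDiff 0 y) x - (Complex.I * M) • x) F
      = Complex.I * (dual (prod 0 (fieldD 0 y) x) F - M * dual x F) := by
  have e : fieldD 0 y = (1 / 2 : ℂ) • fieldDiff 0 y := by
    rw [fieldD]
    exact (by norm_num : ((1 / 2 : ℝ) : ℂ) = 1 / 2) ▸ (Complex.coe_smul (1 / 2 : ℝ) _).symm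
  rw [e]
  simp only [map_sub, map_smul, _root_.sub_apply, _root_.smul_apply, smul_eq_mul]
  ring

/-- A solution of the system in normal form gives a distributional solution of the original system.
The equation `∂ₜφ = φt` comes from the difference of the equations of the two wave variables tested
with `(1 - ∂ₓ)⁻¹` of a test function, where the quadratic source cancels; the wave equation comes
from their sum. -/
theorem isWeakSolution_of_vfield {M m T : ℝ} {z : ℝ → Phase}
    (hz : ∀ t ∈ Set.Icc 0 T, HasDerivWithinAt z (vfield M m 0 t (z t)) (Set.Icc 0 T) t)
    (h0 : Phase.IsReal (z 0)) :
    IsWeakSolution M m T (fun t => (free t (z t)).1) (fun t => (free t (z t)).2.1)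
      (fun t => fieldD 0 (free t (z t))) (fun t => fieldP 0 (free t (z t))) := by
  have hr := isReal_of_isReal_zero hz h0
  refine ⟨fun η t ht => ?_, fun η t ht => ?_, fun η t ht => ?_, fun η t ht => ?_⟩
  · have h := hasDerivWithinAt_dual_frame (c := 1)
      (by simpa using hasDerivWithinAt_vfield_fst (hz t ht)) (pre η)
    simp only [one_mul, lam_pre, srcU, Complex.ofReal_one] at h
    rw [← lam_pre η, pre_sub_lam, lam_pre, dual_src] at h
    exact h
  · have h := hasDerivWithinAt_dual_frame (c := -1)
      (by simpa using hasDerivWithinAt_vfield_snd (hz t ht)) (pre η)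
    simp only [neg_one_mul, lam_pre, srcV, Complex.ofReal_neg, Complex.ofReal_one] at h
    rw [← lam_pre η, pre_sub_lam, lam_pre, dual_src] at h
    simpa only [sub_eq_add_neg, free_apply] using h
  · have hA := weak_fieldA (hz t ht) (hr t ht) (lamT (pre η))
    have hB := weak_fieldB (hz t ht) (hr t ht) (lamT (pre η))
    have e : ∀ F : L2, dual F (lam (lamT (pre η))) = dual (lam F) (test η) := fun F => by
      rw [mulOp_comm, ← dual_lam, lam_pre]
    have e2 : ∀ F : L2, dual F (lamT (pre η)) = 2 * dual (lam F) (test η) - dual F (test η) := by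
      intro F
      have h := congrArg (dual F) (two_smul_lam_lamT (pre η))
      rw [map_smul, e, map_add, lam_pre, smul_eq_mul] at h
      rw [h]; ring
    simp only [map_sub (dual _), e, e2] at hA hB
    have h3 := (hA.fun_sub hB).const_mul (1 / 2 : ℂ)
    have e3 : ∀ r, dual (lam (fieldD 0 (free r (z r)))) (test η)
        = 1 / 2 * (dual (lam (fieldA 0 (free r (z r)))) (test η)
          - dual (lam (fieldB 0 (free r (z r)))) (test η)) := fun r => by
      rw [fieldD, mulOp_real_smul, dual_real_smul, fieldDiff]
      simp only [map_sub, _root_.sub_apply]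
      push_cast; ring
    simp only [e3]
    refine h3.congr_deriv ?_
    rw [fieldP, dual_real_smul]
    simp only [map_add, map_neg, _root_.add_apply, _root_.neg_apply]
    push_cast; ring
  · have hA := weak_fieldA (hz t ht) (hr t ht) (pre η)
    have hB := weak_fieldB (hz t ht) (hr t ht) (pre η)
    rw [pre_sub_lam] at hA hB
    simp only [lam_pre] at hA hB
    have h3 := (hA.fun_add hB).const_mul (1 / 2 : ℂ)
    have e3 : ∀ r, dual (fieldP 0 (free r (z r))) (test η)
        = 1 / 2 * (dual (fieldA 0 (free r (z r))) (test η)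
          + dual (fieldB 0 (free r (z r))) (test η)) := fun r => by
      rw [fieldP, dual_real_smul, map_add, _root_.add_apply]
      push_cast; ring
    simp only [e3]
    refine h3.congr_deriv ?_
    have d1 := dual_eq_dual_lam (fieldDiff 0 (free t (z t))) η
    have d2 := dual_eq_dual_lam (fieldDiff 0 (free t (z t))) (dS η)
    rw [fieldDiff, map_sub, _root_.sub_apply, ← fieldDiff] at d1 d2
    rw [fieldD, mulOp_real_smul]
    simp only [map_add, map_neg, _root_.add_apply, _root_.neg_apply, dual_real_smul]
    push_cast
    linear_combination (-1 / 2 : ℂ) * (d1 + d2)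

/-! ### States and phases -/

theorem fourier_sub (f g : L2) : 𝓕 (f - g) = (𝓕 f - 𝓕 g : L2) :=
  map_sub (AddMonoidHom.mk' (𝓕 : L2 → L2) FourierTransform.fourier_add) f g

/-- The state of the system with given normal form variables. -/
def toState (y : Phase) : State :=
  ⟨![𝓕⁻ y.1, 𝓕⁻ y.2.1], 𝓕⁻ (lam (fieldD 0 y)), 𝓕⁻ (fieldP 0 y)⟩

/-- The normal form variables of the state `w`, where `d` stands for `(1 + ∂ₓ) φ`. -/
def toPhase (w : State) (d : L2) : Phase :=
  (𝓕 (w.ψ 0), 𝓕 (w.ψ 1), 𝓕 w.φt + d + re (prod 0 (cc (𝓕 (w.ψ 0))) (𝓕 (w.ψ 1))),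
    𝓕 w.φt - d - re (prod 0 (𝓕 (w.ψ 1)) (cc (𝓕 (w.ψ 0)))))

theorem fieldA_toPhase (w : State) (d : L2) : fieldA 0 (toPhase w d) = 𝓕 w.φt + d := by
  rw [fieldA, toPhase, add_sub_cancel_right]

theorem fieldB_toPhase (w : State) (d : L2) : fieldB 0 (toPhase w d) = 𝓕 w.φt - d := by
  rw [fieldB, toPhase, sub_add_cancel]

theorem fieldD_toPhase (w : State) (d : L2) : fieldD 0 (toPhase w d) = d := by
  rw [fieldD, fieldDiff, fieldA_toPhase, fieldB_toPhase, add_sub_sub_cancel, ← two_smul ℝ d,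
    smul_smul]
  norm_num

theorem fieldP_toPhase (w : State) (d : L2) : fieldP 0 (toPhase w d) = 𝓕 w.φt := by
  rw [fieldP, fieldA_toPhase, fieldB_toPhase, add_add_sub_cancel, ← two_smul ℝ (𝓕 w.φt : L2),
    smul_smul]
  norm_num

theorem toState_toPhase {w : State} {d : L2} (hd : 𝓕 w.φ = lam d) :
    toState (toPhase w d) = w := by
  rw [toState, fieldD_toPhase, fieldP_toPhase, ← hd]
  simp only [toPhase, FourierTransform.fourierInv_fourier_eq]
  cases w
  congr
  ext i
  fin_cases i <;> rfl

theorem isReal_toPhase {w : State} {d : L2} (hd : 𝓕 w.φ = lam d) (h1 : IsRealValued w.φ)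
    (h2 : IsRealValued w.φt) : Phase.IsReal (toPhase w d) := by
  rw [isRealValued_iff] at h1 h2
  have hd' : cc d = d := lam_injective (by rw [← cc_lam, ← hd, h1])
  simp only [Phase.IsReal, toPhase, map_add, map_sub, cc_re, h2, hd', and_self]

theorem fourier_toState_ψ_zero (y : Phase) : 𝓕 ((toState y).ψ 0) = y.1 :=
  FourierTransform.fourier_fourierInv_eq _

theorem fourier_toState_ψ_one (y : Phase) : 𝓕 ((toState y).ψ 1) = y.2.1 :=
  FourierTransform.fourier_fourierInv_eq _

theorem fourier_toState_φ (y : Phase) : 𝓕 (toState y).φ = lam (fieldD 0 y) :=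
  FourierTransform.fourier_fourierInv_eq _

theorem fourier_toState_φt (y : Phase) : 𝓕 (toState y).φt = fieldP 0 y :=
  FourierTransform.fourier_fourierInv_eq _

theorem isSolution_toState {M m T : ℝ} {z : ℝ → Phase}
    (hz : ∀ t ∈ Set.Icc 0 T, HasDerivWithinAt z (vfield M m 0 t (z t)) (Set.Icc 0 T) t)
    (h0 : Phase.IsReal (z 0)) : IsSolution M m T (fun t => toState (free t (z t))) := by
  rw [isSolution_iff (fun t _ => fourier_toState_φ _)]
  simp only [fourier_toState_ψ_zero, fourier_toState_ψ_one, fourier_toState_φt]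
  exact isWeakSolution_of_vfield hz h0

theorem fieldD_unweight (σ : ℝ≥0) (y : Phase) :
    fieldD 0 (unweight σ y) = mulOp (wtSymb σ) (fieldD σ y) := by
  rw [fieldD, fieldD, fieldDiff_unweight, mulOp_real_smul]

theorem fieldP_unweight (σ : ℝ≥0) (y : Phase) :
    fieldP 0 (unweight σ y) = mulOp (wtSymb σ) (fieldP σ y) := by
  rw [fieldP, fieldP, fieldA_unweight, fieldB_unweight, mulOp_real_smul, map_add]

theorem continuous_fieldD (σ : ℝ≥0) : Continuous (fieldD σ) :=
  ((lipBdd_fieldA σ).continuous.sub (lipBdd_fieldB σ).continuous).const_smul (1 / 2 : ℝ)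

theorem continuous_fieldP (σ : ℝ≥0) : Continuous (fieldP σ) :=
  ((lipBdd_fieldA σ).continuous.add (lipBdd_fieldB σ).continuous).const_smul (1 / 2 : ℝ)

section Weighted

variable {σ : ℝ≥0} (y : Phase)

theorem fourier_toState_unweight_ψ_zero :
    𝓕 ((toState (unweight σ y)).ψ 0) = mulOp (wtSymb σ) y.1 := fourier_toState_ψ_zero _

theorem fourier_toState_unweight_ψ_one :
    𝓕 ((toState (unweight σ y)).ψ 1) = mulOp (wtSymb σ) y.2.1 := fourier_toState_ψ_one _

theorem fourier_toState_unweight_φ :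
    𝓕 (toState (unweight σ y)).φ = mulOp (wtSymb σ) (lam (fieldD σ y)) := by
  rw [fourier_toState_φ, fieldD_unweight, mulOp_comm]

theorem fourier_toState_unweight_φt :
    𝓕 (toState (unweight σ y)).φt = mulOp (wtSymb σ) (fieldP σ y) := by
  rw [fourier_toState_φt, fieldP_unweight]

theorem memX_toState_unweight (hr : Phase.IsReal (unweight σ y)) :
    MemX σ (toState (unweight σ y)) := by
  have hf : ∀ F : L2, fourierConst * ‖F‖ₑ < ∞ := fun F =>
    ENNReal.mul_lt_top fourierConst_ne_top.lt_top enorm_lt_top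
  refine ⟨Fin.forall_fin_two.2 ⟨?_, ?_⟩, ?_, ?_, ?_, ?_⟩
  · rw [MemGevrey, gevreyENorm_zero_eq (fourier_toState_unweight_ψ_zero y)]; exact hf _
  · rw [MemGevrey, gevreyENorm_zero_eq (fourier_toState_unweight_ψ_one y)]; exact hf _
  · rw [MemGevrey, gevreyENorm_one_eq (fourier_toState_unweight_φ y)]; exact hf _
  · rw [MemGevrey, gevreyENorm_zero_eq (fourier_toState_unweight_φt y)]; exact hf _
  · rw [isRealValued_iff, fourier_toState_φ, cc_lam, fieldD, map_smul, hr.fieldDiff]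
  · rw [isRealValued_iff, fourier_toState_φt, fieldP, map_smul, map_add, hr.fieldA, hr.fieldB]

theorem distX_toState_unweight (y' : Phase) :
    distX σ (toState (unweight σ y)) (toState (unweight σ y'))
      = fourierConst * ‖y.1 - y'.1‖ₑ + fourierConst * ‖y.2.1 - y'.2.1‖ₑ
        + fourierConst * ‖fieldD σ y - fieldD σ y'‖ₑ
        + fourierConst * ‖fieldP σ y - fieldP σ y'‖ₑ := by
  rw [distX, Fin.sum_univ_two]
  congr 1
  · congr 1
    · congr 1
      · refine gevreyENorm_zero_eq ?_
        rw [fourier_sub, fourier_toState_unweight_ψ_zero, fourier_toState_unweight_ψ_zero, map_sub]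
      · refine gevreyENorm_zero_eq ?_
        rw [fourier_sub, fourier_toState_unweight_ψ_one, fourier_toState_unweight_ψ_one, map_sub]
    · refine gevreyENorm_one_eq ?_
      rw [fourier_sub, fourier_toState_unweight_φ, fourier_toState_unweight_φ, map_sub, map_sub]
  · refine gevreyENorm_zero_eq ?_
    rw [fourier_sub, fourier_toState_unweight_φt, fourier_toState_unweight_φt, map_sub]

end Weighted

theorem contX_toState_unweight {σ : ℝ≥0} {T : ℝ} {y : ℝ → Phase}
    (hy : ContinuousOn y (Set.Icc 0 T))
    (hr : ∀ t ∈ Set.Icc 0 T, Phase.IsReal (unweight σ (y t))) :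
    ContX σ T (fun t => toState (unweight σ (y t))) := by
  refine ⟨fun t ht => memX_toState_unweight _ (hr t ht), fun t ht => ?_⟩
  simp only [distX_toState_unweight]
  have key : ∀ f : Phase → L2, Continuous f →
      Tendsto (fun s => fourierConst * ‖f (y s) - f (y t)‖ₑ) (𝓝[Set.Icc 0 T] t) (𝓝 0) := by
    intro f hf
    have h1 : Tendsto (fun s => f (y s) - f (y t)) (𝓝[Set.Icc 0 T] t) (𝓝 0) := by
      have := ((hf.tendsto _).comp (hy t ht)).sub_const (f (y t))
      simpa using this
    have h2 := ENNReal.Tendsto.const_mul h1.enorm (Or.inr fourierConst_ne_top)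
    simpa using h2
  have h := (((key _ continuous_fst).add (key _ (continuous_fst.comp continuous_snd))).add
    (key _ (continuous_fieldD σ))).add (key _ (continuous_fieldP σ))
  simpa using h

/-! ### From the system to the normal form -/

theorem tendsto_of_enorm_sub {f : ℝ → L2} {g : L2} {l : Filter ℝ}
    (h : Tendsto (fun s => fourierConst * ‖f s - g‖ₑ) l (𝓝 0)) : Tendsto f l (𝓝 g) := by
  rw [tendsto_iff_edist_tendsto_0]
  simp only [edist_eq_enorm_sub]
  have h2 := ENNReal.Tendsto.const_mul (a := fourierConst⁻¹) h
    (Or.inr (ENNReal.inv_ne_top.2 fourierConst_ne_zero))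
  simpa only [mul_zero, ← mul_assoc, ENNReal.inv_mul_cancel fourierConst_ne_zero
    fourierConst_ne_top, one_mul] using h2

theorem continuousOn_of_contX {T : ℝ} {w : ℝ → State} {d : ℝ → L2} (h : ContX 0 T w)
    (hd : ∀ t ∈ Set.Icc 0 T, 𝓕 (w t).φ = lam (d t)) :
    ContinuousOn (fun t => toPhase (w t) (d t)) (Set.Icc 0 T) := by
  have h0 : ∀ F : L2, mulOp (wtSymb 0) F = F := fun F => by rw [wtSymb_zero, mulOp_one]
  have hzero : ∀ f : ℝ → L2, (∀ t ∈ Set.Icc 0 T,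
      Tendsto (fun s => gevreyENorm (0 : ℝ≥0) 0 (f s - f t)) (𝓝[Set.Icc 0 T] t) (𝓝 0)) →
      ContinuousOn (fun t => (𝓕 (f t) : L2)) (Set.Icc 0 T) := by
    intro f hf t ht
    refine tendsto_of_enorm_sub ((hf t ht).congr fun s => ?_)
    rw [gevreyENorm_zero_eq (a := 𝓕 (f s - f t)) (by rw [h0]), fourier_sub]
  have hle : ∀ {t} {F : ℝ → ℝ≥0∞}, t ∈ Set.Icc 0 T → (∀ s, F s ≤ distX 0 (w s) (w t)) →
      Tendsto F (𝓝[Set.Icc 0 T] t) (𝓝 0) := fun ht hF =>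
    tendsto_of_tendsto_of_tendsto_of_le_of_le tendsto_const_nhds (h.2 _ ht)
      (fun _ => zero_le) hF
  have hu := hzero (fun t => (w t).ψ 0) fun t ht => hle ht fun s => by
    rw [distX, Fin.sum_univ_two, add_assoc, add_assoc]; exact le_self_add
  have hv := hzero (fun t => (w t).ψ 1) fun t ht => hle ht fun s => by
    rw [distX, Fin.sum_univ_two, add_assoc, add_assoc]; exact le_self_add.trans le_add_self
  have hp := hzero (fun t => (w t).φt) fun t ht => hle ht fun s => by
    rw [distX]; exact le_add_self
  have hd' : ContinuousOn d (Set.Icc 0 T) := by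
    intro t ht
    have h1 : Tendsto (fun s => gevreyENorm (0 : ℝ≥0) 1 ((w s).φ - (w t).φ)) (𝓝[Set.Icc 0 T] t)
        (𝓝 0) := hle ht fun s => by
      rw [distX]; exact le_add_self.trans le_self_add
    refine tendsto_of_enorm_sub (h1.congr' ?_)
    filter_upwards [self_mem_nhdsWithin] with s hs'
    exact gevreyENorm_one_eq (by rw [h0, fourier_sub, hd s hs', hd t ht, map_sub])
  have hcu : ContinuousOn (fun t => cc (𝓕 ((w t).ψ 0))) (Set.Icc 0 T) :=
    cc.continuous.comp_continuousOn hu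
  have hq1 : ContinuousOn (fun t => re (prod 0 (cc (𝓕 ((w t).ψ 0))) (𝓕 ((w t).ψ 1))))
      (Set.Icc 0 T) := re.continuous.comp_continuousOn fun t ht => tendsto_prod (hcu t ht) (hv t ht)
  have hq2 : ContinuousOn (fun t => re (prod 0 (𝓕 ((w t).ψ 1)) (cc (𝓕 ((w t).ψ 0)))))
      (Set.Icc 0 T) := re.continuous.comp_continuousOn fun t ht => tendsto_prod (hv t ht) (hcu t ht)
  exact hu.prodMk (hv.prodMk (((hp.add hd').add hq1).prodMk ((hp.sub hd').sub hq2)))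

/-- The normal form variables of a distributional solution in `C([0,T]; L² × H¹ × L²)` solve, in the
interaction picture, the differential equation of the vector field `vfield`. -/
theorem hasDerivWithinAt_toPhase {M m T : ℝ} {w : ℝ → State} {d : ℝ → L2}
    (hs : IsSolution M m T w) (hc : ContX 0 T w)
    (hd : ∀ t ∈ Set.Icc 0 T, 𝓕 (w t).φ = lam (d t)) :
    ∀ t ∈ Set.Icc 0 T, HasDerivWithinAt (fun r => free (-r) (toPhase (w r) (d r)))
      (vfield M m 0 t (free (-t) (toPhase (w t) (d t)))) (Set.Icc 0 T) t := by
  have hw := (isSolution_iff hd).1 hs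
  have hy := continuousOn_of_contX hc hd
  set y : ℝ → Phase := fun t => toPhase (w t) (d t) with hy_def
  have hsrc : ContinuousOn (fun t => source M m 0 (y t)) (Set.Icc 0 T) :=
    (lipBdd_source M m 0).continuous.comp_continuousOn hy
  have hUc : ContinuousOn (fun t => srcU M 0 (y t)) (Set.Icc 0 T) := hsrc.fst
  have hVc : ContinuousOn (fun t => srcV M 0 (y t)) (Set.Icc 0 T) := hsrc.snd.fst
  have hAc : ContinuousOn (fun t => srcA M m 0 (y t)) (Set.Icc 0 T) := hsrc.snd.snd.fst
  have hBc : ContinuousOn (fun t => srcB M m 0 (y t)) (Set.Icc 0 T) := hsrc.snd.snd.snd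
  have hU := hasDerivWithinAt_of_transport (c := 1) hy.fst hUc fun η t ht => by
    refine (hw.left η t ht).congr_deriv ?_
    rw [srcU, dual_src, fieldD_toPhase, Complex.ofReal_one, one_mul]; rfl
  have hV := hasDerivWithinAt_of_transport (c := -1) hy.snd.fst hVc fun η t ht => by
    refine (hw.right η t ht).congr_deriv ?_
    rw [srcV, dual_src, fieldD_toPhase, Complex.ofReal_neg, Complex.ofReal_one, neg_one_mul,
      sub_eq_add_neg]; rfl
  simp only [neg_one_mul, neg_neg, one_mul] at hU hV
  have hreal : ∀ t ∈ Set.Icc 0 T, Phase.IsReal (y t) := fun t ht =>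
    isReal_toPhase (hd t ht) (hc.1 t ht).real_φ (hc.1 t ht).real_φt
  -- `∂ₜ(1 + ∂ₓ)φ = (1 + ∂ₓ)φt`
  have hdd : ∀ η : 𝓢(ℝ, ℂ), ∀ t ∈ Set.Icc 0 T, HasDerivWithinAt (fun r => dual (d r) (test η))
      (dual (𝓕 (w t).φt) (test η) - dual (𝓕 (w t).φt) (test (dS η))) (Set.Icc 0 T) t := by
    intro η t ht
    simp only [dual_eq_dual_lam (d _) η]
    exact (hw.field η t ht).fun_sub (hw.field (dS η) t ht)
  have hA := hasDerivWithinAt_of_transport (c := -1) hy.snd.snd.fst hAc fun η t ht => by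
    have h1 := hasDerivWithinAt_corrA (hU t ht) (hV t ht) (pre η)
    simp only [tr_tr_neg, tr_neg_tr] at h1
    rw [pre_sub_lam, lam_pre] at h1
    have h2 := ((hw.wave η t ht).fun_add (hdd η t ht)).fun_add h1
    have e : ∀ r, dual (y r).2.2.1 (test η) = dual (𝓕 (w r).φt) (test η) + dual (d r) (test η)
        + dual (re (prod 0 (cc (y r).1) (y r).2.1)) (test η) := fun r => by
      simp only [hy_def, toPhase, map_add, _root_.add_apply]
    simp only [e]
    refine h2.congr_deriv ?_
    have hre : re (fieldB 0 (y t) + ((1 - m ^ 2) / 2 : ℝ) • lam (fieldDiff 0 (y t)))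
        = fieldB 0 (y t) + ((1 - m ^ 2) / 2 : ℝ) • lam (fieldDiff 0 (y t)) := by
      refine re_of_cc ?_
      rw [map_add, map_smul, cc_lam, (hreal t ht).fieldB, (hreal t ht).fieldDiff]
    have hD : fieldDiff 0 (y t) = (2 : ℝ) • d t := by
      rw [fieldDiff, fieldA_toPhase, fieldB_toPhase, add_sub_sub_cancel, ← two_smul ℝ (d t)]
    have d1 := dual_eq_dual_lam (d t) η
    have d2 := dual_eq_dual_lam (d t) (dS η)
    have e4 : dual (srcA M m 0 (y t)) (test η) = dual (fieldB 0 (y t)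
        + ((1 - m ^ 2) / 2 : ℝ) • lam (fieldDiff 0 (y t))) (test η)
        + dual (re ((2 : ℝ) • prod 0 (cc (y t).1) (y t).2.1
          + prod 0 (cc (srcU M 0 (y t))) (y t).2.1
          + prod 0 (cc (y t).1) (srcV M 0 (y t)))) (test η) := by
      rw [← hre, srcA]
      simp only [map_add, _root_.add_apply]
      ring
    have e5 : dual (y t).2.2.1 (test (dS η)) = dual (𝓕 (w t).φt) (test (dS η))
        + dual (d t) (test (dS η))
        + dual (re (prod 0 (cc (y t).1) (y t).2.1)) (test (dS η)) := by
      simp only [hy_def, toPhase, map_add, _root_.add_apply]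
    have e6 : nullForm (y t).1 (y t).2.1 (pre η)
      = nullForm (𝓕 ((w t).ψ 0)) (𝓕 ((w t).ψ 1)) (pre η) := rfl
    rw [e4, e5, e6, hD, fieldB_toPhase, mulOp_real_smul]
    simp only [map_add, map_sub, _root_.add_apply, _root_.sub_apply, dual_real_smul]
    push_cast
    linear_combination d1 + d2
  have hB := hasDerivWithinAt_of_transport (c := 1) hy.snd.snd.snd hBc fun η t ht => by
    have h1 := hasDerivWithinAt_corrB (hU t ht) (hV t ht) (pre η)
    simp only [tr_tr_neg, tr_neg_tr] at h1
    rw [pre_sub_lam, lam_pre] at h1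
    have h2 := ((hw.wave η t ht).fun_sub (hdd η t ht)).fun_sub h1
    have e : ∀ r, dual (y r).2.2.2 (test η) = dual (𝓕 (w r).φt) (test η) - dual (d r) (test η)
        - dual (re (prod 0 (y r).2.1 (cc (y r).1))) (test η) := fun r => by
      simp only [hy_def, toPhase, map_sub, _root_.sub_apply]
    simp only [e]
    refine h2.congr_deriv ?_
    have hre : re (-fieldA 0 (y t) + ((1 - m ^ 2) / 2 : ℝ) • lam (fieldDiff 0 (y t)))
        = -fieldA 0 (y t) + ((1 - m ^ 2) / 2 : ℝ) • lam (fieldDiff 0 (y t)) := by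
      refine re_of_cc ?_
      rw [map_add, map_neg, map_smul, cc_lam, (hreal t ht).fieldA, (hreal t ht).fieldDiff]
    have hD : fieldDiff 0 (y t) = (2 : ℝ) • d t := by
      rw [fieldDiff, fieldA_toPhase, fieldB_toPhase, add_sub_sub_cancel, ← two_smul ℝ (d t)]
    have d1 := dual_eq_dual_lam (d t) η
    have d2 := dual_eq_dual_lam (d t) (dS η)
    have e4 : dual (srcB M m 0 (y t)) (test η) = dual (-fieldA 0 (y t)
        + ((1 - m ^ 2) / 2 : ℝ) • lam (fieldDiff 0 (y t))) (test η)
        - dual (re (-((2 : ℝ) • prod 0 (y t).2.1 (cc (y t).1))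
          + prod 0 (y t).2.1 (cc (srcU M 0 (y t)))
          + prod 0 (srcV M 0 (y t)) (cc (y t).1))) (test η) := by
      rw [← hre, srcB]
      simp only [map_add, map_sub, map_neg, _root_.add_apply, _root_.sub_apply, _root_.neg_apply]
      ring
    have e5 : dual (y t).2.2.2 (test (dS η)) = dual (𝓕 (w t).φt) (test (dS η))
        - dual (d t) (test (dS η))
        - dual (re (prod 0 (y t).2.1 (cc (y t).1))) (test (dS η)) := by
      simp only [hy_def, toPhase, map_sub, _root_.sub_apply]
    have e6 : nullForm (y t).1 (y t).2.1 (pre η)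
      = nullForm (𝓕 ((w t).ψ 0)) (𝓕 ((w t).ψ 1)) (pre η) := rfl
    rw [e4, e5, e6, hD, fieldA_toPhase, mulOp_real_smul]
    simp only [map_add, map_neg, _root_.add_apply, _root_.neg_apply, dual_real_smul]
    push_cast
    linear_combination d1 + d2
  simp only [neg_one_mul, neg_neg, one_mul] at hA hB
  intro t ht
  have h := (hU t ht).prodMk ((hV t ht).prodMk ((hA t ht).prodMk (hB t ht)))
  rw [vfield_apply, free_free_neg]
  simpa only [free_apply, neg_neg] using h

theorem vfield_unique {M m T : ℝ} {z z' : ℝ → Phase}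
    (hz : ∀ t ∈ Set.Icc 0 T, HasDerivWithinAt z (vfield M m 0 t (z t)) (Set.Icc 0 T) t)
    (hz' : ∀ t ∈ Set.Icc 0 T, HasDerivWithinAt z' (vfield M m 0 t (z' t)) (Set.Icc 0 T) t)
    (h0 : z 0 = z' 0) : Set.EqOn z z' (Set.Icc 0 T) := by
  have hc : ContinuousOn z (Set.Icc 0 T) := fun t ht => (hz t ht).continuousWithinAt
  have hc' : ContinuousOn z' (Set.Icc 0 T) := fun t ht => (hz' t ht).continuousWithinAt
  obtain ⟨R, hR⟩ := isCompact_Icc.exists_bound_of_continuousOn hc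
  obtain ⟨R', hR'⟩ := isCompact_Icc.exists_bound_of_continuousOn hc'
  -- both curves stay in a ball, where the vector field is Lipschitz uniformly in time
  obtain ⟨K, hK⟩ := vfield_lipschitz M m 0 (max R R')
  refine ODE_solution_unique_of_mem_Icc_right (v := vfield M m 0)
    (s := fun _ => Metric.closedBall 0 (max R R')) (K := K) (fun t _ => hK t) hc
    (fun t ht => (hz t ⟨ht.1, ht.2.le⟩).mono_of_mem_nhdsWithin (Icc_mem_nhdsGE_of_mem ht))
    (fun t ht => ?_) hc'
    (fun t ht => (hz' t ⟨ht.1, ht.2.le⟩).mono_of_mem_nhdsWithin (Icc_mem_nhdsGE_of_mem ht))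
    (fun t ht => ?_) h0
  · exact mem_closedBall_zero_iff.2 ((hR t ⟨ht.1, ht.2.le⟩).trans (le_max_left _ _))
  · exact mem_closedBall_zero_iff.2 ((hR' t ⟨ht.1, ht.2.le⟩).trans (le_max_right _ _))

theorem exists_fourier_φ {T : ℝ} {w : ℝ → State} (hc : ContX 0 T w) :
    ∃ d : ℝ → L2, ∀ t ∈ Set.Icc 0 T, 𝓕 (w t).φ = lam (d t) := by
  have h : ∀ t, ∃ a : L2, t ∈ Set.Icc 0 T → 𝓕 (w t).φ = lam a := fun t => by
    by_cases ht : t ∈ Set.Icc 0 T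
    · obtain ⟨a, ha⟩ := exists_of_memGevrey_one (σ := 0) (hc.1 t ht).mem_φ
      exact ⟨a, fun _ => by rw [ha, wtSymb_zero, mulOp_one]⟩
    · exact ⟨0, fun h => absurd h ht⟩
  choose d hd using h
  exact ⟨d, hd⟩

/-- Uniqueness of solutions in `C([0,T]; L² × H¹ × L²)`. -/
theorem eq_of_isSolution {M m T : ℝ} {w w' : ℝ → State}
    (hs : IsSolution M m T w) (hc : ContX 0 T w) (hs' : IsSolution M m T w') (hc' : ContX 0 T w')
    (h0 : w 0 = w' 0) : ∀ t ∈ Set.Icc 0 T, w t = w' t := by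
  intro t ht
  obtain ⟨d, hd⟩ := exists_fourier_φ hc
  obtain ⟨d', hd'⟩ := exists_fourier_φ hc'
  have hT : (0 : ℝ) ∈ Set.Icc 0 T := ⟨le_rfl, ht.1.trans ht.2⟩
  have e0 : d 0 = d' 0 := lam_injective (by rw [← hd 0 hT, ← hd' 0 hT, h0])
  have h := vfield_unique (hasDerivWithinAt_toPhase hs hc hd) (hasDerivWithinAt_toPhase hs' hc' hd')
    (by rw [h0, e0]) ht
  have h2 := congrArg (free t) h
  simp only [free_free_neg] at h2
  rw [← toState_toPhase (hd t ht), ← toState_toPhase (hd' t ht), h2]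

/-! ### Existence for Gevrey data -/

theorem gevreyNorm_nonneg (σ s : ℝ) (f : L2) : 0 ≤ gevreyNorm σ s f := ENNReal.toReal_nonneg

theorem one_le_lifespan_denom (σ : ℝ) (u : State) :
    1 ≤ 1 + spinorNorm σ u ^ 2 + waveNorm σ u := by
  have h : 0 ≤ waveNorm σ u := add_nonneg (gevreyNorm_nonneg _ _ _) (gevreyNorm_nonneg _ _ _)
  nlinarith [sq_nonneg (spinorNorm σ u)]

/-- The weighted normal form variables of Gevrey data have size `μ` and `μ²`, where
`μ² = 1 + a₀² + b₀`. -/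
theorem exists_phase_of_memX {σ : ℝ≥0} {u : State} (hu : MemX σ u) :
    ∃ (y : Phase) (d : L2), unweight σ y = toPhase u d ∧ 𝓕 u.φ = lam d ∧
      ∀ μ : ℝ, 0 ≤ μ → μ ^ 2 = 1 + spinorNorm σ u ^ 2 + waveNorm σ u →
        ‖y.1‖ ≤ (2 + lamNorm) * μ ∧ ‖y.2.1‖ ≤ (2 + lamNorm) * μ ∧
        ‖y.2.2.1‖ ≤ (2 + lamNorm) * μ ^ 2 ∧ ‖y.2.2.2‖ ≤ (2 + lamNorm) * μ ^ 2 := by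
  obtain ⟨f, hf⟩ := exists_of_memGevrey_zero (hu.mem_ψ 0)
  obtain ⟨g, hg⟩ := exists_of_memGevrey_zero (hu.mem_ψ 1)
  obtain ⟨a, ha⟩ := exists_of_memGevrey_one hu.mem_φ
  obtain ⟨b, hb⟩ := exists_of_memGevrey_zero hu.mem_φt
  refine ⟨(f, g, b + a + re (prod σ (cc f) g), b - a - re (prod σ g (cc f))),
    mulOp (wtSymb σ) a, ?_, by rw [ha, mulOp_comm], fun μ hμ0 hμ => ?_⟩
  · rw [unweight_apply, toPhase, hf, hg, hb]
    simp only [map_add, map_sub, ← wt_prod, cc_wt, re_wt]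
  · have hl := lamNorm_nonneg
    have hS : spinorNorm σ u = gevreyNorm σ 0 (u.ψ 0) + gevreyNorm σ 0 (u.ψ 1) := rfl
    have hf0 := norm_le_gevreyNorm_zero hf
    have hg0 := norm_le_gevreyNorm_zero hg
    have n0 := gevreyNorm_nonneg σ 0 (u.ψ 0)
    have n1 := gevreyNorm_nonneg σ 0 (u.ψ 1)
    obtain ⟨ha0, hb0⟩ := norm_le_waveNorm ha hb
    have hW : 0 ≤ waveNorm σ u := (norm_nonneg _).trans ha0
    have hSμ : spinorNorm σ u ≤ μ := abs_le_of_sq_le_sq' (by nlinarith) hμ0 |>.2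
    have hfμ : ‖f‖ ≤ μ := by linarith
    have hgμ : ‖g‖ ≤ μ := by linarith
    have hWμ : waveNorm σ u ≤ μ ^ 2 := by nlinarith [sq_nonneg (spinorNorm σ u)]
    have hlin : μ ≤ (2 + lamNorm) * μ := by nlinarith
    have hq : ∀ p q : L2, ‖p‖ ≤ μ → ‖q‖ ≤ μ → ‖re (prod σ p q)‖ ≤ lamNorm * μ ^ 2 := by
      intro p q hp hq
      calc ‖re (prod σ p q)‖ ≤ lamNorm * ‖p‖ * ‖q‖ := (norm_re_le _).trans (norm_prod_le _ _ _)
        _ ≤ lamNorm * μ * μ := by gcongr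
        _ = lamNorm * μ ^ 2 := by ring
    have hcf : ‖cc f‖ ≤ μ := (norm_cc_le f).trans hfμ
    refine ⟨hfμ.trans hlin, hgμ.trans hlin, ?_, ?_⟩
    · have h1 := hq _ _ hcf hgμ
      have h2 := norm_add_le (b + a) (re (prod σ (cc f) g))
      have h3 := norm_add_le b a
      change ‖b + a + re (prod σ (cc f) g)‖ ≤ _
      linarith
    · have h1 := hq _ _ hgμ hcf
      have h2 := norm_sub_le (b - a) (re (prod σ g (cc f)))
      have h3 := norm_sub_le b a
      change ‖b - a - re (prod σ g (cc f))‖ ≤ _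
      linarith

theorem unweight_hasDerivWithinAt {M m : ℝ} {σ : ℝ≥0} {z : ℝ → Phase} {s : Set ℝ} {t : ℝ}
    (h : HasDerivWithinAt z (vfield M m σ t (z t)) s t) :
    HasDerivWithinAt (fun r => unweight σ (z r)) (vfield M m 0 t (unweight σ (z t))) s t := by
  rw [vfield_unweight]
  exact ((unweight σ).restrictScalars ℝ).hasFDerivAt.comp_hasDerivWithinAt t h

end

end DKG

theorem theorem2 (M m : ℝ) (hM : 0 ≤ M) (hm : 0 ≤ m) :
    ∃ c₀ : ℝ, 0 < c₀ ∧ ∀ σ₀ : ℝ, 0 < σ₀ → ∀ u₀ : DKG.State, DKG.MemX σ₀ u₀ →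
      ∃ δ : ℝ, 0 < δ ∧ δ = DKG.lifespan c₀ σ₀ u₀ ∧
      ∃ u : ℝ → DKG.State,
        u 0 = u₀ ∧ DKG.IsSolution M m δ u ∧ DKG.ContX σ₀ δ u ∧
        ∀ v : ℝ → DKG.State, v 0 = u₀ → DKG.IsSolution M m δ v → DKG.ContX 0 δ v →
          ∀ t ∈ Set.Icc 0 δ, v t = u t := by
  obtain ⟨c, hc, H⟩ := DKG.exists_solution_vfield M m (2 + DKG.lamNorm)
    (by linarith [DKG.lamNorm_nonneg])
  refine ⟨c, hc, fun σ₀ hσ u₀ hu => ?_⟩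
  lift σ₀ to ℝ≥0 using hσ.le
  have hD := DKG.one_le_lifespan_denom σ₀ u₀
  set D := 1 + DKG.spinorNorm σ₀ u₀ ^ 2 + DKG.waveNorm σ₀ u₀ with hD_def
  have hD0 : 0 < D := by linarith
  have hδ : 0 < c / D := div_pos hc hD0
  refine ⟨c / D, hδ, rfl, ?_⟩
  obtain ⟨y, d, hyd, hd, hy⟩ := DKG.exists_phase_of_memX hu
  have hμ : √D ^ 2 = D := Real.sq_sqrt hD0.le
  -- the scaling parameter `μ = √D` makes the lifespan `c / μ²` equal to `c / D`
  obtain ⟨h1, h2, h3, h4⟩ := hy √D (Real.sqrt_nonneg _) hμ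
  obtain ⟨z, hz0, hz⟩ := H σ₀ √D (Real.one_le_sqrt.2 hD) y h1 h2 h3 h4 (c / D) hδ.le
    (by rw [hμ, div_mul_cancel₀ _ hD0.ne'])
  -- removing the weight turns the curve into a solution of the unweighted equation
  have hZ := fun t ht => DKG.unweight_hasDerivWithinAt (hz t ht)
  have hr0 : DKG.Phase.IsReal (DKG.unweight σ₀ (z 0)) := by
    rw [hz0, hyd]
    exact DKG.isReal_toPhase hd hu.real_φ hu.real_φt
  have hsol := DKG.isSolution_toState hZ hr0
  have hcont : DKG.ContX σ₀ (c / D)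
      (fun t => DKG.toState (DKG.free t (DKG.unweight σ₀ (z t)))) := by
    simp only [DKG.free_unweight]
    refine DKG.contX_toState_unweight (fun t ht => ?_) fun t ht => ?_
    · exact DKG.tendsto_free (tendsto_id.mono_left nhdsWithin_le_nhds)
        (hz t ht).continuousWithinAt
    · rw [← DKG.free_unweight]
      exact (DKG.isReal_of_isReal_zero hZ hr0 t ht).free t
  have h0 : DKG.toState (DKG.free 0 (DKG.unweight σ₀ (z 0))) = u₀ := by
    rw [hz0, hyd]
    rw [DKG.free_apply, neg_zero]
    simp only [DKG.tr_zero]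
    exact DKG.toState_toPhase hd
  exact ⟨_, h0, hsol, hcont, fun v hv0 hv hvc => DKG.eq_of_isSolution hv hvc hsol
    (DKG.contX_zero_of_contX hcont) (hv0.trans h0.symm)⟩
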